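/- All functions are real-valued and $C^\infty$. Consider systems of conservation laws for two fields $(u,v)=(u^1,u^2)$, known up to order $\varepsilon^2$, $$u^i_t=\partial_x\alpha_i,\qquad \alpha_i=a_{i0}+\varepsilon(a_{i1}u_x+a_{i2}v_x)+\varepsilon^2(a_{i3}u_{xx}+a_{i4}v_{xx}+a_{i5}u_x^2+a_{i6}v_x^2+a_{i7}u_xv_x),\qquad i=1,2,$$ where the $a_{ik}$ are functions of $(u,v)$ on an open set $U\subseteq\mathbb R^2$. Such a system is a deformation of the $(2,1)$ flow of the principal hierarchy of $B_2$ with $c=-\tfrac12$ if $a_{10}=uv-\tfrac13u^3$ and $a_{20}=\tfrac12v^2$. Two systems with fluxes $\alpha,\beta$ commute up to order $\varepsilon^2$ if $$\{\alpha,\beta\}_i=\sum_{k,s}\Big(\partial_x^{s+1}\beta_k\,\frac{\partial\alpha_i}{\partial u^k_{(s)}}-\partial_x^{s+1}\alpha_k\,\frac{\partial\beta_i}{\partial u^k_{(s)}}\Big)=O(\varepsilon^3),\qquad i=1,2.$$ A system is integrable up to order $\varepsilon^2$ on $U$ if every symmetry $u^i_\tau=\partial_x h_i(u,v)$ on $U$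 of its dispersionless limit ($\varepsilon=0$) extends to a system of the above form on $U$ with $a_{i0}=h_i$ that commutes with it up to order $\varepsilon^2$. Given functions $F,G,H$ of one variable, put $$f=F(-\tfrac12u^2+v)\,u,\qquad g=G(-\tfrac12u^2+v)\,u^3+\frac{f^2}{3u},\qquad h=-\frac gu+H(v),$$ and let the normal form with parameters $F,G,H$ be $$u_t=\partial_x\Big[uv-\tfrac13u^3+\varepsilon f u_x+\varepsilon^2\big(a_{16}v_x^2+a_{17}u_xv_x\big)\Big],$$ $$v_t=\partial_x\Big[\tfrac12v^2+\varepsilon^2\big(g\,u_{xx}+h\,v_{xx}+a_{25}u_x^2+a_{26}v_x^2-a_{26}\,u\,u_xv_x\big)\Big],$$ where $$a_{16}=g_{vv}+\frac{ff_{vv}-h_v}{2u}-\frac{9g_v}{2u^2}+\frac{2ff_v+h}{u^3}+\frac g{u^4}-\frac{2f^2}{3u^5},\qquad a_{17}=-ug_{vv}-\tfrac12ff_{vv}+\frac{4g_v}u-\frac{ff_v}{u^2}+\frac{2f^2}{3u^4},$$ $$a_{25}=-ug_v+\frac{3g}u-\frac{2f^2}{3u^2},\qquad a_{26}=ug_{vv}-\frac{6g_v}u+\frac{8ff_v}{3u^2}+\frac{3g}{u^3}-\frac{4f^2}{3u^4}.$$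 **Theorem.** (1) Let a deformation of the $(2,1)$ flow for $c=-\tfrac12$ be integrable up to order $\varepsilon^2$ on an open set $U$. Then every point $(u_0,v_0)\in U$ with $u_0\neq0$ has an open neighbourhood $V\subseteq U\cap\{u\ne0\}$ on which, for some functions $F,G$ on $\{-\tfrac12u^2+v:(u,v)\in V\}$ and $H$ on $\{v:(u,v)\in V\}$, a Miura transformation $$w^i=u^i+\partial_x\big(\varepsilon M_i(u,v)+\varepsilon^2(N_{i1}(u,v)u_x+N_{i2}(u,v)v_x)\big),\qquad i=1,2,$$ carries the system, up to order $\varepsilon^2$, to the normal form with parameters $F,G,H$. (2) Conversely, $F,G,H$ are arbitrary: for every open $U\subseteq\{u\neq0\}$ and all functions $F,G$ on $\{-\tfrac12u^2+v:(u,v)\in U\}$ and $H$ on $\{v:(u,v)\in U\}$, the normal form is a deformation of the $(2,1)$ flow that is integrable up to order $\varepsilon^2$ on $U$. -/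

import Mathlib

open Set Filter Topology Asymptotics
open scoped ContDiff

namespace ConsLaw

/-- Jets (at a point `x`) of a pair of fields `(u, v)`:
`j 0 s` stands for `∂ₓˢ u` and `j 1 s` for `∂ₓˢ v`. -/
abbrev Jet : Type := Fin 2 → ℕ → ℝ

/-- The value `(u, v)` of the fields. -/
def Jet.base (j : Jet) : ℝ × ℝ := (j 0 0, j 1 0)

/-- The jet of `(uₓ, vₓ)`. -/
def Jet.shift (j : Jet) : Jet := fun k s => j k (s + 1)

/-- The total derivative `∂ₓ P = ∑_{k,s} (∂P/∂u^k_(s)) u^k_(s+1)` of a function of finitely many jet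
variables, written as the derivative of `P` in the direction `(u^k_(s+1))_{k,s}`. -/
noncomputable def Dx (P : Jet → ℝ) : Jet → ℝ := fun j => lineDeriv ℝ P j j.shift

/-- The jet `(∂ₓˢ Y^k)_{k,s}` of a pair `Y` of functions of the jet variables. -/
noncomputable def prolong (Y : Fin 2 → Jet → ℝ) (j : Jet) : Jet := fun k s => (Dx^[s] (Y k)) j

/-- The derivative `∑_{k,s} (∂P/∂u^k_(s)) ∂ₓˢ Y^k` of `P` along the evolutionary system
`u^k_t = Y^k`. -/
noncomputable def evol (Y : Fin 2 → Jet → ℝ) (P : Jet → ℝ) : Jet → ℝ :=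
  fun j => lineDeriv ℝ P j (prolong Y j)

/-- The right-hand side of the system of conservation laws `u^i_t = ∂ₓ α_i`. -/
noncomputable def flow (α : Fin 2 → Jet → ℝ) : Fin 2 → Jet → ℝ := fun i => Dx (α i)

/-- The bracket of the fluxes of two systems of conservation laws,
`{α, β}_i = ∑_{k,s} (∂ₓ^(s+1) β_k) ∂α_i/∂u^k_(s) - (∂ₓ^(s+1) α_k) ∂β_i/∂u^k_(s)`. -/
noncomputable def bracket (α β : Fin 2 → Jet → ℝ) (i : Fin 2) : Jet → ℝ :=
  fun j => evol (flow β) (α i) j - evol (flow α) (β i) j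

/-- A flux depending only on `(u, v)` and not on derivatives. -/
def hydro (h : Fin 2 → ℝ × ℝ → ℝ) : Fin 2 → Jet → ℝ := fun i j => h i j.base

/-- The coefficients of a flux of degree at most two in `ε`: `a i 0` is the dispersionless part and
`a i k`, `k = 1, …, 7`, are the coefficients displayed in `flux`. -/
abbrev Coeffs : Type := Fin 2 → Fin 8 → ℝ × ℝ → ℝ

/-- The flux
`a_{i0} + ε (a_{i1} uₓ + a_{i2} vₓ)
  + ε² (a_{i3} uₓₓ + a_{i4} vₓₓ + a_{i5} uₓ² + a_{i6} vₓ² + a_{i7} uₓ vₓ)`. -/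
def flux (a : Coeffs) (ε : ℝ) : Fin 2 → Jet → ℝ := fun i j =>
  a i 0 j.base
    + ε * (a i 1 j.base * j 0 1 + a i 2 j.base * j 1 1)
    + ε ^ 2 * (a i 3 j.base * j 0 2 + a i 4 j.base * j 1 2 + a i 5 j.base * (j 0 1) ^ 2
        + a i 6 j.base * (j 1 1) ^ 2 + a i 7 j.base * (j 0 1 * j 1 1))

/-- All coefficients are smooth on `U`. -/
def Coeffs.SmoothOn (a : Coeffs) (U : Set (ℝ × ℝ)) : Prop :=
  ∀ i k, ContDiffOn ℝ ∞ (a i k) U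

/-- The pair of functions `h` on `U` is the flux of a symmetry `u^i_τ = ∂ₓ (h_i(u, v))` of the
dispersionless limit of the system with coefficients `a`. -/
def IsDispersionlessSymmetry (U : Set (ℝ × ℝ)) (a : Coeffs) (h : Fin 2 → ℝ × ℝ → ℝ) : Prop :=
  (∀ i, ContDiffOn ℝ ∞ (h i) U) ∧
    ∀ j : Jet, j.base ∈ U → ∀ i, bracket (hydro fun k => a k 0) (hydro h) i j = 0

/-- The flows with coefficients `a` and `b` commute up to the order `ε²`. -/
def CommuteUpToTwo (U : Set (ℝ × ℝ)) (a b : Coeffs) : Prop :=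
  ∀ j : Jet, j.base ∈ U → ∀ i,
    (fun ε : ℝ => bracket (flux a ε) (flux b ε) i j) =O[𝓝 0] fun ε => ε ^ 3

/-- Integrability up to the order `ε²`: every symmetry of the dispersionless limit extends to a
symmetry of the full system up to that order. -/
def IntegrableUpToTwo (U : Set (ℝ × ℝ)) (a : Coeffs) : Prop :=
  ∀ h : Fin 2 → ℝ × ℝ → ℝ, IsDispersionlessSymmetry U a h →
    ∃ b : Coeffs, b.SmoothOn U ∧ (∀ i, ∀ p ∈ U, b i 0 p = h i p) ∧ CommuteUpToTwo U a b

/-- The potential `ε M_i(u, v) + ε² (N_{i1}(u, v) uₓ + N_{i2}(u, v) vₓ)` of a Miura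
transformation. -/
def miuraPotential (M : Fin 2 → ℝ × ℝ → ℝ) (N : Fin 2 → Fin 2 → ℝ × ℝ → ℝ) (ε : ℝ) :
    Fin 2 → Jet → ℝ := fun i j =>
  ε * M i j.base + ε ^ 2 * (N i 0 j.base * j 0 1 + N i 1 j.base * j 1 1)

/-- The Miura transformation `w^i = u^i + ∂ₓ K_i` with the potential `K`. -/
noncomputable def miura (K : Fin 2 → Jet → ℝ) : Fin 2 → Jet → ℝ :=
  fun i j => j i 0 + Dx (K i) j

/-- The Miura transformation `w^i = u^i + ∂ₓ K_i`, with `K` the potential given by `M` and `N`,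
carries the system `u^i_t = ∂ₓ α_i` with coefficients `a` to the system `w^i_t = ∂ₓ (α'_i(w))` with
coefficients `a'`, up to the order `ε²`. Along solutions `w^i_t = ∂ₓ (α_i + ∂ₜ K_i)`; the fluxes
`α_i + ∂ₜ K_i` and `α'_i(w)` are required to agree, `α'_i(w)` being evaluated at the jet of `w`. -/
def MiuraCarries (V : Set (ℝ × ℝ)) (M : Fin 2 → ℝ × ℝ → ℝ) (N : Fin 2 → Fin 2 → ℝ × ℝ → ℝ)
    (a a' : Coeffs) : Prop :=
  ∀ j : Jet, j.base ∈ V → ∀ i,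
    (fun ε : ℝ =>
        (flux a ε i j + evol (flow (flux a ε)) (miuraPotential M N ε i) j)
          - flux a' ε i (prolong (miura (miuraPotential M N ε)) j))
      =O[𝓝 0] fun ε => ε ^ 3

/-- The Riemann invariant `-u²/2 + v`. -/
noncomputable def riem (p : ℝ × ℝ) : ℝ := -(1 / 2) * p.1 ^ 2 + p.2

/-- The partial derivative in `v`. -/
noncomputable def dv (g : ℝ × ℝ → ℝ) : ℝ × ℝ → ℝ := fun p => deriv (fun t => g (p.1, t)) p.2

/-- The fluxes `(uv - u³/3, v²/2)` of the `(2,1)` flow of the principal hierarchy of `B₂` for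
`c = -1/2`. -/
noncomputable def flow21 : Fin 2 → ℝ × ℝ → ℝ :=
  ![fun p => p.1 * p.2 - 1 / 3 * p.1 ^ 3, fun p => 1 / 2 * p.2 ^ 2]

/-- A deformation, of order two in `ε` and in the form of conservation laws, of the `(2,1)` flow. -/
def IsDeformation (U : Set (ℝ × ℝ)) (a : Coeffs) : Prop :=
  a.SmoothOn U ∧ ∀ i, ∀ p ∈ U, a i 0 p = flow21 i p

/-- `f = F(-u²/2 + v) u`. -/
noncomputable def nfF (F : ℝ → ℝ) : ℝ × ℝ → ℝ := fun p => F (riem p) * p.1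

/-- `g = G(-u²/2 + v) u³ + f²/(3u)`. -/
noncomputable def nfG (F G : ℝ → ℝ) : ℝ × ℝ → ℝ :=
  fun p => G (riem p) * p.1 ^ 3 + nfF F p ^ 2 / (3 * p.1)

/-- `h = -g/u + H(v)`. -/
noncomputable def nfH (F G H : ℝ → ℝ) : ℝ × ℝ → ℝ :=
  fun p => -(nfG F G p) / p.1 + H p.2

noncomputable def nf16 (F G H : ℝ → ℝ) : ℝ × ℝ → ℝ := fun p =>
  let f := nfF F; let g := nfG F G; let h := nfH F G H; let u := p.1
  dv (dv g) p + 1 / 2 * ((f p * dv (dv f) p - dv h p) / u) - 9 / 2 * (dv g p / u ^ 2)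
    + (2 * f p * dv f p + h p) / u ^ 3 + g p / u ^ 4 - 2 / 3 * (f p ^ 2 / u ^ 5)

noncomputable def nf17 (F G : ℝ → ℝ) : ℝ × ℝ → ℝ := fun p =>
  let f := nfF F; let g := nfG F G; let u := p.1;
  -(u * dv (dv g) p) - 1 / 2 * (f p * dv (dv f) p) + 4 * dv g p / u - f p * dv f p / u ^ 2
    + 2 / 3 * (f p ^ 2 / u ^ 4)

noncomputable def nf25 (F G : ℝ → ℝ) : ℝ × ℝ → ℝ := fun p =>
  let f := nfF F; let g := nfG F G; let u := p.1;
  -(u * dv g p) + 3 * g p / u - 2 / 3 * (f p ^ 2 / u ^ 2)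

noncomputable def nf26 (F G : ℝ → ℝ) : ℝ × ℝ → ℝ := fun p =>
  let f := nfF F; let g := nfG F G; let u := p.1
  u * dv (dv g) p - 6 * dv g p / u + 8 / 3 * (f p * dv f p / u ^ 2) + 3 * g p / u ^ 3
    - 4 / 3 * (f p ^ 2 / u ^ 4)

/-- The normal form
`u_t = ∂ₓ [uv - u³/3 + ε f uₓ + ε² (a₁₆ vₓ² + a₁₇ uₓ vₓ)]`,
`v_t = ∂ₓ [v²/2 + ε² (g uₓₓ + h vₓₓ + a₂₅ uₓ² + a₂₆ vₓ² - a₂₆ u uₓ vₓ)]`. -/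
noncomputable def normalForm (F G H : ℝ → ℝ) : Coeffs :=
  ![![flow21 0, nfF F, 0, 0, 0, 0, nf16 F G H, nf17 F G],
    ![flow21 1, 0, 0, nfG F G, nfH F G H, nf25 F G, nf26 F G, fun p => -(nf26 F G p) * p.1]]

end ConsLaw

open ConsLaw

/-! Fluxes form a Lie algebra under the bracket. Sending a flux `α` to the derivation `cl α` along
`u_t = ∂ₓ α` turns brackets into commutators up to sign (`cl_br`), which gives the Jacobi identity
`br_br`. Up to `ε³`, a Miura transformation of the given type is the exponential of a derivation `ε
cl K + ε² cl K₂`. It acts on fluxes through the adjoint action and therefore preserves commutation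
(`br_exp₁`, `br_exp₂`). Commutation up to `ε²` is three bracket identities, and comparing jet
coefficients turns them into equations for functions of `(u, v)`.

At order `ε⁰`, where `u ≠ 0`, the symmetries `(h₁, h₂)` are the solutions of `∂_u h₂ = 0`, `(∂_u + u
∂_v) h₁ = ∂_v h₂`. For part (2), these equations, together with `(∂_u + u ∂_v) F = (∂_u + u ∂_v) G =
0` and `∂_u H = 0`, express every `u`-derivative through `v`-derivatives. An explicit extension of
the symmetry is then verified as a rational identity in `u` and these `v`-derivatives
(`exists_first_order`, `exists_second_order`).

Part (1) uses a single symmetry, the one with `h = (v - u²/2, 0)`. The functions `M` are chosen to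
make the first-order terms diagonal, by solving one equation along `∂_u` and one along `∂_u + u
∂_v`. Commutation then leaves only `φ u uₓ` in the first flux, with `φ` constant along `∂_u + u ∂_v`
(`first_order_normal`). At second order a potential with four free functions removes three
coefficients and imposes one relation, by algebra alone (`exists_second_order_shape`). The
commutation equations are triangular in the unknown coefficients of the symmetry; eliminating these
leaves exactly the normal form (`second_order_normal`). On a box in the coordinates `(v - u²/2, v)`
the functions constant along `∂_u + u ∂_v` or along `∂_u` are functions of one variable, which gives
`F, G, H` (`exists_adapted_nhd`). A Taylor estimate (`ext_sub_expPoly`) identifies the algebraic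
exponential with substitution of the transformed fields (`miuraCarries_of_exp`). -/

namespace ConsLaw
open TopologicalSpace

set_option linter.unusedSimpArgs false

/-! ### Smooth functions on an open set as a commutative algebra with commuting derivations. -/

/-- The algebra of smooth functions on an open set. -/
def SmoothFun (U : Opens (ℝ × ℝ)) : Subalgebra ℝ (U → ℝ) where
  carrier := {φ | ∃ g : ℝ × ℝ → ℝ, ContDiffOn ℝ ∞ g U ∧ ∀ p : U, φ p = g p}
  mul_mem' := by
    rintro φ ψ ⟨f, hf, hf'⟩ ⟨g, hg, hg'⟩
    exact ⟨fun p => f p * g p, hf.mul hg, fun p => by simp [hf', hg']⟩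
  add_mem' := by
    rintro φ ψ ⟨f, hf, hf'⟩ ⟨g, hg, hg'⟩
    exact ⟨fun p => f p + g p, hf.add hg, fun p => by simp [hf', hg']⟩
  algebraMap_mem' r := ⟨fun _ => r, contDiffOn_const, fun p => rfl⟩

namespace SmoothFun

variable {U : Opens (ℝ × ℝ)}

/-- Extension by zero. -/
noncomputable def ext (φ : SmoothFun U) : ℝ × ℝ → ℝ := Function.extend Subtype.val φ.1 0

theorem ext_apply (φ : SmoothFun U) (p : U) : ext φ p = φ.1 p :=
  Subtype.val_injective.extend_apply _ _ _

theorem contDiffOn_ext (φ : SmoothFun U) : ContDiffOn ℝ ∞ (ext φ) U := by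
  obtain ⟨g, hg, h⟩ := φ.2
  exact hg.congr fun p hp => by rw [ext_apply φ ⟨p, hp⟩, h]

theorem contDiffAt_ext (φ : SmoothFun U) (p : U) : ContDiffAt ℝ ∞ (ext φ) p :=
  (contDiffOn_ext φ).contDiffAt (U.2.mem_nhds p.2)

theorem differentiableAt_ext (φ : SmoothFun U) (p : U) : DifferentiableAt ℝ (ext φ) p :=
  (contDiffAt_ext φ p).differentiableAt (by simp)

/-- The restriction of a smooth function. -/
def mk (g : ℝ × ℝ → ℝ) (hg : ContDiffOn ℝ ∞ g U) : SmoothFun U :=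
  ⟨fun p => g p, g, hg, fun _ => rfl⟩

theorem ext_eventuallyEq {φ : SmoothFun U} {g : ℝ × ℝ → ℝ} (h : ∀ p : U, φ.1 p = g p) (p : U) :
    ext φ =ᶠ[𝓝 (p : ℝ × ℝ)] g := by
  filter_upwards [U.2.mem_nhds p.2] with q hq
  rw [ext_apply φ ⟨q, hq⟩, h]

theorem eq_of_forall {φ ψ : SmoothFun U} (h : ∀ p, φ.1 p = ψ.1 p) : φ = ψ :=
  Subtype.ext (funext h)

/-- Evaluation at a point. -/
def ev (p : U) : SmoothFun U →ₐ[ℝ] ℝ := (Pi.evalAlgHom ℝ (fun _ : U => ℝ) p).comp (SmoothFun U).val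

theorem ev_apply (p : U) (φ : SmoothFun U) : ev p φ = φ.1 p := rfl

@[simp] theorem ev_mk (p : U) (g : ℝ × ℝ → ℝ) (hg : ContDiffOn ℝ ∞ g U) : ev p (mk g hg) = g p :=
  rfl

theorem eq_of_ev {φ ψ : SmoothFun U} (h : ∀ p, ev p φ = ev p ψ) : φ = ψ := eq_of_forall h

/-- The derivative in the direction `e`. -/
noncomputable def pd (e : ℝ × ℝ) : Derivation ℝ (SmoothFun U) (SmoothFun U) :=
  Derivation.mk'
    { toFun := fun φ => ⟨fun p => fderiv ℝ (ext φ) p e, fun p => fderiv ℝ (ext φ) p e,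
        ((contDiffOn_ext φ).fderiv_of_isOpen U.2 (by simp)).clm_apply contDiffOn_const,
        fun _ => rfl⟩
      map_add' := fun φ ψ => eq_of_forall fun p => by
        have h : ext (φ + ψ) =ᶠ[𝓝 (p : ℝ × ℝ)] ext φ + ext ψ :=
          ext_eventuallyEq (fun q => by simp [ext_apply]) p
        change fderiv ℝ (ext (φ + ψ)) p e = fderiv ℝ (ext φ) p e + fderiv ℝ (ext ψ) p e
        rw [h.fderiv_eq, fderiv_add (differentiableAt_ext φ p) (differentiableAt_ext ψ p)]
        rfl
      map_smul' := fun r φ => eq_of_forall fun p => by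
        have h : ext (r • φ) =ᶠ[𝓝 (p : ℝ × ℝ)] r • ext φ :=
          ext_eventuallyEq (fun q => by simp [ext_apply]) p
        change fderiv ℝ (ext (r • φ)) p e = r * fderiv ℝ (ext φ) p e
        rw [h.fderiv_eq, fderiv_const_smul (differentiableAt_ext φ p)]
        rfl }
    (fun φ ψ => eq_of_forall fun p => by
      have h : ext (φ * ψ) =ᶠ[𝓝 (p : ℝ × ℝ)] ext φ * ext ψ :=
        ext_eventuallyEq (fun q => by simp [ext_apply]) p
      change fderiv ℝ (ext (φ * ψ)) p e
        = φ.1 p * fderiv ℝ (ext ψ) p e + ψ.1 p * fderiv ℝ (ext φ) p e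
      rw [h.fderiv_eq, fderiv_mul (differentiableAt_ext φ p) (differentiableAt_ext ψ p)]
      simp [ext_apply])

theorem ev_pd (e : ℝ × ℝ) (φ : SmoothFun U) (p : U) : ev p (pd e φ) = fderiv ℝ (ext φ) p e := rfl

theorem ev_pd_of_eq (e : ℝ × ℝ) {φ : SmoothFun U} {g : ℝ × ℝ → ℝ} (h : ∀ p : U, ev p φ = g p)
    (p : U) : ev p (pd e φ) = fderiv ℝ g p e := by
  rw [ev_pd, (ext_eventuallyEq h p).fderiv_eq]

theorem pd_comm (e e' : ℝ × ℝ) (φ : SmoothFun U) : pd e (pd e' φ) = pd e' (pd e φ) := by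
  have key : ∀ (a b : ℝ × ℝ) (p : U), ev p (pd a (pd b φ)) = fderiv ℝ (fderiv ℝ (ext φ)) p a b := by
    intro a b p
    rw [ev_pd_of_eq a (g := fun q => fderiv ℝ (ext φ) q b) (fun q => ev_pd b φ q)]
    have h : DifferentiableAt ℝ (fderiv ℝ (ext φ)) p :=
      (((contDiffOn_ext φ).fderiv_of_isOpen U.2 (m := ∞) (by simp)).contDiffAt
        (U.2.mem_nhds p.2)).differentiableAt (by simp)
    rw [fderiv_clm_apply h (differentiableAt_const b)]
    simp
  refine eq_of_ev fun p => ?_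
  rw [key, key]
  exact (contDiffAt_ext φ p).isSymmSndFDerivAt
    (by simpa using WithTop.coe_le_coe.2 (le_top : (2 : ℕ∞) ≤ ⊤)) e e'

/-- The partial derivative in `u`. -/
noncomputable abbrev pu : Derivation ℝ (SmoothFun U) (SmoothFun U) := pd (1, 0)

/-- The partial derivative in `v`. -/
noncomputable abbrev pv : Derivation ℝ (SmoothFun U) (SmoothFun U) := pd (0, 1)

/-- The coordinate `u`. -/
def cu : SmoothFun U := mk Prod.fst contDiffOn_fst

/-- The coordinate `v`. -/
def cv : SmoothFun U := mk Prod.snd contDiffOn_snd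

@[simp] theorem ev_cu (p : U) : ev p cu = p.1.1 := rfl
@[simp] theorem ev_cv (p : U) : ev p cv = p.1.2 := rfl

@[simp] theorem pd_cu (e : ℝ × ℝ) : pd e (cu : SmoothFun U) = algebraMap ℝ _ e.1 :=
  eq_of_ev fun p => by
    rw [ev_pd_of_eq e ev_cu, AlgHom.commutes]
    simp [fderiv_fst]

@[simp] theorem pd_cv (e : ℝ × ℝ) : pd e (cv : SmoothFun U) = algebraMap ℝ _ e.2 :=
  eq_of_ev fun p => by
    rw [ev_pd_of_eq e ev_cv, AlgHom.commutes]
    simp [fderiv_snd]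

section Calculus

variable (e : ℝ × ℝ) (p : U) (φ ψ : SmoothFun U) (n : ℕ)

theorem pd_add : pd e (φ + ψ) = pd e φ + pd e ψ := map_add _ _ _
theorem pd_sub : pd e (φ - ψ) = pd e φ - pd e ψ := map_sub _ _ _
theorem pd_neg : pd e (-φ) = -pd e φ := map_neg _ _
theorem pd_zero : pd e (0 : SmoothFun U) = 0 := map_zero _
theorem pd_one : pd e (1 : SmoothFun U) = 0 := Derivation.map_one_eq_zero _
theorem pd_mul : pd e (φ * ψ) = φ * pd e ψ + ψ * pd e φ := Derivation.leibniz _ _ _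
theorem pd_natCast : pd e (n : SmoothFun U) = 0 := Derivation.map_natCast _ n
theorem pd_ofNat [n.AtLeastTwo] : pd e (ofNat(n) : SmoothFun U) = 0 := Derivation.map_natCast _ n
theorem pd_pow : pd e (φ ^ n) = n * φ ^ (n - 1) * pd e φ := by
  rw [Derivation.leibniz_pow, nsmul_eq_mul, smul_eq_mul, mul_assoc]

theorem ev_add : ev p (φ + ψ) = ev p φ + ev p ψ := rfl
theorem ev_sub : ev p (φ - ψ) = ev p φ - ev p ψ := rfl
theorem ev_neg : ev p (-φ) = -ev p φ := rfl
theorem ev_zero : ev p 0 = 0 := rfl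
theorem ev_one : ev p 1 = 1 := rfl
theorem ev_mul : ev p (φ * ψ) = ev p φ * ev p ψ := rfl
theorem ev_natCast : ev p n = n := rfl
theorem ev_ofNat [n.AtLeastTwo] : ev p ofNat(n) = OfNat.ofNat n := rfl
theorem ev_pow : ev p (φ ^ n) = ev p φ ^ n := rfl

end Calculus

theorem pv_pu (φ : SmoothFun U) : pv (pu φ) = pu (pv φ) := pd_comm _ _ _

theorem ev_pd_eq_add (p : U) (φ : SmoothFun U) (e : ℝ × ℝ) :
    fderiv ℝ (ext φ) p e = e.1 * ev p (pu φ) + e.2 * ev p (pv φ) := by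
  have : e = e.1 • ((1, 0) : ℝ × ℝ) + e.2 • ((0, 1) : ℝ × ℝ) := by ext <;> simp
  conv_lhs => rw [this, map_add, map_smul, map_smul]
  rfl

/-- Both derivatives are local, so agreement on the open set `U` suffices. This links the
one-variable derivative used in the normal form with the derivation `pv`, and it can be iterated. -/
theorem dv_eq {g : ℝ × ℝ → ℝ} {φ : SmoothFun U} (h : ∀ p : U, ev p φ = g p) (p : U) :
    ev p (pv φ) = dv g p := by
  rw [ev_pd]
  have h1 : HasDerivAt (fun t : ℝ => ext φ (p.1.1, t)) (fderiv ℝ (ext φ) p (0, 1)) p.1.2 :=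
    HasFDerivAt.comp_hasDerivAt (x := p.1.2) (f := fun t : ℝ => (p.1.1, t)) (l := ext φ)
      (differentiableAt_ext φ p).hasFDerivAt ((hasDerivAt_const _ _).prodMk (hasDerivAt_id _))
  rw [← h1.deriv]
  refine Filter.EventuallyEq.deriv_eq ?_
  have : Tendsto (fun t : ℝ => (p.1.1, t)) (𝓝 p.1.2) (𝓝 (p : ℝ × ℝ)) :=
    (Continuous.prodMk_right p.1.1).tendsto _
  exact this.eventually (ext_eventuallyEq h p)

end SmoothFun

/-! ### Differential polynomials and evolutionary derivations. -/

/-- The jets with base point in `U`. -/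
abbrev JetsOver (U : Opens (ℝ × ℝ)) : Type := {j : Jet // j.base ∈ U}

/-- The base point of a jet. -/
def JetsOver.pt {U : Opens (ℝ × ℝ)} (j : JetsOver U) : U := ⟨j.1.base, j.2⟩

/-- The algebra of differential polynomials with smooth coefficients. -/
def DiffFun (U : Opens (ℝ × ℝ)) : Subalgebra ℝ (JetsOver U → ℝ) :=
  Algebra.adjoin ℝ ({P | ∃ φ : SmoothFun U, P = fun j => SmoothFun.ev j.pt φ} ∪
    {P | ∃ k s, P = fun j => j.1 k s})

namespace DiffFun

open SmoothFun

variable {U : Opens (ℝ × ℝ)}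

/-- Evaluation at a jet. -/
def ev (j : JetsOver U) : DiffFun U →ₐ[ℝ] ℝ :=
  (Pi.evalAlgHom ℝ (fun _ : JetsOver U => ℝ) j).comp (DiffFun U).val

theorem eq_of_ev {P Q : DiffFun U} (h : ∀ j, ev j P = ev j Q) : P = Q :=
  Subtype.ext (funext h)

/-- Smooth functions as differential polynomials. -/
def coef : SmoothFun U →ₐ[ℝ] DiffFun U where
  toFun φ := ⟨fun j => SmoothFun.ev j.pt φ, Algebra.subset_adjoin (Or.inl ⟨φ, rfl⟩)⟩
  map_one' := eq_of_ev fun _ => rfl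
  map_mul' _ _ := eq_of_ev fun _ => rfl
  map_zero' := eq_of_ev fun _ => rfl
  map_add' _ _ := eq_of_ev fun _ => rfl
  commutes' _ := eq_of_ev fun _ => rfl

/-- The jet coordinates. -/
def q (k : Fin 2) (s : ℕ) : DiffFun U :=
  ⟨fun j => j.1 k s, Algebra.subset_adjoin (Or.inr ⟨k, s, rfl⟩)⟩

@[simp] theorem ev_coef (j : JetsOver U) (φ : SmoothFun U) : ev j (coef φ) = SmoothFun.ev j.pt φ :=
  rfl

@[simp] theorem ev_q (j : JetsOver U) (k : Fin 2) (s : ℕ) : ev j (q k s) = j.1 k s := rfl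

@[elab_as_elim]
theorem induction {p : DiffFun U → Prop} (hc : ∀ φ, p (coef φ)) (hq : ∀ k s, p (q k s))
    (hadd : ∀ P Q, p P → p Q → p (P + Q)) (hmul : ∀ P Q, p P → p Q → p (P * Q)) (P : DiffFun U) :
    p P := by
  obtain ⟨P, hP⟩ := P
  induction hP using Algebra.adjoin_induction with
  | mem x hx =>
    rcases hx with ⟨φ, rfl⟩ | ⟨k, s, rfl⟩
    · exact hc φ
    · exact hq k s
  | algebraMap r => exact hc (algebraMap ℝ _ r)
  | add x y _ _ hx hy => exact hadd _ _ hx hy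
  | mul x y _ _ hx hy => exact hmul _ _ hx hy

/-- Extension by zero. -/
noncomputable def ext (P : DiffFun U) : Jet → ℝ := Function.extend Subtype.val P.1 0

theorem ext_apply (P : DiffFun U) (j : JetsOver U) : ext P j = ev j P :=
  Subtype.val_injective.extend_apply _ _ _

/-- Lying over `U` constrains only two coordinates, so a line through a jet stays over `U` for small
times. Line derivatives are thus local over `U`, whatever the topology on the space of jets. -/
theorem eventually_mem (j : JetsOver U) (y : Jet) :
    ∀ᶠ t : ℝ in 𝓝 0, ((j : Jet) + t • y).base ∈ U := by
  have : Continuous fun t : ℝ => ((j : Jet) + t • y).base := by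
    simp only [Jet.base, Pi.add_apply, Pi.smul_apply, smul_eq_mul]
    fun_prop
  refine this.continuousAt.eventually (U.2.mem_nhds ?_)
  simpa using j.2

theorem lineDeriv_congr {P Q : Jet → ℝ} (h : ∀ j : JetsOver U, P j = Q j) (j : JetsOver U)
    (y : Jet) : lineDeriv ℝ P j y = lineDeriv ℝ Q j y := by
  refine Filter.EventuallyEq.deriv_eq ?_
  filter_upwards [eventually_mem j y] with t ht using h ⟨_, ht⟩

theorem hasLineDerivAt_congr {P Q : Jet → ℝ} (h : ∀ j : JetsOver U, P j = Q j) {j : JetsOver U}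
    {y : Jet} {d : ℝ} (hQ : HasLineDerivAt ℝ Q d j y) : HasLineDerivAt ℝ P d j y := by
  refine HasDerivAt.congr_of_eventuallyEq (show HasDerivAt _ _ _ from hQ) ?_
  filter_upwards [eventually_mem j y] with t ht using h ⟨_, ht⟩

theorem hasLineDerivAt_coef (φ : SmoothFun U) (j : JetsOver U) (y : Jet) :
    HasLineDerivAt ℝ (ext (coef φ))
      (y 0 0 * SmoothFun.ev j.pt (pu φ) + y 1 0 * SmoothFun.ev j.pt (pv φ)) j y := by
  refine hasLineDerivAt_congr (Q := fun i => SmoothFun.ext φ i.base)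
    (fun i => by rw [ext_apply, ev_coef]; exact (SmoothFun.ext_apply φ i.pt).symm) ?_
  have h := SmoothFun.ev_pd_eq_add j.pt φ (y 0 0, y 1 0)
  have h2 : HasDerivAt (fun t : ℝ => ((j : Jet) + t • y).base) (y 0 0, y 1 0) 0 := by
    refine HasDerivAt.prodMk ?_ ?_
    · simpa using ((hasDerivAt_id (0 : ℝ)).mul_const (y 0 0)).const_add (j.1 0 0)
    · simpa using ((hasDerivAt_id (0 : ℝ)).mul_const (y 1 0)).const_add (j.1 1 0)
  have h3 : HasFDerivAt (SmoothFun.ext φ) (fderiv ℝ (SmoothFun.ext φ) j.pt)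
      (((j : Jet) + (0 : ℝ) • y).base) := by
    rw [zero_smul, add_zero]
    exact (SmoothFun.differentiableAt_ext φ j.pt).hasFDerivAt
  have := h3.comp_hasDerivAt (0 : ℝ) h2
  rw [h] at this
  exact this

theorem hasLineDerivAt_q (k : Fin 2) (s : ℕ) (j : JetsOver U) (y : Jet) :
    HasLineDerivAt ℝ (ext (q k s : DiffFun U)) (y k s) j y := by
  refine hasLineDerivAt_congr (Q := fun i => i k s) (fun i => by rw [ext_apply, ev_q]) ?_
  have := ((hasDerivAt_id (0 : ℝ)).mul_const (y k s)).const_add (j.1 k s)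
  simpa [HasLineDerivAt] using this

theorem hasLineDerivAt_add_ext {P Q : DiffFun U} {a b : ℝ} {j : JetsOver U} {y : Jet}
    (hP : HasLineDerivAt ℝ (ext P) a j y) (hQ : HasLineDerivAt ℝ (ext Q) b j y) :
    HasLineDerivAt ℝ (ext (P + Q)) (a + b) j y :=
  hasLineDerivAt_congr (Q := fun i => ext P i + ext Q i) (fun i => by simp [ext_apply])
    (HasDerivAt.add hP hQ)

theorem hasLineDerivAt_mul_ext {P Q : DiffFun U} {a b : ℝ} {j : JetsOver U} {y : Jet}
    (hP : HasLineDerivAt ℝ (ext P) a j y) (hQ : HasLineDerivAt ℝ (ext Q) b j y) :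
    HasLineDerivAt ℝ (ext (P * Q)) (ev j P * b + ev j Q * a) j y := by
  refine hasLineDerivAt_congr (Q := fun i => ext P i * ext Q i) (fun i => by simp [ext_apply]) ?_
  have h := HasDerivAt.mul hP hQ
  simp only [zero_smul, add_zero, ext_apply] at h
  rw [add_comm, mul_comm (ev j Q)]
  exact h

theorem lineDifferentiableAt_ext (P : DiffFun U) (j : JetsOver U) (y : Jet) :
    LineDifferentiableAt ℝ (ext P) j y := by
  induction P using DiffFun.induction with
  | hc φ => exact (hasLineDerivAt_coef φ j y).lineDifferentiableAt
  | hq k s => exact (hasLineDerivAt_q k s j y).lineDifferentiableAt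
  | hadd P Q hP hQ => exact (hasLineDerivAt_add_ext hP.hasLineDerivAt hQ.hasLineDerivAt).lineDifferentiableAt
  | hmul P Q hP hQ => exact (hasLineDerivAt_mul_ext hP.hasLineDerivAt hQ.hasLineDerivAt).lineDifferentiableAt

theorem lineDeriv_mul_ext (P Q : DiffFun U) (j : JetsOver U) (y : Jet) :
    lineDeriv ℝ (ext (P * Q)) j y
      = ev j P * lineDeriv ℝ (ext Q) j y + ev j Q * lineDeriv ℝ (ext P) j y :=
  (hasLineDerivAt_mul_ext (lineDifferentiableAt_ext P j y).hasLineDerivAt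
    (lineDifferentiableAt_ext Q j y).hasLineDerivAt).lineDeriv

theorem lineDeriv_add_ext (P Q : DiffFun U) (j : JetsOver U) (y : Jet) :
    lineDeriv ℝ (ext (P + Q)) j y = lineDeriv ℝ (ext P) j y + lineDeriv ℝ (ext Q) j y :=
  (hasLineDerivAt_add_ext (lineDifferentiableAt_ext P j y).hasLineDerivAt
    (lineDifferentiableAt_ext Q j y).hasLineDerivAt).lineDeriv

/-- The jet with the coordinates given by the values of `Y`. -/
def jetOf (Y : Fin 2 → ℕ → DiffFun U) (j : JetsOver U) : Jet := fun k s => ev j (Y k s)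

/-- The Leibniz rule reduces this to the generators. Infinitely many components of `Y` cause no
trouble, since each generator involves at most two of them. -/
theorem lineDeriv_mem (Y : Fin 2 → ℕ → DiffFun U) (P : DiffFun U) :
    (fun j : JetsOver U => lineDeriv ℝ (ext P) j (jetOf Y j)) ∈ DiffFun U := by
  induction P using DiffFun.induction with
  | hc φ =>
    convert (Y 0 0 * coef (pu φ) + Y 1 0 * coef (pv φ)).2 using 1
    exact funext fun j => (hasLineDerivAt_coef φ j _).lineDeriv
  | hq k s =>
    convert (Y k s).2 using 1
    exact funext fun j => (hasLineDerivAt_q k s j _).lineDeriv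
  | hadd P Q hP hQ =>
    convert add_mem hP hQ using 1
    exact funext fun j => lineDeriv_add_ext P Q j _
  | hmul P Q hP hQ =>
    convert add_mem (mul_mem P.2 hQ) (mul_mem Q.2 hP) using 1
    exact funext fun j => lineDeriv_mul_ext P Q j _

/-- The derivative along the vector field with the components `Y` on the space of jets. -/
noncomputable def along (Y : Fin 2 → ℕ → DiffFun U) : Derivation ℝ (DiffFun U) (DiffFun U) :=
  Derivation.mk'
    { toFun := fun P => ⟨fun j => lineDeriv ℝ (ext P) j (jetOf Y j), lineDeriv_mem Y P⟩
      map_add' := fun P Q => eq_of_ev fun j => lineDeriv_add_ext P Q j _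
      map_smul' := fun r P => eq_of_ev fun j => by
        -- A scalar multiple is a product with a constant coefficient, so homogeneity follows from
        -- the Leibniz rule.
        have h : lineDeriv ℝ (ext (coef (algebraMap ℝ (SmoothFun U) r))) j (jetOf Y j) = 0 := by
          rw [(hasLineDerivAt_coef _ j _).lineDeriv]
          simp
        have h2 := lineDeriv_mul_ext (coef (algebraMap ℝ (SmoothFun U) r)) P j (jetOf Y j)
        rw [h, mul_zero, add_zero, AlgHom.commutes, ← Algebra.smul_def, AlgHom.commutes] at h2
        exact h2 }
    (fun P Q => eq_of_ev fun j => lineDeriv_mul_ext P Q j _)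

theorem ev_along (Y : Fin 2 → ℕ → DiffFun U) (P : DiffFun U) (j : JetsOver U) :
    ev j (along Y P) = lineDeriv ℝ (ext P) j (jetOf Y j) := rfl

@[simp] theorem along_coef (Y : Fin 2 → ℕ → DiffFun U) (φ : SmoothFun U) :
    along Y (coef φ) = coef (pu φ) * Y 0 0 + coef (pv φ) * Y 1 0 :=
  eq_of_ev fun j => by
    rw [ev_along, (hasLineDerivAt_coef φ j _).lineDeriv]
    simp [jetOf, mul_comm]

@[simp] theorem along_q (Y : Fin 2 → ℕ → DiffFun U) (k : Fin 2) (s : ℕ) :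
    along Y (q k s) = Y k s :=
  eq_of_ev fun j => by
    rw [ev_along, (hasLineDerivAt_q k s j _).lineDeriv]
    rfl

/-- The coefficients and the jet coordinates generate the algebra. The identities between
derivations below are checked on these generators. -/
theorem derivation_ext {X Y : Derivation ℝ (DiffFun U) (DiffFun U)}
    (hc : ∀ φ, X (coef φ) = Y (coef φ)) (hq : ∀ k s, X (q k s) = Y (q k s)) : X = Y := by
  ext1 P
  induction P using DiffFun.induction with
  | hc φ => exact hc φ
  | hq k s => exact hq k s
  | hadd P Q hP hQ => rw [map_add, map_add, hP, hQ]
  | hmul P Q hP hQ => rw [Derivation.leibniz, Derivation.leibniz, hP, hQ]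

/-- The total derivative. -/
noncomputable def D : Derivation ℝ (DiffFun U) (DiffFun U) := along fun k s => q k (s + 1)

/-- The derivation along the evolutionary system `u^i_t = Y^i`. -/
noncomputable def evo (Y : Fin 2 → DiffFun U) : Derivation ℝ (DiffFun U) (DiffFun U) :=
  along fun k s => D^[s] (Y k)

theorem D_coef (φ : SmoothFun U) : D (coef φ) = coef (pu φ) * q 0 1 + coef (pv φ) * q 1 1 :=
  along_coef _ _

theorem D_q (k : Fin 2) (s : ℕ) : D (q k s : DiffFun U) = q k (s + 1) := along_q _ _ _

theorem evo_coef (Y : Fin 2 → DiffFun U) (φ : SmoothFun U) :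
    evo Y (coef φ) = coef (pu φ) * Y 0 + coef (pv φ) * Y 1 := along_coef _ _

theorem evo_q (Y : Fin 2 → DiffFun U) (k : Fin 2) (s : ℕ) : evo Y (q k s) = D^[s] (Y k) :=
  along_q _ _ _

/-- On jet coordinates the two sides agree by the definition of the prolongation; on coefficients
the point is the symmetry of mixed partial derivatives. -/
theorem D_evo (Y : Fin 2 → DiffFun U) (P : DiffFun U) : D (evo Y P) = evo Y (D P) := by
  have h : ⁅(D : Derivation ℝ (DiffFun U) (DiffFun U)), evo Y⁆ = 0 := by
    refine derivation_ext (fun φ => ?_) fun k s => ?_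
    · simp only [Derivation.commutator_apply, D_coef, evo_coef, map_add, Derivation.leibniz, evo_q,
        pv_pu, smul_eq_mul, Function.iterate_one, Derivation.coe_zero, Pi.zero_apply]
      ring
    · rw [Derivation.commutator_apply, D_q, evo_q, evo_q, Function.iterate_succ_apply', sub_self]
      rfl
  have := congrArg (fun X : Derivation ℝ (DiffFun U) (DiffFun U) => X P) h
  exact sub_eq_zero.1 this

theorem D_iterate_evo (Y : Fin 2 → DiffFun U) (s : ℕ) (P : DiffFun U) :
    D^[s] (evo Y P) = evo Y (D^[s] P) :=
  (Function.Commute.iterate_left (f := D) (g := evo Y) (fun P => D_evo Y P) s) P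

theorem D_iterate_sub (s : ℕ) (P Q : DiffFun U) : D^[s] (P - Q) = D^[s] P - D^[s] Q :=
  iterate_map_sub D s P Q

/-- Since evolutionary derivations commute with `D`, a commutator is determined on all jet
coordinates by its values on `u` and `v`. -/
theorem evo_commutator (Y Z : Fin 2 → DiffFun U) :
    ⁅evo Y, evo Z⁆ = evo fun i => evo Y (Z i) - evo Z (Y i) := by
  refine derivation_ext (fun φ => ?_) fun k s => ?_
  · simp only [Derivation.commutator_apply, evo_coef, map_add, Derivation.leibniz,
      pv_pu, smul_eq_mul]
    ring
  · rw [Derivation.commutator_apply, evo_q, evo_q, evo_q, D_iterate_sub, D_iterate_evo,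
      D_iterate_evo]

theorem along_add (Y Z : Fin 2 → ℕ → DiffFun U) :
    along (fun k s => Y k s + Z k s) = along Y + along Z := by
  refine derivation_ext (fun φ => ?_) fun k s => ?_
  · simp only [along_coef, Derivation.add_apply]
    ring
  · simp

theorem along_smul (r : ℝ) (Y : Fin 2 → ℕ → DiffFun U) :
    along (fun k s => r • Y k s) = r • along Y := by
  refine derivation_ext (fun φ => ?_) fun k s => ?_
  · simp [along_coef]
  · simp

end DiffFun

/-! ### The Lie bracket of fluxes and the exponential of its adjoint action. -/

namespace DiffFun

open SmoothFun

variable {U : Opens (ℝ × ℝ)}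

theorem evo_add (Y Z : Fin 2 → DiffFun U) : evo (Y + Z) = evo Y + evo Z := by
  rw [evo, evo, evo, ← along_add]
  congr 1
  funext k s
  exact iterate_map_add D s _ _

theorem evo_smul (r : ℝ) (Y : Fin 2 → DiffFun U) : evo (r • Y) = r • evo Y := by
  rw [evo, evo, ← along_smul]
  congr 1
  funext k s
  induction s with
  | zero => rfl
  | succ s ih => rw [Function.iterate_succ_apply', ih, Derivation.map_smul, Function.iterate_succ_apply']

/-- The derivation along the system of conservation laws with the flux `α`. -/
noncomputable def cl (α : Fin 2 → DiffFun U) : Derivation ℝ (DiffFun U) (DiffFun U) :=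
  evo fun k => D (α k)

theorem cl_add (α β : Fin 2 → DiffFun U) : cl (α + β) = cl α + cl β := by
  rw [cl, cl, cl, ← evo_add]
  congr 1
  funext k
  exact map_add _ _ _

theorem cl_smul (r : ℝ) (α : Fin 2 → DiffFun U) : cl (r • α) = r • cl α := by
  rw [cl, cl, ← evo_smul]
  congr 1
  funext k
  exact Derivation.map_smul D r _

theorem cl_coef (α : Fin 2 → DiffFun U) (φ : SmoothFun U) :
    cl α (coef φ) = coef (pu φ) * D (α 0) + coef (pv φ) * D (α 1) := evo_coef _ _

theorem cl_q (α : Fin 2 → DiffFun U) (k : Fin 2) (s : ℕ) : cl α (q k s) = D^[s + 1] (α k) := by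
  rw [cl, evo_q, Function.iterate_succ_apply]

section Calculus

variable (α : Fin 2 → DiffFun U) (φ ψ : SmoothFun U) (P Q : DiffFun U) (n : ℕ)

theorem coef_add : coef (φ + ψ) = coef φ + coef ψ := rfl
theorem coef_sub : coef (φ - ψ) = coef φ - coef ψ := rfl
theorem coef_neg : coef (-φ) = -coef φ := rfl
theorem coef_mul : coef (φ * ψ) = coef φ * coef ψ := rfl
theorem coef_pow : coef (φ ^ n) = coef φ ^ n := map_pow _ _ _
theorem coef_zero : coef (0 : SmoothFun U) = 0 := rfl
theorem coef_one : coef (1 : SmoothFun U) = 1 := rfl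
theorem coef_natCast : coef (n : SmoothFun U) = n := rfl
theorem coef_ofNat [n.AtLeastTwo] : coef (ofNat(n) : SmoothFun U) = OfNat.ofNat n := rfl

theorem D_add : D (P + Q) = D P + D Q := map_add _ _ _
theorem D_neg : D (-P) = -D P := map_neg _ _
theorem D_sub : D (P - Q) = D P - D Q := map_sub _ _ _
theorem D_zero : D (0 : DiffFun U) = 0 := map_zero _
theorem D_one : D (1 : DiffFun U) = 0 := Derivation.map_one_eq_zero _
theorem D_mul : D (P * Q) = P * D Q + Q * D P := Derivation.leibniz _ _ _
theorem D_ofNat [n.AtLeastTwo] : D (ofNat(n) : DiffFun U) = 0 := Derivation.map_natCast _ n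
theorem D_pow : D (P ^ n) = n * P ^ (n - 1) * D P := by
  rw [Derivation.leibniz_pow, nsmul_eq_mul, smul_eq_mul, mul_assoc]

theorem cl_apply_add : cl α (P + Q) = cl α P + cl α Q := map_add _ _ _
theorem cl_apply_neg : cl α (-P) = -cl α P := map_neg _ _
theorem cl_apply_zero : cl α 0 = 0 := map_zero _
theorem cl_apply_mul : cl α (P * Q) = P * cl α Q + Q * cl α P := Derivation.leibniz _ _ _
theorem cl_apply_pow : cl α (P ^ n) = n * P ^ (n - 1) * cl α P := by
  rw [Derivation.leibniz_pow, nsmul_eq_mul, smul_eq_mul, mul_assoc]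

variable (j : JetsOver U)

theorem eval_add : ev j (P + Q) = ev j P + ev j Q := rfl
theorem eval_sub : ev j (P - Q) = ev j P - ev j Q := rfl
theorem eval_neg : ev j (-P) = -ev j P := rfl
theorem eval_mul : ev j (P * Q) = ev j P * ev j Q := rfl
theorem eval_pow : ev j (P ^ n) = ev j P ^ n := rfl
theorem eval_zero : ev j 0 = 0 := rfl
theorem eval_one : ev j 1 = 1 := rfl
theorem eval_natCast : ev j n = n := rfl
theorem eval_ofNat [n.AtLeastTwo] : ev j ofNat(n) = OfNat.ofNat n := rfl

end Calculus

/-- The bracket of fluxes. -/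
noncomputable def br (α β : Fin 2 → DiffFun U) : Fin 2 → DiffFun U :=
  fun i => cl β (α i) - cl α (β i)

theorem br_apply (α β : Fin 2 → DiffFun U) (i : Fin 2) : br α β i = cl β (α i) - cl α (β i) := rfl

theorem br_add_left (α β γ : Fin 2 → DiffFun U) : br (α + β) γ = br α γ + br β γ := by
  funext i
  simp only [br, cl_add, Pi.add_apply, map_add, Derivation.add_apply]
  ring

theorem br_add_right (α β γ : Fin 2 → DiffFun U) : br α (β + γ) = br α β + br α γ := by
  funext i
  simp only [br, cl_add, Pi.add_apply, map_add, Derivation.add_apply]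
  ring

theorem br_smul_left (r : ℝ) (α β : Fin 2 → DiffFun U) : br (r • α) β = r • br α β := by
  funext i
  simp only [br, cl_smul, Pi.smul_apply, Derivation.map_smul, Derivation.smul_apply, smul_sub]

theorem br_smul_right (r : ℝ) (α β : Fin 2 → DiffFun U) : br α (r • β) = r • br α β := by
  funext i
  simp only [br, cl_smul, Pi.smul_apply, Derivation.map_smul, Derivation.smul_apply, smul_sub]

/-- The total derivative `D` passes through `cl`, so `D` of a bracket of fluxes is the commutator of
the two evolutionary fields. -/
theorem cl_br (α β : Fin 2 → DiffFun U) : cl (br α β) = ⁅cl β, cl α⁆ := by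
  rw [cl, cl, cl, evo_commutator]
  congr 1
  funext i
  simp only [br, cl, map_sub, D_evo]

/-- This is the Jacobi identity, written as the statement that `br γ` is a derivation of the
bracket. It holds for the fluxes themselves, with no integration constants. -/
theorem br_br (γ α β : Fin 2 → DiffFun U) :
    br γ (br α β) = br (br γ α) β + br α (br γ β) := by
  funext i
  rw [Pi.add_apply, br_apply γ, br_apply (br γ α) β, br_apply α (br γ β), cl_br, cl_br, cl_br]
  simp only [br, Derivation.commutator_apply, map_sub]
  ring

/-- First order part of the exponential of `ε K₁ + ε² K₂` applied to `α₀ + ε α₁ + ε² α₂`. -/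
noncomputable def exp₁ (K α₀ α₁ : Fin 2 → DiffFun U) : Fin 2 → DiffFun U := α₁ + br K α₀

/-- Second order part of the exponential of `ε K₁ + ε² K₂` applied to `α₀ + ε α₁ + ε² α₂`. -/
noncomputable def exp₂ (K K₂ α₀ α₁ α₂ : Fin 2 → DiffFun U) : Fin 2 → DiffFun U :=
  α₂ + br K₂ α₀ + br K α₁ + (1 / 2 : ℝ) • br K (br K α₀)

/-- The exponential of the derivation `br K` is an automorphism of the bracket; this is the
coefficient of `ε` in that statement, and `br_exp₂` is the coefficient of `ε²`. Commuting pairs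
therefore stay commuting after a transformation. -/
theorem br_exp₁ (K α₀ α₁ β₀ β₁ : Fin 2 → DiffFun U) :
    br α₀ (exp₁ K β₀ β₁) + br (exp₁ K α₀ α₁) β₀ = br α₀ β₁ + br α₁ β₀ + br K (br α₀ β₀) := by
  simp only [exp₁, br_add_left, br_add_right, br_br K α₀ β₀]
  abel

theorem br_exp₂ (K K₂ α₀ α₁ α₂ β₀ β₁ β₂ : Fin 2 → DiffFun U) :
    br α₀ (exp₂ K K₂ β₀ β₁ β₂) + br (exp₁ K α₀ α₁) (exp₁ K β₀ β₁) + br (exp₂ K K₂ α₀ α₁ α₂) β₀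
      = br α₀ β₂ + br α₁ β₁ + br α₂ β₀ + br K (br α₀ β₁ + br α₁ β₀) + br K₂ (br α₀ β₀)
        + (1 / 2 : ℝ) • br K (br K (br α₀ β₀)) := by
  simp only [exp₁, exp₂, br_add_left, br_add_right, br_smul_left, br_smul_right, br_br K α₀ β₀,
    br_br K₂ α₀ β₀, br_br K α₀ β₁, br_br K α₁ β₀, br_br K (br K α₀) β₀, br_br K α₀ (br K β₀)]
  module

/-! ### From functions of jets to differential polynomials. -/

/-- The function `P` of jets agrees over `U` with the differential polynomial `p`. -/
def Rep (P : Jet → ℝ) (p : DiffFun U) : Prop := ∀ j : JetsOver U, P j = ev j p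

theorem Rep.lineDeriv_eq {P : Jet → ℝ} {p : DiffFun U} (h : Rep P p)
    (Y : Fin 2 → ℕ → DiffFun U) (j : JetsOver U) :
    lineDeriv ℝ P j (jetOf Y j) = ev j (along Y p) := by
  rw [ev_along]
  exact lineDeriv_congr (fun i => by rw [ext_apply]; exact h i) j _

theorem Rep.dx {P : Jet → ℝ} {p : DiffFun U} (h : Rep P p) : Rep (Dx P) (D p) :=
  fun j => h.lineDeriv_eq (fun k s => q k (s + 1)) j

theorem Rep.dx_iterate {P : Jet → ℝ} {p : DiffFun U} (h : Rep P p) (s : ℕ) :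
    Rep (Dx^[s] P) (D^[s] p) := by
  induction s with
  | zero => exact h
  | succ s ih =>
    rw [Function.iterate_succ_apply', Function.iterate_succ_apply']
    exact ih.dx

theorem prolong_eq {Y : Fin 2 → Jet → ℝ} {y : Fin 2 → DiffFun U} (h : ∀ k, Rep (Y k) (y k))
    (j : JetsOver U) : prolong Y j = jetOf (fun k s => D^[s] (y k)) j :=
  funext fun k => funext fun s => (h k).dx_iterate s j

theorem Rep.evol {Y : Fin 2 → Jet → ℝ} {y : Fin 2 → DiffFun U} (h : ∀ k, Rep (Y k) (y k))
    {P : Jet → ℝ} {p : DiffFun U} (hP : Rep P p) : Rep (evol Y P) (evo y p) := fun j => by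
  rw [ConsLaw.evol, prolong_eq h]
  exact hP.lineDeriv_eq _ j

theorem Rep.evol_flow {α : Fin 2 → Jet → ℝ} {x : Fin 2 → DiffFun U} (h : ∀ k, Rep (α k) (x k))
    {P : Jet → ℝ} {p : DiffFun U} (hP : Rep P p) : Rep (ConsLaw.evol (flow α) P) (cl x p) :=
  Rep.evol (fun k => (h k).dx) hP

theorem Rep.bracket {α β : Fin 2 → Jet → ℝ} {x y : Fin 2 → DiffFun U} (h : ∀ k, Rep (α k) (x k))
    (h' : ∀ k, Rep (β k) (y k)) (i : Fin 2) : Rep (bracket α β i) (br x y i) := fun j => by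
  rw [ConsLaw.bracket, Rep.evol_flow h' (h i), Rep.evol_flow h (h' i), br_apply, map_sub]

/-- The differential polynomials of degree one with the coefficients `c`. -/
noncomputable def lin (c : Fin 2 → SmoothFun U) : DiffFun U := coef (c 0) * q 0 1 + coef (c 1) * q 1 1

/-- The differential polynomials of degree two with the coefficients `c`. -/
noncomputable def quad (c : Fin 5 → SmoothFun U) : DiffFun U :=
  coef (c 0) * q 0 2 + coef (c 1) * q 1 2 + coef (c 2) * q 0 1 ^ 2 + coef (c 3) * q 1 1 ^ 2
    + coef (c 4) * (q 0 1 * q 1 1)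

/-- The dispersionless part of a flux. -/
noncomputable def part₀ (a : Fin 2 → Fin 8 → SmoothFun U) : Fin 2 → DiffFun U :=
  fun i => coef (a i 0)

/-- The part of first order of a flux. -/
noncomputable def part₁ (a : Fin 2 → Fin 8 → SmoothFun U) : Fin 2 → DiffFun U :=
  fun i => lin ![a i 1, a i 2]

/-- The part of second order of a flux. -/
noncomputable def part₂ (a : Fin 2 → Fin 8 → SmoothFun U) : Fin 2 → DiffFun U :=
  fun i => quad ![a i 3, a i 4, a i 5, a i 6, a i 7]

theorem rep_flux {a : Coeffs} {x : Fin 2 → Fin 8 → SmoothFun U}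
    (h : ∀ i k p, SmoothFun.ev p (x i k) = a i k p) (ε : ℝ) (i : Fin 2) :
    Rep (flux a ε i) ((part₀ x + ε • part₁ x + ε ^ 2 • part₂ x) i) := fun j => by
  have h' : ∀ i k, SmoothFun.ev j.pt (x i k) = a i k j.1.base := fun i k => h i k j.pt
  simp [flux, part₀, part₁, part₂, lin, quad, h']
  ring

/-- The terms with `ε³` and `ε⁴` are harmless. The others are removed one at a time from the lowest,
because `ε ^ n * d = o(ε ^ n)` forces `d = 0`. -/
theorem isBigO_cube_iff (c : Fin 5 → ℝ) :
    ((fun ε : ℝ => c 0 + ε * c 1 + ε ^ 2 * c 2 + ε ^ 3 * c 3 + ε ^ 4 * c 4)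
      =O[𝓝 0] fun ε => ε ^ 3) ↔ c 0 = 0 ∧ c 1 = 0 ∧ c 2 = 0 := by
  have cont : ∀ f : ℝ → ℝ, Continuous f → (fun ε : ℝ => ε ^ 3 * f ε) =O[𝓝 0] fun ε => ε ^ 3 := by
    intro f hf
    simpa using (isBigO_refl (fun ε : ℝ => ε ^ 3) (𝓝 0)).mul (hf.continuousAt.isBigO_one ℝ)
  have pow0 : ∀ n : ℕ, ∀ d : ℝ, (fun ε : ℝ => ε ^ n * d) =o[𝓝 0] (fun ε : ℝ => ε ^ n) → d = 0 := by
    intro n d h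
    by_contra hd
    have h1 : (fun ε : ℝ => ε ^ n) =o[𝓝 0] (fun ε : ℝ => ε ^ n) :=
      (isBigO_of_le' (c := ‖d‖⁻¹) _ fun ε => by
        rw [norm_mul]
        have : ‖d‖ ≠ 0 := norm_ne_zero_iff.2 hd
        field_simp
        rfl).trans_isLittleO h
    -- Away from `ε = 0`, where `ε ^ n` is nonzero, the bound by half of itself is contradictory.
    have h2 := (h1.mono (nhdsWithin_le_nhds (s := {0}ᶜ))).bound (c := 1 / 2) (by norm_num)
    have h3 : ∀ᶠ ε : ℝ in 𝓝[≠] 0, ε ≠ 0 := eventually_mem_nhdsWithin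
    obtain ⟨ε, h4, h5⟩ := (h2.and h3).exists
    have : 0 < ‖ε ^ n‖ := norm_pos_iff.2 (pow_ne_zero _ h5)
    linarith
  have small : ∀ m n : ℕ, m < n → (fun ε : ℝ => ε ^ n) =o[𝓝 0] fun ε : ℝ => ε ^ m :=
    fun m n h => isLittleO_pow_pow h
  have tail := cont (fun ε => c 3 + ε * c 4) (by fun_prop)
  constructor
  · intro h
    have h2 : (fun ε : ℝ => c 0 + ε * c 1 + ε ^ 2 * c 2) =O[𝓝 0] fun ε => ε ^ 3 :=
      (h.sub tail).congr_left fun ε => by ring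
    have e0 : c 0 = 0 := pow0 0 _ <| by
      have := (h2.trans_isLittleO (small 0 3 (by norm_num)))
      have k : (fun ε : ℝ => ε ^ 1 * c 1 + ε ^ 2 * c 2) =o[𝓝 0] fun ε : ℝ => ε ^ 0 :=
        (((isBigO_refl (fun ε : ℝ => ε ^ 1) (𝓝 0)).mul (isBigO_const_one ℝ (c 1) _)).trans_isLittleO
          (by simpa using small 0 1 (by norm_num))).add
        (((isBigO_refl (fun ε : ℝ => ε ^ 2) (𝓝 0)).mul (isBigO_const_one ℝ (c 2) _)).trans_isLittleO
          (by simpa using small 0 2 (by norm_num)))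
      exact (this.sub k).congr_left fun ε => by ring
    have e1 : c 1 = 0 := pow0 1 _ <| by
      have := (h2.trans_isLittleO (small 1 3 (by norm_num)))
      have k : (fun ε : ℝ => ε ^ 2 * c 2) =o[𝓝 0] fun ε : ℝ => ε ^ 1 :=
        ((isBigO_refl (fun ε : ℝ => ε ^ 2) (𝓝 0)).mul (isBigO_const_one ℝ (c 2) _)).trans_isLittleO
          (by simpa using small 1 2 (by norm_num))
      exact (this.sub k).congr_left fun ε => by rw [e0]; ring
    have e2 : c 2 = 0 := pow0 2 _ <|
      (h2.trans_isLittleO (small 2 3 (by norm_num))).congr_left fun ε => by rw [e0, e1]; ring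
    exact ⟨e0, e1, e2⟩
  · rintro ⟨e0, e1, e2⟩
    refine tail.congr_left fun ε => ?_
    rw [e0, e1, e2]
    ring

/-- By bilinearity the bracket of the two fluxes is a polynomial of degree four in `ε`; only its
first three coefficients matter. -/
theorem commuteUpToTwo_iff {a b : Coeffs} {x y : Fin 2 → Fin 8 → SmoothFun U}
    (ha : ∀ i k p, SmoothFun.ev p (x i k) = a i k p)
    (hb : ∀ i k p, SmoothFun.ev p (y i k) = b i k p) :
    CommuteUpToTwo U a b ↔ br (part₀ x) (part₀ y) = 0 ∧
      br (part₀ x) (part₁ y) + br (part₁ x) (part₀ y) = 0 ∧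
      br (part₀ x) (part₂ y) + br (part₁ x) (part₁ y) + br (part₂ x) (part₀ y) = 0 := by
  have key : ∀ (j : JetsOver U) i, (fun ε : ℝ => bracket (flux a ε) (flux b ε) i j) =
      fun ε : ℝ => ev j (br (part₀ x) (part₀ y) i)
        + ε * ev j ((br (part₀ x) (part₁ y) + br (part₁ x) (part₀ y)) i)
        + ε ^ 2 * ev j
          ((br (part₀ x) (part₂ y) + br (part₁ x) (part₁ y) + br (part₂ x) (part₀ y)) i)
        + ε ^ 3 * ev j ((br (part₁ x) (part₂ y) + br (part₂ x) (part₁ y)) i)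
        + ε ^ 4 * ev j (br (part₂ x) (part₂ y) i) := by
    intro j i
    funext ε
    rw [Rep.bracket (rep_flux ha ε) (rep_flux hb ε) i j]
    simp only [br_add_left, br_add_right, br_smul_left, br_smul_right, Pi.add_apply, Pi.smul_apply,
      map_add, map_smul, smul_eq_mul]
    ring
  have key2 : CommuteUpToTwo U a b ↔ ∀ (j : JetsOver U) (i : Fin 2),
      ev j (br (part₀ x) (part₀ y) i) = 0 ∧
      ev j ((br (part₀ x) (part₁ y) + br (part₁ x) (part₀ y)) i) = 0 ∧
      ev j ((br (part₀ x) (part₂ y) + br (part₁ x) (part₁ y) + br (part₂ x) (part₀ y)) i) = 0 := by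
    have h1 : ∀ (j : JetsOver U) i, _ ↔ _ := fun j i => isBigO_cube_iff
      ![ev j (br (part₀ x) (part₀ y) i),
        ev j ((br (part₀ x) (part₁ y) + br (part₁ x) (part₀ y)) i),
        ev j ((br (part₀ x) (part₂ y) + br (part₁ x) (part₁ y) + br (part₂ x) (part₀ y)) i),
        ev j ((br (part₁ x) (part₂ y) + br (part₂ x) (part₁ y)) i),
        ev j (br (part₂ x) (part₂ y) i)]
    constructor
    · intro h j i
      have := h j j.2 i
      rw [key] at this
      exact (h1 j i).1 this
    · intro h j hj i
      rw [key ⟨j, hj⟩]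
      exact (h1 ⟨j, hj⟩ i).2 (h ⟨j, hj⟩ i)
  rw [key2]
  constructor
  · intro h
    exact ⟨funext fun i => eq_of_ev fun j => by simpa using (h j i).1,
      funext fun i => eq_of_ev fun j => by simpa using (h j i).2.1,
      funext fun i => eq_of_ev fun j => by simpa using (h j i).2.2⟩
  · rintro ⟨h0, h1, h2⟩ j i
    rw [h0, h1, h2]
    simp

end DiffFun

/-! ### Explicit brackets with the `(2,1)` flow. -/

namespace SmoothFun

variable {U : Opens (ℝ × ℝ)}

theorem pu_cu : pu (cu : SmoothFun U) = 1 := by simp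
theorem pv_cu : pv (cu : SmoothFun U) = 0 := by simp
theorem pu_cv : pu (cv : SmoothFun U) = 0 := by simp
theorem pv_cv : pv (cv : SmoothFun U) = 1 := by simp

end SmoothFun

namespace DiffFun

open SmoothFun

variable {U : Opens (ℝ × ℝ)}

/-- The differential polynomials of degree three with the coefficients `c`. -/
noncomputable def cubic (c : Fin 10 → SmoothFun U) : DiffFun U :=
  coef (c 0) * q 0 3 + coef (c 1) * q 1 3 + coef (c 2) * (q 0 1 * q 0 2)
    + coef (c 3) * (q 0 1 * q 1 2) + coef (c 4) * (q 0 2 * q 1 1) + coef (c 5) * (q 1 1 * q 1 2)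
    + coef (c 6) * q 0 1 ^ 3 + coef (c 7) * (q 0 1 ^ 2 * q 1 1) + coef (c 8) * (q 0 1 * q 1 1 ^ 2)
    + coef (c 9) * q 1 1 ^ 3

/-- The flux of the `(2,1)` flow. -/
noncomputable def flow₀ : Fin 2 → DiffFun U :=
  ![coef (cu * cv - (1 / 3 : ℝ) • cu ^ 3), coef ((1 / 2 : ℝ) • cv ^ 2)]

theorem D_flow₀_zero : D (flow₀ 0 : DiffFun U) = coef (cv - cu ^ 2) * q 0 1 + coef cu * q 1 1 := by
  simp only [flow₀, Matrix.cons_val, D_coef]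
  congr 3
  · refine SmoothFun.eq_of_ev fun p => ?_
    simp [map_ofNat (SmoothFun.ev p) 3]
  · refine SmoothFun.eq_of_ev fun p => ?_
    simp

theorem D_flow₀_one : D (flow₀ 1 : DiffFun U) = coef cv * q 1 1 := by
  simp only [flow₀, Matrix.cons_val, D_coef]
  refine eq_of_ev fun p => ?_
  simp [map_ofNat (SmoothFun.ev p.pt) 2]
  ring

theorem cl_flow₀_zero (α : Fin 2 → DiffFun U) :
    cl α (flow₀ 0) = coef (cv - cu ^ 2) * D (α 0) + coef cu * D (α 1) := by
  simp only [flow₀, Matrix.cons_val, cl_coef]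
  congr 3
  · refine SmoothFun.eq_of_ev fun p => ?_
    simp [map_ofNat (SmoothFun.ev p) 3]
  · refine SmoothFun.eq_of_ev fun p => ?_
    simp

theorem cl_flow₀_one (α : Fin 2 → DiffFun U) : cl α (flow₀ 1) = coef cv * D (α 1) := by
  simp only [flow₀, Matrix.cons_val, cl_coef]
  refine eq_of_ev fun p => ?_
  simp [map_ofNat (SmoothFun.ev p.pt) 2]
  ring

/-- This serves twice: it gives the equations for dispersionless symmetries, and it gives the effect
of the potential `M` on the terms of first order. -/
theorem br_hydro (h₁ h₂ : SmoothFun U) :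
    br flow₀ ![coef h₁, coef h₂] =
      ![lin ![pu h₂ * cu,
        -(pv h₁ * cu ^ 2) - pu h₁ * cu + pv h₂ * cu],
        lin ![pu h₂ * cu ^ 2,
        -(pu h₂ * cu)]] := by
  funext i
  fin_cases i
  · simp only [br_apply, Pi.add_apply, Pi.zero_apply, Fin.zero_eta, Fin.mk_one, Fin.isValue, lin, quad, cubic, Matrix.cons_val,
      pd_add, pd_sub, pd_neg, pd_mul, pd_pow, pd_zero, pd_one, pd_ofNat, coef_add, coef_sub,
      coef_neg, coef_mul, coef_pow, coef_zero, coef_one, coef_natCast, coef_ofNat, D_add, D_sub,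
      D_neg, D_mul, D_pow, D_zero, D_one, D_ofNat, cl_apply_add, cl_apply_neg, cl_apply_zero, cl_apply_mul, cl_apply_pow,
      Nat.cast_ofNat, cl_coef, cl_q, D_coef, D_q,
      D_flow₀_zero, D_flow₀_one, cl_flow₀_zero, cl_flow₀_one, Function.iterate_succ_apply',
      Function.iterate_zero_apply, pu_cu, pv_cu, pu_cv, pv_cv, pv_pu, zero_add, add_zero]
    refine eq_of_ev fun j => ?_
    simp only [eval_add, eval_sub, eval_neg, eval_mul, eval_pow, eval_zero, eval_one, eval_natCast,
      eval_ofNat]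
    ring
  · simp only [br_apply, Pi.add_apply, Pi.zero_apply, Fin.zero_eta, Fin.mk_one, Fin.isValue, lin, quad, cubic, Matrix.cons_val,
      pd_add, pd_sub, pd_neg, pd_mul, pd_pow, pd_zero, pd_one, pd_ofNat, coef_add, coef_sub,
      coef_neg, coef_mul, coef_pow, coef_zero, coef_one, coef_natCast, coef_ofNat, D_add, D_sub,
      D_neg, D_mul, D_pow, D_zero, D_one, D_ofNat, cl_apply_add, cl_apply_neg, cl_apply_zero, cl_apply_mul, cl_apply_pow,
      Nat.cast_ofNat, cl_coef, cl_q, D_coef, D_q,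
      D_flow₀_zero, D_flow₀_one, cl_flow₀_zero, cl_flow₀_one, Function.iterate_succ_apply',
      Function.iterate_zero_apply, pu_cu, pv_cu, pu_cv, pv_cv, pv_pu, zero_add, add_zero]
    refine eq_of_ev fun j => ?_
    simp only [eval_add, eval_sub, eval_neg, eval_mul, eval_pow, eval_zero, eval_one, eval_natCast,
      eval_ofNat]
    ring

/-- The first-order part of the deformation is taken diagonal, the shape reached by the choice of
`M`, while the symmetry is left general. With `h₁ = h₂ = f = p = 0` it also describes how a
second-order potential acts. -/
theorem br_first_order (h₁ h₂ f p b₁₁ b₁₂ b₂₁ b₂₂ : SmoothFun U) :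
    br flow₀ ![lin ![b₁₁, b₁₂], lin ![b₂₁, b₂₂]]
        + br ![lin ![f, 0], lin ![0, p]] ![coef h₁, coef h₂] =
      ![quad ![b₂₁ * cu,
        -(b₁₁ * cu) - b₁₂ * cu ^ 2 + b₂₂ * cu + f * pv h₁ - pv h₁ * p,
        2 * b₁₁ * cu + pu b₂₁ * cu + f * pu (pu h₁) + pv f * pu h₂,
        -(b₁₂) - pv b₁₂ * cu ^ 2 - pu b₁₂ * cu + pv b₂₂ * cu + f * pv (pv h₁) - pv h₁ * pv p,
        -(2 * b₁₁) - pv b₁₁ * cu ^ 2 - pu b₁₁ * cu + pv b₂₁ * cu + pu b₂₂ * cu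
          + 2 * f * pu (pv h₁) - pv f * pu h₁ + pv f * pv h₂ + pu f * pv h₁ - pv h₁ * pu p],
        quad ![b₂₁ * cu ^ 2 - f * pu h₂ + pu h₂ * p,
        -(b₂₁ * cu),
        2 * b₂₁ * cu + pu b₂₁ * cu ^ 2 - pu f * pu h₂ + pu (pu h₂) * p,
        -(b₂₂) - pu b₂₂ * cu + pv h₁ * pu p + pv (pv h₂) * p,
        -(2 * b₂₁) - pu b₂₁ * cu + pu b₂₂ * cu ^ 2 - pv f * pu h₂ + pu h₁ * pu p - pv h₂ * pu p
          + pu h₂ * pv p + 2 * pu (pv h₂) * p]] := by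
  funext i
  fin_cases i
  · simp only [br_apply, Pi.add_apply, Pi.zero_apply, Fin.zero_eta, Fin.mk_one, Fin.isValue, lin, quad, cubic, Matrix.cons_val,
      pd_add, pd_sub, pd_neg, pd_mul, pd_pow, pd_zero, pd_one, pd_ofNat, coef_add, coef_sub,
      coef_neg, coef_mul, coef_pow, coef_zero, coef_one, coef_natCast, coef_ofNat, D_add, D_sub,
      D_neg, D_mul, D_pow, D_zero, D_one, D_ofNat, cl_apply_add, cl_apply_neg, cl_apply_zero, cl_apply_mul, cl_apply_pow,
      Nat.cast_ofNat, cl_coef, cl_q, D_coef, D_q,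
      D_flow₀_zero, D_flow₀_one, cl_flow₀_zero, cl_flow₀_one, Function.iterate_succ_apply',
      Function.iterate_zero_apply, pu_cu, pv_cu, pu_cv, pv_cv, pv_pu, zero_add, add_zero]
    refine eq_of_ev fun j => ?_
    simp only [eval_add, eval_sub, eval_neg, eval_mul, eval_pow, eval_zero, eval_one, eval_natCast,
      eval_ofNat]
    ring
  · simp only [br_apply, Pi.add_apply, Pi.zero_apply, Fin.zero_eta, Fin.mk_one, Fin.isValue, lin, quad, cubic, Matrix.cons_val,
      pd_add, pd_sub, pd_neg, pd_mul, pd_pow, pd_zero, pd_one, pd_ofNat, coef_add, coef_sub,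
      coef_neg, coef_mul, coef_pow, coef_zero, coef_one, coef_natCast, coef_ofNat, D_add, D_sub,
      D_neg, D_mul, D_pow, D_zero, D_one, D_ofNat, cl_apply_add, cl_apply_neg, cl_apply_zero, cl_apply_mul, cl_apply_pow,
      Nat.cast_ofNat, cl_coef, cl_q, D_coef, D_q,
      D_flow₀_zero, D_flow₀_one, cl_flow₀_zero, cl_flow₀_one, Function.iterate_succ_apply',
      Function.iterate_zero_apply, pu_cu, pv_cu, pu_cv, pv_cv, pv_pu, zero_add, add_zero]
    refine eq_of_ev fun j => ?_
    simp only [eval_add, eval_sub, eval_neg, eval_mul, eval_pow, eval_zero, eval_one, eval_natCast,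
      eval_ofNat]
    ring

-- The shape of the deformation here is the one left after normalising by `M` and `N`. One expansion
-- serves both the sufficiency and the necessity computations.
set_option maxHeartbeats 2000000 in
theorem br_second_order (h₁ h₂ f b₁₁ b₁₂ a₁₆ a₁₇ g h a₂₅ a₂₆ b₁₃ b₁₄ b₁₅ b₁₆ b₁₇ b₂₃ b₂₄ b₂₅ b₂₆
    b₂₇ : SmoothFun U) :
    br flow₀ ![quad ![b₁₃, b₁₄, b₁₅, b₁₆, b₁₇], quad ![b₂₃, b₂₄, b₂₅, b₂₆, b₂₇]]
        + br ![lin ![f, 0], 0] ![lin ![b₁₁, b₁₂], 0]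
        + br ![quad ![0, 0, 0, a₁₆, a₁₇], quad ![g, h, a₂₅, a₂₆, -(cu * a₂₆)]]
          ![coef h₁, coef h₂] =
      ![cubic ![b₂₃ * cu - g * pv h₁,
        b₁₂ * f - b₁₃ * cu - b₁₄ * cu ^ 2 + b₂₄ * cu - h * pv h₁,
        a₁₇ * pu h₂ - 2 * a₂₅ * pv h₁ - 2 * b₁₁ * pu f + 2 * pu b₁₁ * f + 6 * b₁₃ * cu
          + pu b₂₃ * cu + 2 * b₂₅ * cu - pu g * pv h₁,
        -(a₁₇ * pu h₁) + a₁₇ * pv h₂ + a₂₆ * pv h₁ * cu - b₁₁ * pv f + pv b₁₁ * f + b₁₂ * pu f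
          + 2 * pu b₁₂ * f - 3 * b₁₃ - 2 * b₁₅ * cu - b₁₇ * cu ^ 2 + pu b₂₄ * cu + b₂₇ * cu
          - pu h * pv h₁,
        2 * a₁₆ * pu h₂ + a₂₆ * pv h₁ * cu - 2 * b₁₁ * pv f + 2 * pv b₁₁ * f - 3 * b₁₃
          - pv b₁₃ * cu ^ 2 - pu b₁₃ * cu + pv b₂₃ * cu + b₂₇ * cu - pv g * pv h₁,
        -(2 * a₁₆ * pu h₁) + 2 * a₁₆ * pv h₂ + a₁₇ * pv h₁ - 2 * a₂₆ * pv h₁ + 3 * pv b₁₂ * f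
          - 3 * b₁₄ - pv b₁₄ * cu ^ 2 - pu b₁₄ * cu - 2 * b₁₆ * cu ^ 2 - b₁₇ * cu + pv b₂₄ * cu
          + 2 * b₂₆ * cu - pv h * pv h₁,
        a₁₇ * pu (pu h₂) - pu a₂₅ * pv h₁ - b₁₁ * pu (pu f) + pu (pu b₁₁) * f + 2 * b₁₃
          + 4 * b₁₅ * cu + pu b₂₅ * cu,
        2 * a₁₆ * pu (pu h₂) + a₁₇ * pu (pu h₁) + 2 * a₁₇ * pu (pv h₂) + pv a₁₇ * pu h₂
          - pv a₂₅ * pv h₁ + a₂₆ * pv h₁ + pu a₂₆ * pv h₁ * cu - 2 * b₁₁ * pu (pv f)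
          + pv b₁₁ * pu f - pu b₁₁ * pv f + 2 * pu (pv b₁₁) * f + pu (pu b₁₂) * f - 4 * b₁₅
          - pv b₁₅ * cu ^ 2 - pu b₁₅ * cu + 2 * b₁₇ * cu + pv b₂₅ * cu + pu b₂₇ * cu,
        4 * a₁₆ * pu (pv h₂) + pv a₁₆ * pu h₂ + 2 * a₁₇ * pu (pv h₁) + a₁₇ * pv (pv h₂)
          - pv a₁₇ * pu h₁ + pv a₁₇ * pv h₂ + pu a₁₇ * pv h₁ + pv a₂₆ * pv h₁ * cu
          - pu a₂₆ * pv h₁ - b₁₁ * pv (pv f) + pv (pv b₁₁) * f + pv b₁₂ * pu f - pu b₁₂ * pv f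
          + 2 * pu (pv b₁₂) * f - 3 * b₁₇ - pv b₁₇ * cu ^ 2 - pu b₁₇ * cu + pu b₂₆ * cu
          + pv b₂₇ * cu,
        2 * a₁₆ * pv (pv h₂) - pv a₁₆ * pu h₁ + pv a₁₆ * pv h₂ + pu a₁₆ * pv h₁ + a₁₇ * pv (pv h₁)
          - pv a₂₆ * pv h₁ + pv (pv b₁₂) * f - 2 * b₁₆ - pv b₁₆ * cu ^ 2 - pu b₁₆ * cu
          + pv b₂₆ * cu],
        cubic ![b₂₃ * cu ^ 2 + g * pu h₁ - g * pv h₂ + h * pu h₂,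
        -(b₂₃ * cu) + g * pv h₁,
        2 * a₂₅ * pu h₁ - 2 * a₂₅ * pv h₂ - a₂₆ * pu h₂ * cu + 6 * b₂₃ * cu + pu b₂₃ * cu ^ 2
          + 2 * b₂₅ * cu ^ 2 + 3 * g * pu (pu h₁) + pv g * pu h₂ + pu g * pu h₁ - pu g * pv h₂
          + 3 * h * pu (pu h₂),
        -(a₁₇ * pu h₂) + 2 * a₂₅ * pv h₁ - 3 * b₂₃ + pu b₂₄ * cu ^ 2 - 2 * b₂₅ * cu
          + 3 * g * pu (pv h₁) + 3 * h * pu (pv h₂) + pv h * pu h₂ + pu h * pu h₁ - pu h * pv h₂,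
        -(a₁₇ * pu h₂) - a₂₆ * pu h₁ * cu + a₂₆ * pv h₂ * cu + 2 * a₂₆ * pu h₂ - 3 * b₂₃
          - pu b₂₃ * cu + b₂₇ * cu ^ 2 + 3 * g * pu (pv h₁) + pu g * pv h₁ + 3 * h * pu (pv h₂),
        -(2 * a₁₆ * pu h₂) - a₂₆ * pv h₁ * cu - 3 * b₂₄ - pu b₂₄ * cu - b₂₇ * cu
          + 3 * g * pv (pv h₁) + 3 * h * pv (pv h₂) + pu h * pv h₁,
        2 * a₂₅ * pu (pu h₁) + pv a₂₅ * pu h₂ + pu a₂₅ * pu h₁ - pu a₂₅ * pv h₂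
          - a₂₆ * pu (pu h₂) * cu + 2 * b₂₃ + 4 * b₂₅ * cu + pu b₂₅ * cu ^ 2 + g * pu (pu (pu h₁))
          + h * pu (pu (pu h₂)),
        -(pu a₁₇ * pu h₂) + 4 * a₂₅ * pu (pv h₁) + pu a₂₅ * pv h₁ - a₂₆ * pu h₁
          - a₂₆ * pu (pu h₁) * cu + a₂₆ * pv h₂ - 2 * a₂₆ * pu (pv h₂) * cu + 2 * a₂₆ * pu (pu h₂)
          - pv a₂₆ * pu h₂ * cu - pu a₂₆ * pu h₁ * cu + pu a₂₆ * pv h₂ * cu - 4 * b₂₅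
          - pu b₂₅ * cu + 2 * b₂₇ * cu + pu b₂₇ * cu ^ 2 + 3 * g * pu (pu (pv h₁))
          + 3 * h * pu (pu (pv h₂)),
        -(pu a₁₆ * pu h₂) - pv a₁₇ * pu h₂ + 2 * a₂₅ * pv (pv h₁) - a₂₆ * pv h₁
          - 2 * a₂₆ * pu (pv h₁) * cu - a₂₆ * pv (pv h₂) * cu + 4 * a₂₆ * pu (pv h₂)
          + pv a₂₆ * pu h₂ - pu a₂₆ * pv h₁ * cu + pu a₂₆ * pu h₁ - pu a₂₆ * pv h₂
          + pu b₂₆ * cu ^ 2 - 3 * b₂₇ - pu b₂₇ * cu + 3 * g * pu (pv (pv h₁))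
          + 3 * h * pu (pv (pv h₂)),
        -(pv a₁₆ * pu h₂) - a₂₆ * pv (pv h₁) * cu + 2 * a₂₆ * pv (pv h₂) + pu a₂₆ * pv h₁
          - 2 * b₂₆ - pu b₂₆ * cu + g * pv (pv (pv h₁)) + h * pv (pv (pv h₂))]] := by
  funext i
  fin_cases i
  · simp only [br_apply, Pi.add_apply, Pi.zero_apply, Fin.zero_eta, Fin.mk_one, Fin.isValue, lin, quad, cubic, Matrix.cons_val,
      pd_add, pd_sub, pd_neg, pd_mul, pd_pow, pd_zero, pd_one, pd_ofNat, coef_add, coef_sub,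
      coef_neg, coef_mul, coef_pow, coef_zero, coef_one, coef_natCast, coef_ofNat, D_add, D_sub,
      D_neg, D_mul, D_pow, D_zero, D_one, D_ofNat, cl_apply_add, cl_apply_neg, cl_apply_zero, cl_apply_mul, cl_apply_pow,
      Nat.cast_ofNat, cl_coef, cl_q, D_coef, D_q,
      D_flow₀_zero, D_flow₀_one, cl_flow₀_zero, cl_flow₀_one, Function.iterate_succ_apply',
      Function.iterate_zero_apply, pu_cu, pv_cu, pu_cv, pv_cv, pv_pu, zero_add, add_zero]
    refine eq_of_ev fun j => ?_
    simp only [eval_add, eval_sub, eval_neg, eval_mul, eval_pow, eval_zero, eval_one, eval_natCast,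
      eval_ofNat]
    ring
  · simp only [br_apply, Pi.add_apply, Pi.zero_apply, Fin.zero_eta, Fin.mk_one, Fin.isValue, lin, quad, cubic, Matrix.cons_val,
      pd_add, pd_sub, pd_neg, pd_mul, pd_pow, pd_zero, pd_one, pd_ofNat, coef_add, coef_sub,
      coef_neg, coef_mul, coef_pow, coef_zero, coef_one, coef_natCast, coef_ofNat, D_add, D_sub,
      D_neg, D_mul, D_pow, D_zero, D_one, D_ofNat, cl_apply_add, cl_apply_neg, cl_apply_zero, cl_apply_mul, cl_apply_pow,
      Nat.cast_ofNat, cl_coef, cl_q, D_coef, D_q,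
      D_flow₀_zero, D_flow₀_one, cl_flow₀_zero, cl_flow₀_one, Function.iterate_succ_apply',
      Function.iterate_zero_apply, pu_cu, pv_cu, pu_cv, pv_cv, pv_pu, zero_add, add_zero]
    refine eq_of_ev fun j => ?_
    simp only [eval_add, eval_sub, eval_neg, eval_mul, eval_pow, eval_zero, eval_one, eval_natCast,
      eval_ofNat]
    ring

end DiffFun

/-! ### Comparison of coefficients. -/

namespace DiffFun

open SmoothFun

variable {U : Opens (ℝ × ℝ)}

/-- The jet over `p` with the given derivatives. -/
def jetAt (p : U) (x : Fin 2 → ℕ → ℝ) : JetsOver U :=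
  ⟨fun k s => match s with
    | 0 => ![p.1.1, p.1.2] k
    | s + 1 => x k s, by exact p.2⟩

theorem pt_jetAt (p : U) (x : Fin 2 → ℕ → ℝ) : (jetAt p x).pt = p := rfl

theorem jetAt_succ (p : U) (x : Fin 2 → ℕ → ℝ) (k : Fin 2) (s : ℕ) :
    (jetAt p x).1 k (s + 1) = x k s := rfl

/-- The derivatives in a jet over a given point are arbitrary, so the coefficients are read off by
evaluating at suitable jets. -/
theorem lin_eq_zero_iff {c₀ c₁ : SmoothFun U} : lin ![c₀, c₁] = 0 ↔ c₀ = 0 ∧ c₁ = 0 := by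
  constructor
  · intro h
    have key : ∀ p (a b : ℝ), SmoothFun.ev p c₀ * a + SmoothFun.ev p c₁ * b = 0 := fun p a b => by
      have := congrArg (ev (jetAt p ![fun _ => a, fun _ => b])) h
      simpa [lin, pt_jetAt, jetAt_succ _ _ _ 0] using this
    exact ⟨SmoothFun.eq_of_ev fun p => by simpa using key p 1 0,
      SmoothFun.eq_of_ev fun p => by simpa using key p 0 1⟩
  · rintro ⟨rfl, rfl⟩
    simp [lin]

theorem quad_eq_zero_iff {c₀ c₁ c₂ c₃ c₄ : SmoothFun U} :
    quad ![c₀, c₁, c₂, c₃, c₄] = 0 ↔ c₀ = 0 ∧ c₁ = 0 ∧ c₂ = 0 ∧ c₃ = 0 ∧ c₄ = 0 := by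
  constructor
  · intro h
    have key : ∀ p (a b a' b' : ℝ), SmoothFun.ev p c₀ * a' + SmoothFun.ev p c₁ * b'
        + SmoothFun.ev p c₂ * a ^ 2 + SmoothFun.ev p c₃ * b ^ 2 + SmoothFun.ev p c₄ * (a * b) = 0 :=
      fun p a b a' b' => by
        have := congrArg (ev (jetAt p ![fun s => if s = 0 then a else a',
          fun s => if s = 0 then b else b'])) h
        simpa [quad, pt_jetAt, jetAt_succ _ _ _ 0, jetAt_succ _ _ _ 1] using this
    have e2 : ∀ p, SmoothFun.ev p c₂ = 0 := fun p => by simpa using key p 1 0 0 0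
    have e3 : ∀ p, SmoothFun.ev p c₃ = 0 := fun p => by simpa using key p 0 1 0 0
    exact ⟨SmoothFun.eq_of_ev fun p => by simpa using key p 0 0 1 0,
      SmoothFun.eq_of_ev fun p => by simpa using key p 0 0 0 1,
      SmoothFun.eq_of_ev fun p => by simpa using e2 p,
      SmoothFun.eq_of_ev fun p => by simpa using e3 p,
      SmoothFun.eq_of_ev fun p => by simpa [e2, e3] using key p 1 1 0 0⟩
  · rintro ⟨rfl, rfl, rfl, rfl, rfl⟩
    simp [quad]

theorem cubic_eq_zero_iff {c₀ c₁ c₂ c₃ c₄ c₅ c₆ c₇ c₈ c₉ : SmoothFun U} :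
    cubic ![c₀, c₁, c₂, c₃, c₄, c₅, c₆, c₇, c₈, c₉] = 0 ↔ c₀ = 0 ∧ c₁ = 0 ∧ c₂ = 0 ∧ c₃ = 0 ∧
      c₄ = 0 ∧ c₅ = 0 ∧ c₆ = 0 ∧ c₇ = 0 ∧ c₈ = 0 ∧ c₉ = 0 := by
  constructor
  · intro h
    have key : ∀ p (a b a' b' a'' b'' : ℝ), SmoothFun.ev p c₀ * a'' + SmoothFun.ev p c₁ * b''
        + SmoothFun.ev p c₂ * (a * a') + SmoothFun.ev p c₃ * (a * b')
        + SmoothFun.ev p c₄ * (a' * b) + SmoothFun.ev p c₅ * (b * b')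
        + SmoothFun.ev p c₆ * a ^ 3 + SmoothFun.ev p c₇ * (a ^ 2 * b)
        + SmoothFun.ev p c₈ * (a * b ^ 2) + SmoothFun.ev p c₉ * b ^ 3 = 0 :=
      fun p a b a' b' a'' b'' => by
        have := congrArg (ev (jetAt p ![fun s => if s = 0 then a else if s = 1 then a' else a'',
          fun s => if s = 0 then b else if s = 1 then b' else b''])) h
        simpa [cubic, pt_jetAt, jetAt_succ _ _ _ 0, jetAt_succ _ _ _ 1, jetAt_succ _ _ _ 2]
          using this
    have e6 : ∀ p, SmoothFun.ev p c₆ = 0 := fun p => by simpa using key p 1 0 0 0 0 0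
    have e9 : ∀ p, SmoothFun.ev p c₉ = 0 := fun p => by simpa using key p 0 1 0 0 0 0
    -- The two mixed cubic terms cannot be isolated by setting a derivative to zero; the jets with
    -- `(uₓ, vₓ) = (1, 1)` and `(1, -1)` separate them.
    have e78 : ∀ p, SmoothFun.ev p c₇ + SmoothFun.ev p c₈ = 0 := fun p => by
      simpa [e6, e9] using key p 1 1 0 0 0 0
    have e78' : ∀ p, -SmoothFun.ev p c₇ + SmoothFun.ev p c₈ = 0 := fun p => by
      simpa [e6, e9] using key p 1 (-1) 0 0 0 0
    exact ⟨SmoothFun.eq_of_ev fun p => by simpa using key p 0 0 0 0 1 0,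
      SmoothFun.eq_of_ev fun p => by simpa using key p 0 0 0 0 0 1,
      SmoothFun.eq_of_ev fun p => by simpa [e6] using key p 1 0 1 0 0 0,
      SmoothFun.eq_of_ev fun p => by simpa [e6] using key p 1 0 0 1 0 0,
      SmoothFun.eq_of_ev fun p => by simpa [e9] using key p 0 1 1 0 0 0,
      SmoothFun.eq_of_ev fun p => by simpa [e9] using key p 0 1 0 1 0 0,
      SmoothFun.eq_of_ev fun p => by simpa using e6 p,
      SmoothFun.eq_of_ev fun p => by
        rw [map_zero]; linarith [e78 p, e78' p],
      SmoothFun.eq_of_ev fun p => by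
        rw [map_zero]; linarith [e78 p, e78' p],
      SmoothFun.eq_of_ev fun p => by simpa using e9 p⟩
  · rintro ⟨rfl, rfl, rfl, rfl, rfl, rfl, rfl, rfl, rfl, rfl⟩
    simp [cubic]

end DiffFun

/-! ### Coefficients of the normal form and of the extended symmetries. -/

namespace SmoothFun

variable {U : Opens (ℝ × ℝ)}

/-- Constant functions. -/
noncomputable def const (r : ℝ) : SmoothFun U := algebraMap ℝ _ r

theorem pd_const (e : ℝ × ℝ) (r : ℝ) : pd e (const r : SmoothFun U) = 0 :=
  Derivation.map_algebraMap _ _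

theorem ev_const (p : U) (r : ℝ) : ev p (const r) = r := (ev p).commutes r

theorem pu_inv {w : SmoothFun U} (h : cu * w = 1) : pu w = -w ^ 2 := by
  have := congrArg pu h
  rw [Derivation.leibniz, Derivation.map_one_eq_zero, pu_cu, smul_eq_mul, smul_eq_mul] at this
  linear_combination w * this - pu w * h

theorem pv_inv {w : SmoothFun U} (h : cu * w = 1) : pv w = 0 := by
  have := congrArg pv h
  rw [Derivation.leibniz, Derivation.map_one_eq_zero, pv_cu, smul_eq_mul, smul_eq_mul] at this
  linear_combination w * this - pv w * h

theorem ev_cu_ne_zero {w : SmoothFun U} (h : cu * w = 1) (p : U) : p.1.1 ≠ 0 := fun h0 => by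
  have := congrArg (ev p) h
  rw [map_mul, ev_cu, h0, zero_mul, map_one] at this
  exact zero_ne_one this

theorem ev_inv {w : SmoothFun U} (h : cu * w = 1) (p : U) : ev p w = p.1.1⁻¹ := by
  have := congrArg (ev p) h
  rw [map_mul, ev_cu, map_one] at this
  exact eq_inv_of_mul_eq_one_right this

/-- The field `∂_u + u ∂_v` commutes with `∂_v`, so its first integrals are stable under `∂_v`.
Iterated, this removes all `u`-derivatives of such functions. -/
theorem pu_pv_of_riem {φ : SmoothFun U} (h : pu φ = -(cu * pv φ)) :
    pu (pv φ) = -(cu * pv (pv φ)) := by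
  rw [← pv_pu, h, map_neg, Derivation.leibniz, pv_cu]
  simp

theorem pu_pv_of_snd {φ : SmoothFun U} (h : pu φ = 0) : pu (pv φ) = 0 := by
  rw [← pv_pu, h, map_zero]

theorem pu_pv_of_sym {φ ψ : SmoothFun U} (h : pu φ = pv ψ - cu * pv φ) :
    pu (pv φ) = pv (pv ψ) - cu * pv (pv φ) := by
  rw [← pv_pu, h, map_sub, Derivation.leibniz, pv_cu]
  simp

/-- The coefficient of `vₓ²` in the first flux of the normal form. -/
noncomputable def nf₁₆ (F G H iu : SmoothFun U) : SmoothFun U :=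
  -(const (2 / 3) * F * pv F * iu) + const (7 / 6) * F * pv (pv F) * cu
    - const (2 / 3) * F ^ 2 * iu ^ 3 + const (2 / 3) * (pv F) ^ 2 * cu - const 4 * pv G * cu
    + pv (pv G) * cu ^ 3 + H * iu ^ 3 - const (1 / 2) * pv H * iu

/-- The coefficient of `uₓ vₓ` in the first flux of the normal form. -/
noncomputable def nf₁₇ (F G iu : SmoothFun U) : SmoothFun U :=
  const (5 / 3) * F * pv F - const (7 / 6) * F * pv (pv F) * cu ^ 2
    + const (2 / 3) * F ^ 2 * iu ^ 2 - const (2 / 3) * (pv F) ^ 2 * cu ^ 2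
    + const 4 * pv G * cu ^ 2 - pv (pv G) * cu ^ 4

/-- The function `g` of the normal form. -/
noncomputable def nf₂₃ (F G : SmoothFun U) : SmoothFun U :=
  const (1 / 3) * F ^ 2 * cu + G * cu ^ 3

/-- The function `h` of the normal form. -/
noncomputable def nf₂₄ (F G H : SmoothFun U) : SmoothFun U :=
  -(const (1 / 3) * F ^ 2) - G * cu ^ 2 + H

/-- The coefficient of `uₓ²` in the second flux of the normal form. -/
noncomputable def nf₂₅ (F G : SmoothFun U) : SmoothFun U :=
  -(const (2 / 3) * F * pv F * cu ^ 2) + const (1 / 3) * F ^ 2 + const 3 * G * cu ^ 2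
    - pv G * cu ^ 4

/-- The coefficient of `vₓ²` in the second flux of the normal form. -/
noncomputable def nf₂₆ (F G iu : SmoothFun U) : SmoothFun U :=
  -(const (4 / 3) * F * pv F) + const (2 / 3) * F * pv (pv F) * cu ^ 2
    - const (1 / 3) * F ^ 2 * iu ^ 2 + const (2 / 3) * (pv F) ^ 2 * cu ^ 2 + const 3 * G
    - const 6 * pv G * cu ^ 2 + pv (pv G) * cu ^ 4

/-- A coefficient of the symmetry with the dispersionless part `(h₁, h₂)`. -/
noncomputable def sym₁₁ (F h₁ h₂ : SmoothFun U) : SmoothFun U :=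
  const (1 / 2) * F * pv h₁ - const (1 / 2) * F * pv (pv h₁) * cu ^ 2
    + const (1 / 2) * F * cu * pv (pv h₂)

/-- A coefficient of the symmetry with the dispersionless part `(h₁, h₂)`. -/
noncomputable def sym₁₂ (F h₁ h₂ iu : SmoothFun U) : SmoothFun U :=
  const (1 / 2) * F * pv h₁ * iu + const (1 / 2) * F * pv (pv h₁) * cu
    - const (1 / 2) * F * pv (pv h₂)

/-- A coefficient of the symmetry with the dispersionless part `(h₁, h₂)`. -/
noncomputable def sym₁₃ (F G h₁ h₂ iu : SmoothFun U) : SmoothFun U :=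
  const (1 / 3) * F ^ 2 * pv h₁ * iu + const (1 / 2) * F ^ 2 * pv (pv h₁) * cu
    - const (1 / 6) * F ^ 2 * pv (pv (pv h₁)) * cu ^ 3
    + const (1 / 6) * F ^ 2 * cu ^ 2 * pv (pv (pv h₂)) - const (1 / 3) * F ^ 2 * pv (pv h₂)
    + const (1 / 2) * G * pv h₁ * cu + const (1 / 2) * G * pv (pv h₁) * cu ^ 3
    - const (1 / 2) * G * cu ^ 2 * pv (pv h₂)

/-- A coefficient of the symmetry with the dispersionless part `(h₁, h₂)`. -/
noncomputable def sym₁₄ (F G H h₁ h₂ iu : SmoothFun U) : SmoothFun U :=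
  const (1 / 6) * F ^ 2 * pv h₁ * iu ^ 2 + const (1 / 6) * F ^ 2 * pv (pv (pv h₁)) * cu ^ 2
    - const (1 / 6) * F ^ 2 * iu * pv (pv h₂) - const (1 / 6) * F ^ 2 * cu * pv (pv (pv h₂))
    - const (1 / 2) * G * pv h₁ - const (1 / 2) * G * pv (pv h₁) * cu ^ 2
    + const (1 / 2) * G * cu * pv (pv h₂) - H * pv h₁ * iu ^ 2 + H * iu * pv (pv h₂)

/-- A coefficient of the symmetry with the dispersionless part `(h₁, h₂)`. -/
noncomputable def sym₁₅ (F G h₁ h₂ iu : SmoothFun U) : SmoothFun U :=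
  -(const (7 / 12) * F * pv F * pv h₁) - const (5 / 6) * F * pv F * pv (pv h₁) * cu ^ 2
    + const (1 / 4) * F * pv F * pv (pv (pv h₁)) * cu ^ 4
    + const (7 / 12) * F * pv F * cu * pv (pv h₂)
    - const (1 / 4) * F * pv F * cu ^ 3 * pv (pv (pv h₂)) - const (1 / 6) * F ^ 2 * pv h₁ * iu ^ 2
    + const (5 / 24) * F ^ 2 * pv (pv h₁) - const (3 / 4) * F ^ 2 * pv (pv (pv h₁)) * cu ^ 2
    + const (1 / 8) * F ^ 2 * pv (pv (pv (pv h₁))) * cu ^ 4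
    + const (1 / 6) * F ^ 2 * iu * pv (pv h₂) + const (5 / 8) * F ^ 2 * cu * pv (pv (pv h₂))
    - const (1 / 8) * F ^ 2 * cu ^ 3 * pv (pv (pv (pv h₂))) + const (3 / 4) * G * pv h₁
    + G * pv (pv h₁) * cu ^ 2 - const (1 / 4) * G * pv (pv (pv h₁)) * cu ^ 4
    - const (3 / 4) * G * cu * pv (pv h₂) + const (1 / 4) * G * cu ^ 3 * pv (pv (pv h₂))
    - const (1 / 2) * pv G * pv h₁ * cu ^ 2 - const (1 / 2) * pv G * pv (pv h₁) * cu ^ 4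
    + const (1 / 2) * pv G * cu ^ 3 * pv (pv h₂)

/-- A coefficient of the symmetry with the dispersionless part `(h₁, h₂)`. -/
noncomputable def sym₁₆ (F G H h₁ h₂ iu : SmoothFun U) : SmoothFun U :=
  const (11 / 12) * F * pv F * pv h₁ * iu ^ 2 + const (2 / 3) * F * pv F * pv (pv h₁)
    + const (1 / 4) * F * pv F * pv (pv (pv h₁)) * cu ^ 2
    - const (19 / 12) * F * pv F * iu * pv (pv h₂)
    - const (1 / 4) * F * pv F * cu * pv (pv (pv h₂)) + const (7 / 6) * F * pv (pv F) * pv h₁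
    - F ^ 2 * pv h₁ * iu ^ 4 + const (5 / 24) * F ^ 2 * pv (pv h₁) * iu ^ 2
    + const (1 / 12) * F ^ 2 * pv (pv (pv h₁))
    + const (1 / 8) * F ^ 2 * pv (pv (pv (pv h₁))) * cu ^ 2
    - const (5 / 24) * F ^ 2 * iu * pv (pv (pv h₂)) + const (1 / 3) * F ^ 2 * iu ^ 3 * pv (pv h₂)
    - const (1 / 8) * F ^ 2 * cu * pv (pv (pv (pv h₂))) + const (2 / 3) * (pv F) ^ 2 * pv h₁
    - const (9 / 4) * G * pv h₁ * iu ^ 2 - const (1 / 4) * G * pv (pv (pv h₁)) * cu ^ 2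
    + const (9 / 4) * G * iu * pv (pv h₂) + const (1 / 4) * G * cu * pv (pv (pv h₂))
    - const (7 / 2) * pv G * pv h₁ - const (1 / 2) * pv G * pv (pv h₁) * cu ^ 2
    - const (1 / 2) * pv G * cu * pv (pv h₂) + pv (pv G) * pv h₁ * cu ^ 2
    + const (3 / 2) * H * pv h₁ * iu ^ 4 + const (1 / 2) * H * iu * pv (pv (pv h₂))
    - const (1 / 2) * H * iu ^ 3 * pv (pv h₂) - const (1 / 2) * pv H * pv h₁ * iu ^ 2

/-- A coefficient of the symmetry with the dispersionless part `(h₁, h₂)`. -/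
noncomputable def sym₁₇ (F G h₁ h₂ iu : SmoothFun U) : SmoothFun U :=
  const (4 / 3) * F * pv F * pv h₁ * iu + const (1 / 6) * F * pv F * pv (pv h₁) * cu
    - const (1 / 2) * F * pv F * pv (pv (pv h₁)) * cu ^ 3
    + const (1 / 2) * F * pv F * cu ^ 2 * pv (pv (pv h₂)) + const (1 / 3) * F * pv F * pv (pv h₂)
    - const (7 / 6) * F * pv (pv F) * pv h₁ * cu + const (1 / 2) * F ^ 2 * pv h₁ * iu ^ 3
    + const (1 / 12) * F ^ 2 * pv (pv h₁) * iu + const (1 / 2) * F ^ 2 * pv (pv (pv h₁)) * cu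
    - const (1 / 4) * F ^ 2 * pv (pv (pv (pv h₁))) * cu ^ 3
    + const (1 / 6) * F ^ 2 * iu ^ 2 * pv (pv h₂)
    + const (1 / 4) * F ^ 2 * cu ^ 2 * pv (pv (pv (pv h₂)))
    - const (1 / 4) * F ^ 2 * pv (pv (pv h₂)) - const (2 / 3) * (pv F) ^ 2 * pv h₁ * cu
    - const (1 / 2) * G * pv (pv h₁) * cu + const (1 / 2) * G * pv (pv (pv h₁)) * cu ^ 3
    - const (1 / 2) * G * cu ^ 2 * pv (pv (pv h₂)) + const 5 * pv G * pv h₁ * cu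
    + pv G * pv (pv h₁) * cu ^ 3 - pv G * cu ^ 2 * pv (pv h₂) - pv (pv G) * pv h₁ * cu ^ 3

/-- A coefficient of the symmetry with the dispersionless part `(h₁, h₂)`. -/
noncomputable def sym₂₃ (F G h₁ : SmoothFun U) : SmoothFun U :=
  const (1 / 3) * F ^ 2 * pv h₁ + G * pv h₁ * cu ^ 2

/-- A coefficient of the symmetry with the dispersionless part `(h₁, h₂)`. -/
noncomputable def sym₂₄ (F G H h₁ h₂ iu : SmoothFun U) : SmoothFun U :=
  -(const (1 / 3) * F ^ 2 * pv h₁ * iu) - G * pv h₁ * cu + H * pv (pv h₂)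

/-- A coefficient of the symmetry with the dispersionless part `(h₁, h₂)`. -/
noncomputable def sym₂₅ (F G h₁ h₂ : SmoothFun U) : SmoothFun U :=
  -(const (2 / 3) * F * pv F * pv h₁ * cu) - const (1 / 3) * F ^ 2 * pv (pv h₁) * cu
    + const (1 / 3) * F ^ 2 * pv (pv h₂) + const 2 * G * pv h₁ * cu - G * pv (pv h₁) * cu ^ 3
    + G * cu ^ 2 * pv (pv h₂) - pv G * pv h₁ * cu ^ 3

/-- A coefficient of the symmetry with the dispersionless part `(h₁, h₂)`. -/
noncomputable def sym₂₆ (F G H h₁ h₂ iu : SmoothFun U) : SmoothFun U :=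
  -(const (2 / 3) * F * pv F * pv h₁ * iu) - const (2 / 3) * F * pv F * pv (pv h₂)
    + const (2 / 3) * F * pv (pv F) * pv h₁ * cu - const (2 / 3) * F ^ 2 * pv h₁ * iu ^ 3
    - const (1 / 3) * F ^ 2 * pv (pv h₁) * iu + const (1 / 3) * F ^ 2 * iu ^ 2 * pv (pv h₂)
    + const (2 / 3) * (pv F) ^ 2 * pv h₁ * cu - G * pv (pv h₁) * cu + const 3 * G * pv (pv h₂)
    - const 5 * pv G * pv h₁ * cu - pv G * cu ^ 2 * pv (pv h₂) + pv (pv G) * pv h₁ * cu ^ 3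
    + const (1 / 2) * H * pv (pv (pv h₂))

/-- A coefficient of the symmetry with the dispersionless part `(h₁, h₂)`. -/
noncomputable def sym₂₇ (F G h₁ h₂ iu : SmoothFun U) : SmoothFun U :=
  const (4 / 3) * F * pv F * pv h₁ - const (2 / 3) * F * pv (pv F) * pv h₁ * cu ^ 2
    + F ^ 2 * pv h₁ * iu ^ 2 + const (2 / 3) * F ^ 2 * pv (pv h₁)
    - const (2 / 3) * F ^ 2 * iu * pv (pv h₂) - const (2 / 3) * (pv F) ^ 2 * pv h₁ * cu ^ 2
    - G * pv h₁ + const 2 * G * pv (pv h₁) * cu ^ 2 - const 2 * G * cu * pv (pv h₂)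
    + const 6 * pv G * pv h₁ * cu ^ 2 - pv (pv G) * pv h₁ * cu ^ 4

end SmoothFun

/-! ### Extension of every dispersionless symmetry of the normal form. -/

namespace DiffFun

open SmoothFun

variable {U : Opens (ℝ × ℝ)}

/-- The symmetry and first-integral equations replace every `u`-derivative by `v`-derivatives. Each
coefficient of the bracket is then an identity in `u`, its inverse and these `v`-derivatives. -/
theorem exists_first_order {iu F h₁ h₂ : SmoothFun U} (hi : cu * iu = 1)
    (hF : pu F = -(cu * pv F)) (h₂u : pu h₂ = 0)
    (h₁u : pu h₁ = pv h₂ - cu * pv h₁) :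
    br flow₀ ![lin ![sym₁₁ F h₁ h₂,
          sym₁₂ F h₁ h₂ iu], 0]
        + br ![lin ![F * cu, 0], 0] ![coef h₁, coef h₂] = 0 := by
  have i₁ := pu_inv hi
  have i₂ := pv_inv hi
  have F₁ := pu_pv_of_riem hF
  have F₂ := pu_pv_of_riem F₁
  have F₃ := pu_pv_of_riem F₂
  have h₁₁ := pu_pv_of_sym h₁u
  have h₁₂ := pu_pv_of_sym h₁₁
  have h₁₃ := pu_pv_of_sym h₁₂
  have h₁₄ := pu_pv_of_sym h₁₃
  have h₂₁ := pu_pv_of_snd h₂u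
  have h₂₂ := pu_pv_of_snd h₂₁
  have h₂₃ := pu_pv_of_snd h₂₂
  have h₂₄ := pu_pv_of_snd h₂₃
  have h := br_first_order h₁ h₂ (F * cu) 0 (sym₁₁ F h₁ h₂)
    (sym₁₂ F h₁ h₂ iu) 0 0
  have h0 : lin ![0, 0] = (0 : DiffFun U) := lin_eq_zero_iff.2 ⟨rfl, rfl⟩
  rw [h0] at h
  rw [h]
  have two : ∀ x y : DiffFun U, x = 0 → y = 0 → ![x, y] = 0 := by
    rintro x y rfl rfl
    simp
  refine two _ _ (quad_eq_zero_iff.2 ⟨?_, ?_, ?_, ?_, ?_⟩)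
    (quad_eq_zero_iff.2 ⟨?_, ?_, ?_, ?_, ?_⟩)
  all_goals
    refine SmoothFun.eq_of_ev fun p => ?_
    have hp := ev_cu_ne_zero hi p
    simp only [sym₁₁, sym₁₂, pd_add, pd_sub, pd_neg, pd_mul, pd_pow, pd_zero, pd_one, pd_natCast, pd_ofNat,
      ev_add, ev_sub, ev_neg, ev_mul, ev_pow, ev_zero, ev_one, ev_natCast, ev_ofNat,
      Nat.reduceSub, pow_one, pd_const, pu_cu, pv_cu, i₁, i₂, hF, F₁, F₂, F₃, h₁u, h₁₁, h₁₂,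
      h₁₃, h₁₄, h₂u, h₂₁, h₂₂, h₂₃, h₂₄]
    simp only [ev_const, ev_inv hi, ev_cu, mul_zero, zero_mul, add_zero, zero_add, sub_zero,
      neg_zero, ev_natCast, ev_ofNat, Nat.cast_ofNat]
    try field_simp
    try ring1

-- The witness is linear in `v`-derivatives of `h₁, h₂`, of order at most four, and its coefficients
-- are quadratic in `F` and linear in `G, H`. Once `u`-derivatives are eliminated, each of the
-- twenty equations is a rational identity in independent quantities.
set_option maxHeartbeats 4000000 in
theorem exists_second_order {iu F G H h₁ h₂ : SmoothFun U} (hi : cu * iu = 1)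
    (hF : pu F = -(cu * pv F)) (hG : pu G = -(cu * pv G)) (hH : pu H = 0) (h₂u : pu h₂ = 0)
    (h₁u : pu h₁ = pv h₂ - cu * pv h₁) :
    ∃ b : Fin 2 → Fin 5 → SmoothFun U,
      br flow₀ (fun i => quad (b i))
        + br ![lin ![F * cu, 0], 0] ![lin ![sym₁₁ F h₁ h₂,
          sym₁₂ F h₁ h₂ iu], 0]
        + br ![quad ![0, 0, 0, nf₁₆ F G H iu, nf₁₇ F G iu], quad ![nf₂₃ F G, nf₂₄ F G H, nf₂₅ F G,
          nf₂₆ F G iu, -(cu * nf₂₆ F G iu)]] ![coef h₁, coef h₂] = 0 := by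
  have i₁ := pu_inv hi
  have i₂ := pv_inv hi
  have F₁ := pu_pv_of_riem hF
  have F₂ := pu_pv_of_riem F₁
  have F₃ := pu_pv_of_riem F₂
  have h₁₁ := pu_pv_of_sym h₁u
  have h₁₂ := pu_pv_of_sym h₁₁
  have h₁₃ := pu_pv_of_sym h₁₂
  have h₁₄ := pu_pv_of_sym h₁₃
  have h₂₁ := pu_pv_of_snd h₂u
  have h₂₂ := pu_pv_of_snd h₂₁
  have h₂₃ := pu_pv_of_snd h₂₂
  have h₂₄ := pu_pv_of_snd h₂₃
  have G₁ := pu_pv_of_riem hG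
  have G₂ := pu_pv_of_riem G₁
  have H₁ := pu_pv_of_snd hH
  have hb : ∀ b : Fin 2 → Fin 5 → SmoothFun U,
      (fun i => quad (b i)) = ![quad ![b 0 0, b 0 1, b 0 2, b 0 3, b 0 4],
        quad ![b 1 0, b 1 1, b 1 2, b 1 3, b 1 4]] := fun b => by
    funext i
    fin_cases i <;> rfl
  refine ⟨![![sym₁₃ F G h₁ h₂ iu,
      sym₁₄ F G H h₁ h₂ iu,
      sym₁₅ F G h₁ h₂ iu,
      sym₁₆ F G H h₁ h₂ iu,
      sym₁₇ F G h₁ h₂ iu],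
    ![sym₂₃ F G h₁,
      sym₂₄ F G H h₁ h₂ iu,
      sym₂₅ F G h₁ h₂,
      sym₂₆ F G H h₁ h₂ iu,
      sym₂₇ F G h₁ h₂ iu]], ?_⟩
  rw [hb, br_second_order]
  have two : ∀ x y : DiffFun U, x = 0 → y = 0 → ![x, y] = 0 := by
    rintro x y rfl rfl
    simp
  refine two _ _ (cubic_eq_zero_iff.2 ⟨?_, ?_, ?_, ?_, ?_, ?_, ?_, ?_, ?_, ?_⟩)
    (cubic_eq_zero_iff.2 ⟨?_, ?_, ?_, ?_, ?_, ?_, ?_, ?_, ?_, ?_⟩)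
  all_goals
    refine SmoothFun.eq_of_ev fun p => ?_
    have hp := ev_cu_ne_zero hi p
    simp only [Matrix.cons_val, nf₁₆, nf₁₇, nf₂₃, nf₂₄, nf₂₅, nf₂₆, sym₁₁, sym₁₂,
      sym₁₃, sym₁₄, sym₁₅, sym₁₆, sym₁₇, sym₂₃, sym₂₄, sym₂₅, sym₂₆, sym₂₇,
      pd_add, pd_sub, pd_neg, pd_mul, pd_pow, pd_zero, pd_one, pd_natCast, pd_ofNat,
      ev_add, ev_sub, ev_neg, ev_mul, ev_pow, ev_zero, ev_one, ev_natCast, ev_ofNat,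
      Nat.reduceSub, pow_one, pd_const, pu_cu, pv_cu, i₁, i₂, hF, F₁, F₂, F₃, h₁u, h₁₁, h₁₂,
      h₁₃, h₁₄, h₂u, h₂₁, h₂₂, h₂₃, h₂₄, hG, G₁, G₂, hH, H₁]
    simp only [ev_const, ev_inv hi, ev_cu, mul_zero, zero_mul, add_zero, zero_add, sub_zero,
      neg_zero, ev_natCast, ev_ofNat, Nat.cast_ofNat]
    try field_simp
    try ring1

end DiffFun

/-! ### The normal form as a family of smooth functions, and its integrability. -/

namespace SmoothFun

variable {U : Opens (ℝ × ℝ)}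

theorem ev_pd_of_curve {φ : SmoothFun U} {γ : ℝ → ℝ × ℝ} {p : U} {e : ℝ × ℝ}
    (h0 : γ 0 = p) (hγ : HasDerivAt γ e 0) {c : ℝ}
    (hc : ∀ t, γ t ∈ U → ext φ (γ t) = c) :
    e.1 * ev p (pu φ) + e.2 * ev p (pv φ) = 0 := by
  rw [← ev_pd_eq_add]
  have h1 : HasFDerivAt (ext φ) (fderiv ℝ (ext φ) p) (γ 0) := by
    rw [h0]
    exact (differentiableAt_ext φ p).hasFDerivAt
  have h2 := h1.comp_hasDerivAt (0 : ℝ) hγ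
  have h3 : (ext φ ∘ γ) =ᶠ[𝓝 0] fun _ => c := by
    have : ∀ᶠ t in 𝓝 (0 : ℝ), γ t ∈ U :=
      hγ.continuousAt.eventually (U.2.mem_nhds (by rw [h0]; exact p.2))
    filter_upwards [this] with t ht using hc t ht
  exact h2.unique ((hasDerivAt_const (0 : ℝ) c).congr_of_eventuallyEq h3)

/-- The level curves of the Riemann invariant are the parabolas `(u + t, v + u t + t²/2)`, with
velocity `(1, u)` at `t = 0`. Differentiating `φ` along them requires no derivative of `F`. -/
theorem pu_of_riem {φ : SmoothFun U} {F : ℝ → ℝ} (h : ∀ p : U, ev p φ = F (riem p)) :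
    pu φ = -(cu * pv φ) := eq_of_ev fun p => by
  have hd : HasDerivAt (fun t : ℝ => (p.1.1 + t, p.1.2 + p.1.1 * t + t ^ 2 / 2)) (1, p.1.1) 0 := by
    refine HasDerivAt.prodMk ((hasDerivAt_id (0 : ℝ)).const_add _) ?_
    have h1 := ((hasDerivAt_id (0 : ℝ)).const_mul p.1.1).const_add p.1.2
    have h2 := ((hasDerivAt_id (0 : ℝ)).pow 2).div_const 2
    exact (h1.add h2).congr_deriv (by simp)
  have := ev_pd_of_curve (φ := φ) (p := p) (by simp) hd (c := F (riem p)) fun t ht => by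
    rw [ext_apply φ ⟨_, ht⟩, ← ev_apply, h]
    congr 1
    simp only [riem]
    ring
  simp only [one_mul] at this
  rw [map_neg, map_mul, ev_cu]
  linarith

theorem pu_of_snd {φ : SmoothFun U} {H : ℝ → ℝ} (h : ∀ p : U, ev p φ = H p.1.2) :
    pu φ = 0 := eq_of_ev fun p => by
  have hd : HasDerivAt (fun t : ℝ => (p.1.1 + t, p.1.2)) (1, 0) 0 :=
    HasDerivAt.prodMk ((hasDerivAt_id (0 : ℝ)).const_add _) (hasDerivAt_const _ _)
  have := ev_pd_of_curve (φ := φ) (p := p) (by simp) hd (c := H p.1.2) fun t ht => by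
    rw [ext_apply φ ⟨_, ht⟩, ← ev_apply, h]
  simpa using this

section NormalForm

variable {F G H : ℝ → ℝ} {φ γ η w : SmoothFun U}

theorem ev_nf₂₃ (hw : cu * w = 1) (hF : ∀ p : U, ev p φ = F (riem p))
    (hG : ∀ p : U, ev p γ = G (riem p)) (p : U) : ev p (nf₂₃ φ γ) = nfG F G p := by
  have hp := ev_cu_ne_zero hw p
  simp only [nf₂₃, nfG, nfF, map_add, map_mul, map_pow, ev_const, ev_cu, hF, hG]
  field_simp
  ring

theorem ev_nf₂₄ (hw : cu * w = 1) (hF : ∀ p : U, ev p φ = F (riem p))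
    (hG : ∀ p : U, ev p γ = G (riem p)) (hH : ∀ p : U, ev p η = H p.1.2) (p : U) :
    ev p (nf₂₄ φ γ η) = nfH F G H p := by
  have hp := ev_cu_ne_zero hw p
  simp only [nf₂₄, nfH, nfG, nfF, map_add, map_sub, map_neg, map_mul, map_pow, ev_const, ev_cu, hF,
    hG, hH]
  field_simp
  ring

theorem ev_nf (hw : cu * w = 1) (hF : ∀ p : U, ev p φ = F (riem p))
    (hG : ∀ p : U, ev p γ = G (riem p)) (hH : ∀ p : U, ev p η = H p.1.2) (p : U) :
    ev p (nf₁₆ φ γ η w) = nf16 F G H p ∧ ev p (nf₁₇ φ γ w) = nf17 F G p ∧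
      ev p (nf₂₅ φ γ) = nf25 F G p ∧ ev p (nf₂₆ φ γ w) = nf26 F G p := by
  have hp := ev_cu_ne_zero hw p
  have hf : ∀ p : U, ev p (φ * cu) = nfF F p := fun p => by simp [nfF, hF]
  have f₀ := hf p
  have f₁ := dv_eq hf p
  have f₂ := dv_eq (dv_eq hf) p
  have g₀ := ev_nf₂₃ hw hF hG p
  have g₁ := dv_eq (ev_nf₂₃ hw hF hG) p
  have g₂ := dv_eq (dv_eq (ev_nf₂₃ hw hF hG)) p
  have h₀ := ev_nf₂₄ hw hF hG hH p
  have h₁ := dv_eq (ev_nf₂₄ hw hF hG hH) p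
  refine ⟨?_, ?_, ?_, ?_⟩
  all_goals
    simp only [nf16, nf17, nf25, nf26, ← f₀, ← f₁, ← f₂, ← g₀, ← g₁, ← g₂, ← h₀, ← h₁, nf₁₆, nf₁₇,
      nf₂₅, nf₂₆, nf₂₃, nf₂₄, map_add, map_sub, map_neg, map_mul, map_pow, map_zero,
      Derivation.leibniz, Derivation.leibniz_pow, smul_eq_mul, nsmul_eq_mul, Nat.reduceSub, pow_one,
      pd_const, Derivation.map_natCast, pv_cu, pv_inv hw]
    simp only [ev_const, ev_inv hw, ev_cu, mul_zero, zero_mul, add_zero, zero_add, sub_zero,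
      neg_zero, map_ofNat (ev p), map_natCast, Nat.cast_ofNat]
    field_simp
    ring

/-- The normal form as a family of smooth functions. -/
noncomputable def normalFormFun (φ γ η w : SmoothFun U) : Fin 2 → Fin 8 → SmoothFun U :=
  ![![cu * cv - (1 / 3 : ℝ) • cu ^ 3, φ * cu, 0, 0, 0, 0, nf₁₆ φ γ η w, nf₁₇ φ γ w],
    ![(1 / 2 : ℝ) • cv ^ 2, 0, 0, nf₂₃ φ γ, nf₂₄ φ γ η, nf₂₅ φ γ, nf₂₆ φ γ w, -(cu * nf₂₆ φ γ w)]]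

theorem ev_normalFormFun (hw : cu * w = 1) (hF : ∀ p : U, ev p φ = F (riem p))
    (hG : ∀ p : U, ev p γ = G (riem p)) (hH : ∀ p : U, ev p η = H p.1.2) (i : Fin 2) (k : Fin 8)
    (p : U) : ev p (normalFormFun φ γ η w i k) = normalForm F G H i k p := by
  obtain ⟨h1, h2, h3, h4⟩ := ev_nf hw hF hG hH p
  have h5 := ev_nf₂₃ hw hF hG p
  have h6 := ev_nf₂₄ hw hF hG hH p
  have hf : ev p (φ * cu) = nfF F p := by simp [nfF, hF]
  have e0 : ev p (cu * cv - (1 / 3 : ℝ) • cu ^ 3) = flow21 0 p := by simp [flow21]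
  have e1 : ev p ((1 / 2 : ℝ) • cv ^ 2) = flow21 1 p := by simp [flow21]
  fin_cases i <;> fin_cases k <;> first
    | exact e0 | exact e1 | exact hf | exact h1 | exact h2 | exact h3 | exact h4 | exact h5
    | exact h6 | exact map_zero _ | skip
  change ev p (-(cu * nf₂₆ φ γ w)) = -(nf26 F G p) * p.1.1
  rw [map_neg, map_mul, h4, ev_cu]
  ring

end NormalForm

end SmoothFun

namespace DiffFun

open SmoothFun

variable {U : Opens (ℝ × ℝ)}

theorem part₀_normalFormFun (φ γ η w : SmoothFun U) :
    part₀ (normalFormFun φ γ η w) = flow₀ := by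
  funext i
  fin_cases i <;> rfl

theorem part₁_normalFormFun (φ γ η w : SmoothFun U) :
    part₁ (normalFormFun φ γ η w) = ![lin ![φ * cu, 0], 0] := by
  funext i
  fin_cases i
  · rfl
  · exact lin_eq_zero_iff.2 ⟨rfl, rfl⟩

theorem part₂_normalFormFun (φ γ η w : SmoothFun U) :
    part₂ (normalFormFun φ γ η w) =
      ![quad ![0, 0, 0, nf₁₆ φ γ η w, nf₁₇ φ γ w], quad ![nf₂₃ φ γ, nf₂₄ φ γ η, nf₂₅ φ γ,
          nf₂₆ φ γ w, -(cu * nf₂₆ φ γ w)]] := by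
  funext i
  fin_cases i <;> rfl

/-- The factors `u` are not cancelled, because `U` may meet `u = 0` here. -/
theorem isDispersionlessSymmetry_iff {a : Coeffs} (ha : ∀ i, ∀ p ∈ U, a i 0 p = flow21 i p)
    {h : Fin 2 → ℝ × ℝ → ℝ} {h₁ h₂ : SmoothFun U} (h₁' : ∀ p, SmoothFun.ev p h₁ = h 0 p)
    (h₂' : ∀ p, SmoothFun.ev p h₂ = h 1 p) :
    (∀ j : Jet, j.base ∈ U → ∀ i, bracket (hydro fun k => a k 0) (hydro h) i j = 0) ↔
      pu h₂ * cu = 0 ∧ -(pv h₁ * cu ^ 2) - pu h₁ * cu + pv h₂ * cu = 0 := by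
  have r1 : ∀ i, Rep (hydro (fun k => a k 0) i) ((flow₀ : Fin 2 → DiffFun U) i) := by
    intro i j
    change a i 0 j.1.base = _
    rw [ha i _ j.2]
    fin_cases i <;> simp [flow₀, flow21] <;> rfl
  have r2 : ∀ i, Rep (hydro h i) ((![coef h₁, coef h₂] : Fin 2 → DiffFun U) i) := by
    intro i
    fin_cases i
    · exact fun j => (h₁' j.pt).symm
    · exact fun j => (h₂' j.pt).symm
  have r3 : (∀ j : Jet, j.base ∈ U → ∀ i, bracket (hydro fun k => a k 0) (hydro h) i j = 0) ↔
      br flow₀ ![coef h₁, coef h₂] = 0 := by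
    constructor
    · exact fun H => funext fun i => eq_of_ev fun j => by
        rw [← Rep.bracket r1 r2 i j, H j.1 j.2 i]
        rfl
    · intro H j hj i
      rw [Rep.bracket r1 r2 i ⟨j, hj⟩, H]
      exact map_zero _
  rw [r3, br_hydro]
  constructor
  · intro H
    exact lin_eq_zero_iff.1 (congrFun H 0)
  · rintro ⟨e1, e2⟩
    funext i
    fin_cases i
    · exact lin_eq_zero_iff.2 ⟨e1, e2⟩
    -- The second flux adds no condition: its coefficients are `u` and `-1` times the first
    -- coefficient of the first flux.
    · exact lin_eq_zero_iff.2 ⟨by linear_combination cu * e1, by linear_combination -e1⟩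

theorem isDeformation_normalForm {F G H : ℝ → ℝ} (hU : ∀ q ∈ U, q.1 ≠ 0)
    (hF : ContDiffOn ℝ ∞ F (riem '' U)) (hG : ContDiffOn ℝ ∞ G (riem '' U))
    (hH : ContDiffOn ℝ ∞ H (Prod.snd '' (U : Set (ℝ × ℝ)))) :
    IsDeformation U (normalForm F G H) ∧ IntegrableUpToTwo U (normalForm F G H) := by
  have hr : ContDiffOn ℝ ∞ riem U := by unfold riem; fun_prop
  let φ : SmoothFun U := SmoothFun.mk (fun p => F (riem p)) (hF.comp hr (mapsTo_image _ _))
  let γ : SmoothFun U := SmoothFun.mk (fun p => G (riem p)) (hG.comp hr (mapsTo_image _ _))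
  let η : SmoothFun U := SmoothFun.mk (fun p => H p.2) (hH.comp contDiffOn_snd (mapsTo_image _ _))
  let w : SmoothFun U := SmoothFun.mk (fun p => p.1⁻¹) (contDiffOn_fst.inv hU)
  have hw : cu * w = 1 := SmoothFun.eq_of_ev fun p => by
    simp only [map_mul, ev_cu, w, ev_mk, map_one]
    exact mul_inv_cancel₀ (hU p p.2)
  have eF : ∀ p : U, SmoothFun.ev p φ = F (riem p) := fun _ => rfl
  have eG : ∀ p : U, SmoothFun.ev p γ = G (riem p) := fun _ => rfl
  have eH : ∀ p : U, SmoothFun.ev p η = H p.1.2 := fun _ => rfl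
  have ex := ev_normalFormFun hw eF eG eH
  have h0 : ∀ i, ∀ p ∈ (U : Set (ℝ × ℝ)), normalForm F G H i 0 p = flow21 i p := by
    intro i p _
    fin_cases i <;> rfl
  refine ⟨⟨fun i k => ?_, h0⟩, fun h hh => ?_⟩
  · exact (SmoothFun.contDiffOn_ext (normalFormFun φ γ η w i k)).congr fun p hp =>
      ((SmoothFun.ext_apply _ ⟨p, hp⟩).trans (ex i k ⟨p, hp⟩)).symm
  · let h₁ : SmoothFun U := SmoothFun.mk (h 0) (hh.1 0)
    let h₂ : SmoothFun U := SmoothFun.mk (h 1) (hh.1 1)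
    obtain ⟨e1, e2⟩ := (isDispersionlessSymmetry_iff (U := U) h0 (h₁ := h₁) (h₂ := h₂)
      (fun _ => rfl) (fun _ => rfl)).1 hh.2
    -- On `u ≠ 0` the common factor `u` can be cancelled.
    have h₂u : pu h₂ = 0 := by linear_combination w * e1 - pu h₂ * hw
    have h₁u : pu h₁ = pv h₂ - cu * pv h₁ := by
      linear_combination -w * e2 - (pu h₁ - pv h₂ + cu * pv h₁) * hw
    obtain ⟨b, hb⟩ := exists_second_order hw (pu_of_riem eF) (pu_of_riem eG) (pu_of_snd eH) h₂u h₁u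
    have hb₁ := exists_first_order hw (pu_of_riem eF) h₂u h₁u
    let y : Fin 2 → Fin 8 → SmoothFun U :=
      ![![h₁, sym₁₁ φ h₁ h₂, sym₁₂ φ h₁ h₂ w, b 0 0, b 0 1, b 0 2, b 0 3, b 0 4],
        ![h₂, 0, 0, b 1 0, b 1 1, b 1 2, b 1 3, b 1 4]]
    have y0 : part₀ y = ![coef h₁, coef h₂] := by
      funext i
      fin_cases i <;> rfl
    have y1 : part₁ y = ![lin ![sym₁₁ φ h₁ h₂, sym₁₂ φ h₁ h₂ w], 0] := by
      funext i
      fin_cases i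
      · rfl
      · exact lin_eq_zero_iff.2 ⟨rfl, rfl⟩
    have y2 : part₂ y = fun i => quad (b i) := by
      funext i
      fin_cases i <;> rfl
    refine ⟨fun i k => SmoothFun.ext (y i k), fun i k => SmoothFun.contDiffOn_ext _,
      fun i p hp => ?_, ?_⟩
    · refine (SmoothFun.ext_apply (y i 0) ⟨p, hp⟩).trans ?_
      fin_cases i <;> rfl
    · rw [commuteUpToTwo_iff ex (fun i k p => (SmoothFun.ext_apply (y i k) p).symm), y0, y1, y2,
        part₀_normalFormFun, part₁_normalFormFun, part₂_normalFormFun]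
      refine ⟨?_, hb₁, hb⟩
      rw [br_hydro]
      funext i
      fin_cases i
      · exact lin_eq_zero_iff.2 ⟨e1, e2⟩
      · exact lin_eq_zero_iff.2 ⟨by linear_combination cu * e1, by linear_combination -e1⟩

end DiffFun

/-! ### Necessary conditions from the single symmetry with flux `(v - u²/2, 0)`. -/

namespace SmoothFun

variable {U : Opens (ℝ × ℝ)}

/-- The Riemann invariant `v - u² / 2`. -/
noncomputable def riemFun : SmoothFun U := cv - const (1 / 2) * cu ^ 2

theorem ev_riemFun (p : U) : ev p riemFun = riem p := by
  simp only [riemFun, riem, map_sub, map_mul, map_pow, ev_cu, ev_cv, ev_const]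
  ring

theorem pv_riemFun : pv (riemFun : SmoothFun U) = 1 := by
  simp [riemFun, pd_const]

theorem pu_riemFun : pu (riemFun : SmoothFun U) = -cu := eq_of_ev fun p => by
  simp only [riemFun, map_sub, map_mul, Derivation.leibniz, Derivation.leibniz_pow, pu_cu, pu_cv,
    pd_const, smul_eq_mul, nsmul_eq_mul, map_add, map_zero, map_neg, ev_const, ev_cu, map_natCast,
    map_pow, map_one]
  norm_num
  ring

end SmoothFun

namespace DiffFun

open SmoothFun

variable {U : Opens (ℝ × ℝ)}

/-- The equations determine the symmetry coefficients one after another. What survives says that `f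
/ u` is a first integral of `∂_u + u ∂_v` and that `p` vanishes. -/
theorem first_order_normal {w f p b₁₁ b₁₂ b₂₁ b₂₂ : SmoothFun U} (hw : cu * w = 1)
    (h : br flow₀ ![lin ![b₁₁, b₁₂], lin ![b₂₁, b₂₂]]
      + br ![lin ![f, 0], lin ![0, p]] ![coef riemFun, coef 0] = 0) :
    p = 0 ∧ b₂₁ = 0 ∧ b₂₂ = 0 ∧ ∃ φ : SmoothFun U, pu φ = -(cu * pv φ) ∧ f = φ * cu ∧
      b₁₁ = const (1 / 2) * φ ∧ b₁₂ = const (1 / 2) * φ * w := by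
  rw [br_first_order] at h
  obtain ⟨e0, e1, e2, e3, e4⟩ := quad_eq_zero_iff.1 (congrFun h 0)
  obtain ⟨-, -, -, d3, d4⟩ := quad_eq_zero_iff.1 (congrFun h 1)
  simp only [pv_riemFun, pu_riemFun, map_zero, map_neg, pu_cu, pv_cu, mul_zero, add_zero, sub_zero,
    zero_add, Derivation.map_one_eq_zero] at e0 e1 e2 e3 e4 d3 d4
  have hb : b₂₁ = 0 := by linear_combination w * e0 - b₂₁ * hw
  subst hb
  simp only [map_zero, mul_zero, zero_mul, sub_zero, add_zero, zero_sub, zero_add] at e2 e4 d4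
  have hb : b₂₂ = 0 := by
    have hd : pu b₂₂ * cu = pu p := by
      linear_combination w * d4 - (pu b₂₂ * cu - pu p) * hw
    linear_combination -d3 - hd
  subst hb
  simp only [map_zero, mul_zero, zero_mul, sub_zero, add_zero, zero_sub, zero_add] at e1 e3 e4 d3
  have i₁ := pu_inv hw
  have i₂ := pv_inv hw
  have h11 : b₁₁ = const (1 / 2) * f * w := SmoothFun.eq_of_ev fun x => by
    have hx := ev_cu_ne_zero hw x
    have := congrArg (SmoothFun.ev x) e2
    simp only [map_add, map_mul, map_neg, map_one, map_zero, map_ofNat (SmoothFun.ev x), ev_cu,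
      ev_const, ev_inv hw] at this ⊢
    linear_combination (norm := (field_simp; ring)) (1 / 2) * x.1.1⁻¹ * this
  have h12 : b₁₂ = (const (1 / 2) * f - p) * w ^ 2 := SmoothFun.eq_of_ev fun x => by
    have hx := ev_cu_ne_zero hw x
    have := congrArg (SmoothFun.ev x) e1
    simp only [h11, map_add, map_mul, map_neg, map_sub, map_pow, map_one, map_zero, ev_cu,
      ev_const, ev_inv hw] at this ⊢
    linear_combination (norm := (field_simp; ring)) -x.1.1⁻¹ ^ 2 * this
  subst h11 h12
  simp only [map_sub, Derivation.leibniz, Derivation.leibniz_pow, smul_eq_mul, nsmul_eq_mul, i₁, i₂,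
    pd_const, Nat.reduceSub, pow_one, mul_zero, add_zero] at e3 e4
  -- At this stage `d3` reads `∂_u p = 0`; inserting it into `e4` leaves `(∂_u + u ∂_v) f = f / u`.
  have hX : ∀ x, SmoothFun.ev x (pu f) + x.1.1 * SmoothFun.ev x (pv f)
      = SmoothFun.ev x f * x.1.1⁻¹ := fun x => by
    have hx := ev_cu_ne_zero hw x
    have h3 := congrArg (SmoothFun.ev x) d3
    have h4 := congrArg (SmoothFun.ev x) e4
    simp only [map_add, map_mul, map_neg, map_sub, map_pow, map_one, map_zero,
      map_ofNat (SmoothFun.ev x), ev_cu, ev_const, ev_inv hw] at h3 h4 ⊢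
    linear_combination (norm := (field_simp; ring)) 2 * h4 + 2 * h3
  have hp : p = 0 := SmoothFun.eq_of_ev fun x => by
    have hx := ev_cu_ne_zero hw x
    have h3 := congrArg (SmoothFun.ev x) d3
    have h4 := congrArg (SmoothFun.ev x) e3
    simp only [map_add, map_mul, map_neg, map_sub, map_pow, map_one, map_zero, map_natCast,
      Nat.cast_ofNat, map_ofNat (SmoothFun.ev x), ev_cu, ev_const, ev_inv hw] at h3 h4 ⊢
    linear_combination (norm := (field_simp; ring))
      -x.1.1 ^ 2 * h4 + x.1.1 * h3 - (1 / 2) * x.1.1 * hX x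
  subst hp
  refine ⟨rfl, rfl, rfl, f * w, SmoothFun.eq_of_ev fun x => ?_, ?_, ?_, ?_⟩
  · have hx := ev_cu_ne_zero hw x
    simp only [map_add, Derivation.leibniz, smul_eq_mul, i₁, i₂, map_mul, map_neg, map_pow, map_zero,
      ev_cu, ev_inv hw]
    linear_combination (norm := (field_simp; ring)) x.1.1⁻¹ * hX x
  · linear_combination -f * hw
  · ring
  · ring

end DiffFun

namespace DiffFun

open SmoothFun

variable {U : Opens (ℝ × ℝ)}

-- The unknown `b`'s enter triangularly, so each can be solved for and substituted. The remaining
-- equations are conditions on the deformation alone; they involve `g`, `h`, `a₂₅`, `a₂₆` but not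
-- `a₁₆`, `a₁₇`.
set_option maxHeartbeats 1000000 in
theorem second_order_leading {w φ a₁₆ a₁₇ g h a₂₅ a₂₆ b₁₃ b₁₄ b₁₅ b₁₆ b₁₇ b₂₃ b₂₄ b₂₅ b₂₆ b₂₇ : SmoothFun U}
    (hw : cu * w = 1) (hφ : pu φ = -(cu * pv φ)) (H : 
    br flow₀ ![quad ![b₁₃, b₁₄, b₁₅, b₁₆, b₁₇], quad ![b₂₃, b₂₄, b₂₅, b₂₆, b₂₇]]
        + br ![lin ![φ * cu, 0], 0] ![lin ![const (1 / 2) * φ, const (1 / 2) * φ * w], 0]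
        + br ![quad ![0, 0, 0, a₁₆, a₁₇], quad ![g, h, a₂₅, a₂₆, -(cu * a₂₆)]]
          ![coef riemFun, coef 0] = 0) :
    a₂₅ = pu g ∧ a₂₆ = pu (pu g) * w - pu g * w ^ 2 ∧ pu h = g * w ^ 2 - pu g * w ∧
      pu g + cu * pv g = const 3 * g * w - const (2 / 3) * φ ^ 2 := by
  rw [br_second_order] at H
  obtain ⟨-, -, e2, -, e4, -, -, -, -, -⟩ := cubic_eq_zero_iff.1 (congrFun H 0)
  obtain ⟨d0, -, d2, d3, d4, d5, d6, -, d8, d9⟩ := cubic_eq_zero_iff.1 (congrFun H 1)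
  have i₁ := pu_inv hw
  have i₂ := pv_inv hw
  have φ₁ := pu_pv_of_riem hφ
  have hb : b₂₃ = g * w :=
    SmoothFun.eq_of_ev fun x => by
    have hx := ev_cu_ne_zero hw x
    have kd0 := congrArg (SmoothFun.ev x) d0
    simp only [pd_add, pd_sub, pd_neg, pd_mul, pd_pow, pd_zero, pd_one,
      pd_natCast, pd_ofNat, i₁, i₂, pd_const,
      pu_cu, pv_cu, pu_riemFun, pv_riemFun, Nat.reduceSub, pow_one, hφ, φ₁, pv_pu] at kd0 ⊢
    simp only [ev_add, ev_sub, ev_neg, ev_mul, ev_pow, ev_one, ev_zero, ev_natCast,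
      ev_ofNat, Nat.cast_ofNat, ev_cu, ev_const, ev_inv hw] at kd0 ⊢
    linear_combination (norm := (field_simp; ring)) x.1.1⁻¹ ^ 2 * kd0
  subst hb
  have hb : b₂₅ = a₂₅ * w - g * w ^ 2 :=
    SmoothFun.eq_of_ev fun x => by
    have hx := ev_cu_ne_zero hw x
    have kd2 := congrArg (SmoothFun.ev x) d2
    simp only [pd_add, pd_sub, pd_neg, pd_mul, pd_pow, pd_zero, pd_one,
      pd_natCast, pd_ofNat, i₁, i₂, pd_const,
      pu_cu, pv_cu, pu_riemFun, pv_riemFun, Nat.reduceSub, pow_one, hφ, φ₁, pv_pu] at kd2 ⊢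
    simp only [ev_add, ev_sub, ev_neg, ev_mul, ev_pow, ev_one, ev_zero, ev_natCast,
      ev_ofNat, Nat.cast_ofNat, ev_cu, ev_const, ev_inv hw] at kd2 ⊢
    linear_combination (norm := (field_simp; ring)) (1 / 2) * x.1.1⁻¹ ^ 2 * kd2
  subst hb
  have hb : b₂₇ = -(a₂₆) + const 2 * g * w ^ 3 :=
    SmoothFun.eq_of_ev fun x => by
    have hx := ev_cu_ne_zero hw x
    have kd4 := congrArg (SmoothFun.ev x) d4
    simp only [pd_add, pd_sub, pd_neg, pd_mul, pd_pow, pd_zero, pd_one,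
      pd_natCast, pd_ofNat, i₁, i₂, pd_const,
      pu_cu, pv_cu, pu_riemFun, pv_riemFun, Nat.reduceSub, pow_one, hφ, φ₁, pv_pu] at kd4 ⊢
    simp only [ev_add, ev_sub, ev_neg, ev_mul, ev_pow, ev_one, ev_zero, ev_natCast,
      ev_ofNat, Nat.cast_ofNat, ev_cu, ev_const, ev_inv hw] at kd4 ⊢
    linear_combination (norm := (field_simp; ring)) x.1.1⁻¹ ^ 2 * kd4
  subst hb
  -- A combination of two equations cancels `pu b₂₄`, which makes the determination algebraic; the
  -- same device gives `b₂₆` next.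
  have hb : b₂₄ = -(g * w ^ 2) :=
    SmoothFun.eq_of_ev fun x => by
    have hx := ev_cu_ne_zero hw x
    have kd5 := congrArg (SmoothFun.ev x) d5
    have kd3 := congrArg (SmoothFun.ev x) d3
    simp only [pd_add, pd_sub, pd_neg, pd_mul, pd_pow, pd_zero, pd_one,
      pd_natCast, pd_ofNat, i₁, i₂, pd_const,
      pu_cu, pv_cu, pu_riemFun, pv_riemFun, Nat.reduceSub, pow_one, hφ, φ₁, pv_pu] at kd5 kd3 ⊢
    simp only [ev_add, ev_sub, ev_neg, ev_mul, ev_pow, ev_one, ev_zero, ev_natCast,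
      ev_ofNat, Nat.cast_ofNat, ev_cu, ev_const, ev_inv hw] at kd5 kd3 ⊢
    linear_combination (norm := (field_simp; ring)) -(1 / 3) * (kd5 + x.1.1⁻¹ * kd3)
  subst hb
  have hb : b₂₆ = a₂₆ * w - pu g * w ^ 3 :=
    SmoothFun.eq_of_ev fun x => by
    have hx := ev_cu_ne_zero hw x
    have kd9 := congrArg (SmoothFun.ev x) d9
    have kd8 := congrArg (SmoothFun.ev x) d8
    simp only [pd_add, pd_sub, pd_neg, pd_mul, pd_pow, pd_zero, pd_one,
      pd_natCast, pd_ofNat, i₁, i₂, pd_const,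
      pu_cu, pv_cu, pu_riemFun, pv_riemFun, Nat.reduceSub, pow_one, hφ, φ₁, pv_pu] at kd9 kd8 ⊢
    simp only [ev_add, ev_sub, ev_neg, ev_mul, ev_pow, ev_one, ev_zero, ev_natCast,
      ev_ofNat, Nat.cast_ofNat, ev_cu, ev_const, ev_inv hw] at kd9 kd8 ⊢
    linear_combination (norm := (field_simp; ring)) -(1 / 2) * (kd9 + x.1.1⁻¹ * kd8)
  subst hb
  have hb : a₂₅ = pu g :=
    SmoothFun.eq_of_ev fun x => by
    have hx := ev_cu_ne_zero hw x
    have kd6 := congrArg (SmoothFun.ev x) d6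
    simp only [pd_add, pd_sub, pd_neg, pd_mul, pd_pow, pd_zero, pd_one,
      pd_natCast, pd_ofNat, i₁, i₂, pd_const,
      pu_cu, pv_cu, pu_riemFun, pv_riemFun, Nat.reduceSub, pow_one, hφ, φ₁, pv_pu] at kd6 ⊢
    simp only [ev_add, ev_sub, ev_neg, ev_mul, ev_pow, ev_one, ev_zero, ev_natCast,
      ev_ofNat, Nat.cast_ofNat, ev_cu, ev_const, ev_inv hw] at kd6 ⊢
    linear_combination (norm := (field_simp; ring)) kd6
  subst hb
  have hb : b₁₃ = const (1 / 6) * φ ^ 2 * w + const (1 / 2) * g * w ^ 2 :=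
    SmoothFun.eq_of_ev fun x => by
    have hx := ev_cu_ne_zero hw x
    have ke2 := congrArg (SmoothFun.ev x) e2
    simp only [pd_add, pd_sub, pd_neg, pd_mul, pd_pow, pd_zero, pd_one,
      pd_natCast, pd_ofNat, i₁, i₂, pd_const,
      pu_cu, pv_cu, pu_riemFun, pv_riemFun, Nat.reduceSub, pow_one, hφ, φ₁, pv_pu] at ke2 ⊢
    simp only [ev_add, ev_sub, ev_neg, ev_mul, ev_pow, ev_one, ev_zero, ev_natCast,
      ev_ofNat, Nat.cast_ofNat, ev_cu, ev_const, ev_inv hw] at ke2 ⊢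
    linear_combination (norm := (field_simp; ring)) (1 / 6) * x.1.1⁻¹ * ke2
  subst hb
  have hb : a₂₆ = pu (pu g) * w - pu g * w ^ 2 :=
    SmoothFun.eq_of_ev fun x => by
    have hx := ev_cu_ne_zero hw x
    have kd9 := congrArg (SmoothFun.ev x) d9
    simp only [pd_add, pd_sub, pd_neg, pd_mul, pd_pow, pd_zero, pd_one,
      pd_natCast, pd_ofNat, i₁, i₂, pd_const,
      pu_cu, pv_cu, pu_riemFun, pv_riemFun, Nat.reduceSub, pow_one, hφ, φ₁, pv_pu] at kd9 ⊢
    simp only [ev_add, ev_sub, ev_neg, ev_mul, ev_pow, ev_one, ev_zero, ev_natCast,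
      ev_ofNat, Nat.cast_ofNat, ev_cu, ev_const, ev_inv hw] at kd9 ⊢
    linear_combination (norm := (field_simp; ring)) -x.1.1 * kd9
  subst hb
  refine ⟨rfl, rfl, ?_, ?_⟩
  · refine SmoothFun.eq_of_ev fun x => ?_
    have hx := ev_cu_ne_zero hw x
    have kd3 := congrArg (SmoothFun.ev x) d3
    simp only [pd_add, pd_sub, pd_neg, pd_mul, pd_pow, pd_zero, pd_one,
      pd_natCast, pd_ofNat, i₁, i₂, pd_const,
      pu_cu, pv_cu, pu_riemFun, pv_riemFun, Nat.reduceSub, pow_one, hφ, φ₁, pv_pu] at kd3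
    simp only [ev_add, ev_sub, ev_neg, ev_mul, ev_pow, ev_one, ev_zero, ev_natCast,
      ev_ofNat, Nat.cast_ofNat, ev_cu, ev_const, ev_inv hw] at kd3 ⊢
    linear_combination (norm := (field_simp; ring)) -x.1.1⁻¹ * kd3
  · refine SmoothFun.eq_of_ev fun x => ?_
    have hx := ev_cu_ne_zero hw x
    have ke4 := congrArg (SmoothFun.ev x) e4
    simp only [pd_add, pd_sub, pd_neg, pd_mul, pd_pow, pd_zero, pd_one,
      pd_natCast, pd_ofNat, i₁, i₂, pd_const,
      pu_cu, pv_cu, pu_riemFun, pv_riemFun, Nat.reduceSub, pow_one, hφ, φ₁, pv_pu] at ke4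
    simp only [ev_add, ev_sub, ev_neg, ev_mul, ev_pow, ev_one, ev_zero, ev_natCast,
      ev_ofNat, Nat.cast_ofNat, ev_cu, ev_const, ev_inv hw] at ke4 ⊢
    linear_combination (norm := (field_simp; ring)) -2 * x.1.1 * ke4

-- Once `g, h, a₂₅, a₂₆` have their final form, the elimination continues with the rest of the first
-- flux. Equation `e3` then fixes `a₁₇`, and `e9` fixes `a₁₆`.
set_option maxHeartbeats 4000000 in
theorem second_order_trailing {w φ γ η a₁₆ a₁₇ b₁₃ b₁₄ b₁₅ b₁₆ b₁₇ b₂₃ b₂₄ b₂₅ b₂₆ b₂₇ : SmoothFun U}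
    (hw : cu * w = 1) (hφ : pu φ = -(cu * pv φ)) (hγ : pu γ = -(cu * pv γ)) (hη : pu η = 0) (H : 
    br flow₀ ![quad ![b₁₃, b₁₄, b₁₅, b₁₆, b₁₇], quad ![b₂₃, b₂₄, b₂₅, b₂₆, b₂₇]]
        + br ![lin ![φ * cu, 0], 0] ![lin ![const (1 / 2) * φ, const (1 / 2) * φ * w], 0]
        + br ![quad ![0, 0, 0, a₁₆, a₁₇], quad ![nf₂₃ φ γ, nf₂₄ φ γ η, nf₂₅ φ γ, nf₂₆ φ γ w,
          -(cu * nf₂₆ φ γ w)]]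
          ![coef riemFun, coef 0] = 0) :
    a₁₇ = nf₁₇ φ γ w ∧ a₁₆ = nf₁₆ φ γ η w := by
  rw [br_second_order] at H
  obtain ⟨-, e1, e2, e3, -, e5, e6, e7, -, e9⟩ := cubic_eq_zero_iff.1 (congrFun H 0)
  obtain ⟨d0, -, d2, d3, d4, d5, -, -, d8, d9⟩ := cubic_eq_zero_iff.1 (congrFun H 1)
  have i₁ := pu_inv hw
  have i₂ := pv_inv hw
  have φ₁ := pu_pv_of_riem hφ
  have φ₂ := pu_pv_of_riem φ₁
  have φ₃ := pu_pv_of_riem φ₂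
  have γ₁ := pu_pv_of_riem hγ
  have γ₂ := pu_pv_of_riem γ₁
  have η₁ := pu_pv_of_snd hη
  have hb : b₂₃ = const (1 / 3) * φ ^ 2 + γ * cu ^ 2 :=
    SmoothFun.eq_of_ev fun x => by
    have hx := ev_cu_ne_zero hw x
    have kd0 := congrArg (SmoothFun.ev x) d0
    simp only [pd_add, pd_sub, pd_neg, pd_mul, pd_pow, pd_zero, pd_one,
      pd_natCast, pd_ofNat, i₁, i₂, pd_const,
      pu_cu, pv_cu, pu_riemFun, pv_riemFun, Nat.reduceSub, pow_one, hφ, φ₁, φ₂, φ₃, hγ, γ₁, γ₂, hη, η₁, nf₁₇, nf₂₃, nf₂₄, nf₂₅, nf₂₆] at kd0 ⊢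
    simp only [ev_add, ev_sub, ev_neg, ev_mul, ev_pow, ev_one, ev_zero, ev_natCast,
      ev_ofNat, Nat.cast_ofNat, ev_cu, ev_const, ev_inv hw] at kd0 ⊢
    linear_combination (norm := (field_simp; ring)) x.1.1⁻¹ ^ 2 * kd0
  subst hb
  have hb : b₂₅ = -(const (2 / 3) * φ * pv φ * cu) + const 2 * γ * cu - pv γ * cu ^ 3 :=
    SmoothFun.eq_of_ev fun x => by
    have hx := ev_cu_ne_zero hw x
    have kd2 := congrArg (SmoothFun.ev x) d2
    simp only [pd_add, pd_sub, pd_neg, pd_mul, pd_pow, pd_zero, pd_one,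
      pd_natCast, pd_ofNat, i₁, i₂, pd_const,
      pu_cu, pv_cu, pu_riemFun, pv_riemFun, Nat.reduceSub, pow_one, hφ, φ₁, φ₂, φ₃, hγ, γ₁, γ₂, hη, η₁, nf₁₇, nf₂₃, nf₂₄, nf₂₅, nf₂₆] at kd2 ⊢
    simp only [ev_add, ev_sub, ev_neg, ev_mul, ev_pow, ev_one, ev_zero, ev_natCast,
      ev_ofNat, Nat.cast_ofNat, ev_cu, ev_const, ev_inv hw] at kd2 ⊢
    linear_combination (norm := (field_simp; ring)) (1 / 2) * x.1.1⁻¹ ^ 2 * kd2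
  subst hb
  have hb : b₂₇ = const (4 / 3) * φ * pv φ - const (2 / 3) * φ * pv (pv φ) * cu ^ 2 + φ ^ 2 * w ^ 2
        - const (2 / 3) * (pv φ) ^ 2 * cu ^ 2 - γ + const 6 * pv γ * cu ^ 2 - pv (pv γ) * cu ^ 4 :=
    SmoothFun.eq_of_ev fun x => by
    have hx := ev_cu_ne_zero hw x
    have kd4 := congrArg (SmoothFun.ev x) d4
    simp only [pd_add, pd_sub, pd_neg, pd_mul, pd_pow, pd_zero, pd_one,
      pd_natCast, pd_ofNat, i₁, i₂, pd_const,
      pu_cu, pv_cu, pu_riemFun, pv_riemFun, Nat.reduceSub, pow_one, hφ, φ₁, φ₂, φ₃, hγ, γ₁, γ₂, hη, η₁, nf₁₇, nf₂₃, nf₂₄, nf₂₅, nf₂₆] at kd4 ⊢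
    simp only [ev_add, ev_sub, ev_neg, ev_mul, ev_pow, ev_one, ev_zero, ev_natCast,
      ev_ofNat, Nat.cast_ofNat, ev_cu, ev_const, ev_inv hw] at kd4 ⊢
    linear_combination (norm := (field_simp; ring)) x.1.1⁻¹ ^ 2 * kd4
  subst hb
  have hb : b₂₄ = -(const (1 / 3) * φ ^ 2 * w) - γ * cu :=
    SmoothFun.eq_of_ev fun x => by
    have hx := ev_cu_ne_zero hw x
    have kd5 := congrArg (SmoothFun.ev x) d5
    have kd3 := congrArg (SmoothFun.ev x) d3
    simp only [pd_add, pd_sub, pd_neg, pd_mul, pd_pow, pd_zero, pd_one,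
      pd_natCast, pd_ofNat, i₁, i₂, pd_const,
      pu_cu, pv_cu, pu_riemFun, pv_riemFun, Nat.reduceSub, pow_one, hφ, φ₁, φ₂, φ₃, hγ, γ₁, γ₂, hη, η₁, nf₁₇, nf₂₃, nf₂₄, nf₂₅, nf₂₆] at kd5 kd3 ⊢
    simp only [ev_add, ev_sub, ev_neg, ev_mul, ev_pow, ev_one, ev_zero, ev_natCast,
      ev_ofNat, Nat.cast_ofNat, ev_cu, ev_const, ev_inv hw] at kd5 kd3 ⊢
    linear_combination (norm := (field_simp; ring)) -(1 / 3) * (kd5 + x.1.1⁻¹ * kd3)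
  subst hb
  have hb : b₂₆ = -(const (2 / 3) * φ * pv φ * w) + const (2 / 3) * φ * pv (pv φ) * cu
        - const (2 / 3) * φ ^ 2 * w ^ 3 + const (2 / 3) * (pv φ) ^ 2 * cu - const 5 * pv γ * cu
        + pv (pv γ) * cu ^ 3 :=
    SmoothFun.eq_of_ev fun x => by
    have hx := ev_cu_ne_zero hw x
    have kd9 := congrArg (SmoothFun.ev x) d9
    have kd8 := congrArg (SmoothFun.ev x) d8
    simp only [pd_add, pd_sub, pd_neg, pd_mul, pd_pow, pd_zero, pd_one,
      pd_natCast, pd_ofNat, i₁, i₂, pd_const,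
      pu_cu, pv_cu, pu_riemFun, pv_riemFun, Nat.reduceSub, pow_one, hφ, φ₁, φ₂, φ₃, hγ, γ₁, γ₂, hη, η₁, nf₁₇, nf₂₃, nf₂₄, nf₂₅, nf₂₆] at kd9 kd8 ⊢
    simp only [ev_add, ev_sub, ev_neg, ev_mul, ev_pow, ev_one, ev_zero, ev_natCast,
      ev_ofNat, Nat.cast_ofNat, ev_cu, ev_const, ev_inv hw] at kd9 kd8 ⊢
    linear_combination (norm := (field_simp; ring)) -(1 / 2) * (kd9 + x.1.1⁻¹ * kd8)
  subst hb
  have hb : b₁₃ = const (1 / 3) * φ ^ 2 * w + const (1 / 2) * γ * cu :=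
    SmoothFun.eq_of_ev fun x => by
    have hx := ev_cu_ne_zero hw x
    have ke2 := congrArg (SmoothFun.ev x) e2
    simp only [pd_add, pd_sub, pd_neg, pd_mul, pd_pow, pd_zero, pd_one,
      pd_natCast, pd_ofNat, i₁, i₂, pd_const,
      pu_cu, pv_cu, pu_riemFun, pv_riemFun, Nat.reduceSub, pow_one, hφ, φ₁, φ₂, φ₃, hγ, γ₁, γ₂, hη, η₁, nf₁₇, nf₂₃, nf₂₄, nf₂₅, nf₂₆] at ke2 ⊢
    simp only [ev_add, ev_sub, ev_neg, ev_mul, ev_pow, ev_one, ev_zero, ev_natCast,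
      ev_ofNat, Nat.cast_ofNat, ev_cu, ev_const, ev_inv hw] at ke2 ⊢
    linear_combination (norm := (field_simp; ring)) (1 / 6) * x.1.1⁻¹ * ke2
  subst hb
  have hb : b₁₄ = const (1 / 6) * φ ^ 2 * w ^ 2 - const (1 / 2) * γ - η * w ^ 2 :=
    SmoothFun.eq_of_ev fun x => by
    have hx := ev_cu_ne_zero hw x
    have ke1 := congrArg (SmoothFun.ev x) e1
    simp only [pd_add, pd_sub, pd_neg, pd_mul, pd_pow, pd_zero, pd_one,
      pd_natCast, pd_ofNat, i₁, i₂, pd_const,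
      pu_cu, pv_cu, pu_riemFun, pv_riemFun, Nat.reduceSub, pow_one, hφ, φ₁, φ₂, φ₃, hγ, γ₁, γ₂, hη, η₁, nf₁₇, nf₂₃, nf₂₄, nf₂₅, nf₂₆] at ke1 ⊢
    simp only [ev_add, ev_sub, ev_neg, ev_mul, ev_pow, ev_one, ev_zero, ev_natCast,
      ev_ofNat, Nat.cast_ofNat, ev_cu, ev_const, ev_inv hw] at ke1 ⊢
    linear_combination (norm := (field_simp; ring)) -x.1.1⁻¹ ^ 2 * ke1
  subst hb
  have hb : b₁₅ = -(const (7 / 12) * φ * pv φ) - const (1 / 6) * φ ^ 2 * w ^ 2 + const (3 / 4) * γ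
        - const (1 / 2) * pv γ * cu ^ 2 :=
    SmoothFun.eq_of_ev fun x => by
    have hx := ev_cu_ne_zero hw x
    have ke6 := congrArg (SmoothFun.ev x) e6
    simp only [pd_add, pd_sub, pd_neg, pd_mul, pd_pow, pd_zero, pd_one,
      pd_natCast, pd_ofNat, i₁, i₂, pd_const,
      pu_cu, pv_cu, pu_riemFun, pv_riemFun, Nat.reduceSub, pow_one, hφ, φ₁, φ₂, φ₃, hγ, γ₁, γ₂, hη, η₁, nf₁₇, nf₂₃, nf₂₄, nf₂₅, nf₂₆] at ke6 ⊢
    simp only [ev_add, ev_sub, ev_neg, ev_mul, ev_pow, ev_one, ev_zero, ev_natCast,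
      ev_ofNat, Nat.cast_ofNat, ev_cu, ev_const, ev_inv hw] at ke6 ⊢
    linear_combination (norm := (field_simp; ring)) (1 / 4) * x.1.1⁻¹ * ke6
  subst hb
  have hb : b₁₇ = const (1 / 2) * φ * pv φ * w - const (7 / 12) * φ * pv (pv φ) * cu
        + const (1 / 6) * φ ^ 2 * w ^ 3 - const (1 / 3) * (pv φ) ^ 2 * cu + const 3 * pv γ * cu
        - const (1 / 2) * pv (pv γ) * cu ^ 3 + const (1 / 2) * a₁₇ * w :=
    SmoothFun.eq_of_ev fun x => by
    have hx := ev_cu_ne_zero hw x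
    have ke7 := congrArg (SmoothFun.ev x) e7
    simp only [pd_add, pd_sub, pd_neg, pd_mul, pd_pow, pd_zero, pd_one,
      pd_natCast, pd_ofNat, i₁, i₂, pd_const,
      pu_cu, pv_cu, pu_riemFun, pv_riemFun, Nat.reduceSub, pow_one, hφ, φ₁, φ₂, φ₃, hγ, γ₁, γ₂, hη, η₁, nf₁₇, nf₂₃, nf₂₄, nf₂₅, nf₂₆] at ke7 ⊢
    simp only [ev_add, ev_sub, ev_neg, ev_mul, ev_pow, ev_one, ev_zero, ev_natCast,
      ev_ofNat, Nat.cast_ofNat, ev_cu, ev_const, ev_inv hw] at ke7 ⊢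
    linear_combination (norm := (field_simp; ring)) (1 / 2) * x.1.1⁻¹ * ke7
  subst hb
  have hb : a₁₇ = nf₁₇ φ γ w :=
    SmoothFun.eq_of_ev fun x => by
    have hx := ev_cu_ne_zero hw x
    have ke3 := congrArg (SmoothFun.ev x) e3
    simp only [pd_add, pd_sub, pd_neg, pd_mul, pd_pow, pd_zero, pd_one,
      pd_natCast, pd_ofNat, i₁, i₂, pd_const,
      pu_cu, pv_cu, pu_riemFun, pv_riemFun, Nat.reduceSub, pow_one, hφ, φ₁, φ₂, φ₃, hγ, γ₁, γ₂, hη, η₁, nf₁₇, nf₂₃, nf₂₄, nf₂₅, nf₂₆] at ke3 ⊢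
    simp only [ev_add, ev_sub, ev_neg, ev_mul, ev_pow, ev_one, ev_zero, ev_natCast,
      ev_ofNat, Nat.cast_ofNat, ev_cu, ev_const, ev_inv hw] at ke3 ⊢
    linear_combination (norm := (field_simp; ring)) 2 * x.1.1⁻¹ * ke3
  subst hb
  have hb : b₁₆ = const (19 / 12) * φ * pv φ * w ^ 2 - const (1 / 3) * φ ^ 2 * w ^ 4
        - const (9 / 4) * γ * w ^ 2 + const (1 / 2) * pv γ + const (1 / 2) * η * w ^ 4 + a₁₆ * w :=
    SmoothFun.eq_of_ev fun x => by
    have hx := ev_cu_ne_zero hw x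
    have ke5 := congrArg (SmoothFun.ev x) e5
    simp only [pd_add, pd_sub, pd_neg, pd_mul, pd_pow, pd_zero, pd_one,
      pd_natCast, pd_ofNat, i₁, i₂, pd_const,
      pu_cu, pv_cu, pu_riemFun, pv_riemFun, Nat.reduceSub, pow_one, hφ, φ₁, φ₂, φ₃, hγ, γ₁, γ₂, hη, η₁, nf₁₇, nf₂₃, nf₂₄, nf₂₅, nf₂₆] at ke5 ⊢
    simp only [ev_add, ev_sub, ev_neg, ev_mul, ev_pow, ev_one, ev_zero, ev_natCast,
      ev_ofNat, Nat.cast_ofNat, ev_cu, ev_const, ev_inv hw] at ke5 ⊢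
    linear_combination (norm := (field_simp; ring)) -(1 / 2) * x.1.1⁻¹ ^ 2 * ke5
  subst hb
  refine ⟨rfl, ?_⟩
  · refine SmoothFun.eq_of_ev fun x => ?_
    have hx := ev_cu_ne_zero hw x
    have ke9 := congrArg (SmoothFun.ev x) e9
    simp only [pd_add, pd_sub, pd_neg, pd_mul, pd_pow, pd_zero, pd_one,
      pd_natCast, pd_ofNat, i₁, i₂, pd_const,
      pu_cu, pv_cu, pu_riemFun, pv_riemFun, Nat.reduceSub, pow_one, hφ, φ₁, φ₂, φ₃, hγ, γ₁, γ₂, hη, η₁, nf₁₇, nf₂₃, nf₂₄, nf₂₅, nf₂₆] at ke9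
    rw [nf₁₆]
    simp only [ev_add, ev_sub, ev_neg, ev_mul, ev_pow, ev_one, ev_zero, ev_natCast,
      ev_ofNat, Nat.cast_ofNat, ev_cu, ev_const, ev_inv hw] at ke9 ⊢
    linear_combination (norm := (field_simp; ring)) -x.1.1 * ke9

end DiffFun

namespace DiffFun

open SmoothFun

variable {U : Opens (ℝ × ℝ)}

/-- The equations for `g` and `h` from `second_order_leading` are linear and of first order. They
integrate to a first integral of `∂_u + u ∂_v` and a function killed by `∂_u`, the future `G` and
`H`. -/
theorem second_order_normal {w φ a₁₆ a₁₇ g h a₂₅ a₂₆ : SmoothFun U} {b : Fin 2 → Fin 5 → SmoothFun U}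
    (hw : cu * w = 1) (hφ : pu φ = -(cu * pv φ)) (H : br flow₀ (fun i => quad (b i))
        + br ![lin ![φ * cu, 0], 0] ![lin ![const (1 / 2) * φ, const (1 / 2) * φ * w], 0]
        + br ![quad ![0, 0, 0, a₁₆, a₁₇], quad ![g, h, a₂₅, a₂₆, -(cu * a₂₆)]]
          ![coef riemFun, coef 0] = 0) :
    ∃ γ η : SmoothFun U, pu γ = -(cu * pv γ) ∧ pu η = 0 ∧ g = nf₂₃ φ γ ∧ h = nf₂₄ φ γ η ∧
      a₂₅ = nf₂₅ φ γ ∧ a₂₆ = nf₂₆ φ γ w ∧ a₁₇ = nf₁₇ φ γ w ∧ a₁₆ = nf₁₆ φ γ η w := by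
  have hb : (fun i => quad (b i)) = ![quad ![b 0 0, b 0 1, b 0 2, b 0 3, b 0 4],
      quad ![b 1 0, b 1 1, b 1 2, b 1 3, b 1 4]] := by
    funext i
    fin_cases i <;> rfl
  rw [hb] at H
  obtain ⟨e5, e6, eh, eg⟩ := second_order_leading hw hφ H
  have i₁ := pu_inv hw
  have i₂ := pv_inv hw
  have φ₁ := pu_pv_of_riem hφ
  -- Here `φ² u / 3` is a particular solution of the equation for `g`, and `u³` times a first
  -- integral solves the homogeneous one.
  obtain ⟨γ, hγ⟩ : ∃ γ, γ = (g - const (1 / 3) * φ ^ 2 * cu) * w ^ 3 := ⟨_, rfl⟩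
  obtain ⟨η, hη⟩ : ∃ η, η = h + g * w := ⟨_, rfl⟩
  have hg : g = nf₂₃ φ γ := SmoothFun.eq_of_ev fun x => by
    have hx := ev_cu_ne_zero hw x
    simp only [nf₂₃, hγ, map_add, map_sub, map_mul, map_pow, ev_const, ev_cu, ev_inv hw]
    field_simp
    ring
  have hh : h = nf₂₄ φ γ η := SmoothFun.eq_of_ev fun x => by
    have hx := ev_cu_ne_zero hw x
    simp only [nf₂₄, hγ, hη, map_add, map_sub, map_neg, map_mul, map_pow, ev_const, ev_cu, ev_inv hw]
    field_simp
    ring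
  have hγ' : pu γ = -(cu * pv γ) := SmoothFun.eq_of_ev fun x => by
    have hx := ev_cu_ne_zero hw x
    have k := congrArg (SmoothFun.ev x) eg
    simp only [hγ, map_add, map_sub, map_neg, map_mul, map_pow, ev_const, ev_cu, ev_inv hw,
      Derivation.leibniz, Derivation.leibniz_pow, smul_eq_mul, nsmul_eq_mul, i₁, i₂, hφ, pd_const,
      pu_cu, pv_cu, map_natCast, map_zero, map_one, Nat.reduceSub, Nat.cast_ofNat,
      map_ofNat (SmoothFun.ev x)] at k ⊢
    linear_combination (norm := (field_simp; ring)) x.1.1⁻¹ ^ 3 * k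
  have hη' : pu η = 0 := SmoothFun.eq_of_ev fun x => by
    have hx := ev_cu_ne_zero hw x
    have k := congrArg (SmoothFun.ev x) eh
    simp only [hη, map_add, map_sub, map_neg, map_mul, map_pow, ev_const, ev_cu, ev_inv hw,
      Derivation.leibniz, smul_eq_mul, i₁, map_zero] at k ⊢
    linear_combination (norm := (field_simp; ring)) k
  have γ₁ := pu_pv_of_riem hγ'
  have h5 : a₂₅ = nf₂₅ φ γ := SmoothFun.eq_of_ev fun x => by
    rw [e5, hg]
    simp only [nf₂₃, nf₂₅, map_add, map_sub, map_neg, map_mul, map_pow, ev_const, ev_cu, ev_inv hw,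
      Derivation.leibniz, Derivation.leibniz_pow, smul_eq_mul, nsmul_eq_mul, hφ, hγ', pd_const,
      pu_cu, pv_cu, map_natCast, map_zero, map_one, Nat.reduceSub, Nat.cast_ofNat,
      map_ofNat (SmoothFun.ev x)]
    ring
  have h6 : a₂₆ = nf₂₆ φ γ w := SmoothFun.eq_of_ev fun x => by
    have hx := ev_cu_ne_zero hw x
    have k₂ : pu (2 : SmoothFun U) = 0 := Derivation.map_natCast pu 2
    have k₃ : pu (3 : SmoothFun U) = 0 := Derivation.map_natCast pu 3
    rw [e6, hg]
    simp only [nf₂₃, nf₂₆, map_add, map_sub, map_neg, map_mul, map_pow, ev_const, ev_cu, ev_inv hw,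
      Derivation.leibniz, Derivation.leibniz_pow, smul_eq_mul, nsmul_eq_mul, hφ, hγ', φ₁, γ₁, pd_const,
      pu_cu, pv_cu, map_natCast, Derivation.map_natCast, Derivation.map_one_eq_zero, map_zero, map_one,
      k₂, k₃, Nat.reduceSub, Nat.cast_ofNat, pow_one, map_ofNat (SmoothFun.ev x)]
    field_simp
    ring
  subst h5 h6
  rw [hg, hh] at H
  obtain ⟨h7, h8⟩ := second_order_trailing hw hφ hγ' hη' H
  exact ⟨γ, η, hγ', hη', hg, hh, rfl, rfl, h7, h8⟩

/-! ### Grading by the number of `x`-derivatives. -/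

/-- Differential polynomials of degree one. -/
def IsLin (P : DiffFun U) : Prop := ∃ a b, P = lin ![a, b]

/-- Differential polynomials of degree two. -/
def IsQuad (P : DiffFun U) : Prop := ∃ c, P = quad c

theorem isLin_lin (c : Fin 2 → SmoothFun U) : IsLin (lin c) := ⟨c 0, c 1, rfl⟩

theorem isLin_D_coef (φ : SmoothFun U) : IsLin (D (coef φ)) := ⟨pu φ, pv φ, D_coef φ⟩

theorem IsLin.add {P Q : DiffFun U} (hP : IsLin P) (hQ : IsLin Q) : IsLin (P + Q) := by
  obtain ⟨a, b, rfl⟩ := hP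
  obtain ⟨c, d, rfl⟩ := hQ
  refine ⟨a + c, b + d, ?_⟩
  simp only [lin, Matrix.cons_val, map_add]
  ring

theorem IsLin.coef_mul {P : DiffFun U} (hP : IsLin P) (φ : SmoothFun U) : IsLin (coef φ * P) := by
  obtain ⟨a, b, rfl⟩ := hP
  refine ⟨φ * a, φ * b, ?_⟩
  simp only [lin, Matrix.cons_val, map_mul]
  ring

theorem IsLin.neg {P : DiffFun U} (hP : IsLin P) : IsLin (-P) := by
  have h : coef (-1) * P = -P := by
    rw [map_neg, map_one]
    ring
  exact h ▸ hP.coef_mul (-1)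

theorem IsLin.sub {P Q : DiffFun U} (hP : IsLin P) (hQ : IsLin Q) : IsLin (P - Q) := by
  simpa [sub_eq_add_neg] using hP.add hQ.neg

theorem IsQuad.add {P Q : DiffFun U} (hP : IsQuad P) (hQ : IsQuad Q) : IsQuad (P + Q) := by
  obtain ⟨c, rfl⟩ := hP
  obtain ⟨d, rfl⟩ := hQ
  refine ⟨c + d, ?_⟩
  simp only [quad, Pi.add_apply, map_add]
  ring

theorem IsQuad.coef_mul {P : DiffFun U} (hP : IsQuad P) (φ : SmoothFun U) : IsQuad (coef φ * P) := by
  obtain ⟨c, rfl⟩ := hP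
  refine ⟨fun i => φ * c i, ?_⟩
  simp only [quad, map_mul]
  ring

theorem IsQuad.neg {P : DiffFun U} (hP : IsQuad P) : IsQuad (-P) := by
  have h : coef (-1) * P = -P := by
    rw [map_neg, map_one]
    ring
  exact h ▸ hP.coef_mul (-1)

theorem IsQuad.sub {P Q : DiffFun U} (hP : IsQuad P) (hQ : IsQuad Q) : IsQuad (P - Q) := by
  simpa [sub_eq_add_neg] using hP.add hQ.neg

theorem IsQuad.smul {P : DiffFun U} (hP : IsQuad P) (r : ℝ) : IsQuad (r • P) := by
  rw [Algebra.smul_def, ← AlgHom.commutes coef]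
  exact hP.coef_mul _

theorem IsLin.mul {P Q : DiffFun U} (hP : IsLin P) (hQ : IsLin Q) : IsQuad (P * Q) := by
  obtain ⟨a, b, rfl⟩ := hP
  obtain ⟨c, d, rfl⟩ := hQ
  refine ⟨![0, 0, a * c, b * d, a * d + b * c], ?_⟩
  simp only [lin, quad, Matrix.cons_val, map_add, map_mul, map_zero]
  ring

theorem IsLin.D {P : DiffFun U} (hP : IsLin P) : IsQuad (D P) := by
  obtain ⟨a, b, rfl⟩ := hP
  refine ⟨![a, b, pu a, pv b, pv a + pu b], ?_⟩
  simp only [lin, quad, Matrix.cons_val, map_add, Derivation.leibniz, D_coef, D_q, smul_eq_mul]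
  ring

theorem isLin_cl_coef (M : Fin 2 → SmoothFun U) (φ : SmoothFun U) :
    IsLin (cl (fun k => coef (M k)) (coef φ)) := by
  rw [cl_coef]
  exact ((isLin_D_coef _).coef_mul _).add ((isLin_D_coef _).coef_mul _)

theorem isQuad_cl_coef {α : Fin 2 → DiffFun U} (hα : ∀ k, IsLin (α k)) (φ : SmoothFun U) :
    IsQuad (cl α (coef φ)) := by
  rw [cl_coef]
  exact ((hα 0).D.coef_mul _).add ((hα 1).D.coef_mul _)

theorem isQuad_cl_of_isLin (M : Fin 2 → SmoothFun U) {P : DiffFun U} (hP : IsLin P) :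
    IsQuad (cl (fun k => coef (M k)) P) := by
  obtain ⟨a, b, rfl⟩ := hP
  have h : ∀ (c : SmoothFun U) k, IsQuad (cl (fun k => coef (M k)) (coef c * q k 1)) := by
    intro c k
    rw [Derivation.leibniz, cl_q, smul_eq_mul, smul_eq_mul]
    refine ((isLin_D_coef (M k)).D.coef_mul c).add ?_
    rw [mul_comm]
    refine (isLin_cl_coef M c).mul ?_
    fin_cases k
    · exact ⟨1, 0, by simp [lin]⟩
    · exact ⟨0, 1, by simp [lin]⟩
  rw [lin, map_add]
  exact (h _ _).add (h _ _)

/-- A bracket adds the degrees of its arguments and one more. Hence transformed fluxes keep the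
shape of the ansatz, and the coefficient lemmas still apply to them. -/
theorem isLin_br (M N : Fin 2 → SmoothFun U) (i : Fin 2) :
    IsLin (br (fun k => coef (M k)) (fun k => coef (N k)) i) :=
  (isLin_cl_coef N _).sub (isLin_cl_coef M _)

theorem isQuad_br (M : Fin 2 → SmoothFun U) {α : Fin 2 → DiffFun U} (hα : ∀ k, IsLin (α k))
    (i : Fin 2) : IsQuad (br (fun k => coef (M k)) α i) :=
  (isQuad_cl_coef hα _).sub (isQuad_cl_of_isLin M (hα i))

theorem br_comm (α β : Fin 2 → DiffFun U) : br α β = -br β α := by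
  funext i
  simp [br]

theorem isLin_exp₁ (M N : Fin 2 → SmoothFun U) {β : Fin 2 → DiffFun U} (hβ : ∀ k, IsLin (β k))
    (i : Fin 2) : IsLin (exp₁ (fun k => coef (M k)) (fun k => coef (N k)) β i) :=
  (hβ i).add (isLin_br M N i)

theorem isQuad_exp₂ (M N : Fin 2 → SmoothFun U) {K β γ : Fin 2 → DiffFun U} (hK : ∀ k, IsLin (K k))
    (hβ : ∀ k, IsLin (β k)) (hγ : ∀ k, IsQuad (γ k)) (i : Fin 2) :
    IsQuad (exp₂ (fun k => coef (M k)) K (fun k => coef (N k)) β γ i) := by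
  refine (((hγ i).add ?_).add (isQuad_br M hβ i)).add ((isQuad_br M (isLin_br M N) i).smul _)
  rw [br_comm]
  exact (isQuad_br N hK i).neg

theorem br_zero_right (α : Fin 2 → DiffFun U) : br α 0 = 0 := by
  simpa using br_smul_right 0 α 0

/-! ### Normalisation by Miura transformations. -/

set_option maxHeartbeats 1000000 in
theorem exists_second_order_shape {w : SmoothFun U} (hw : cu * w = 1) (c : Fin 2 → Fin 5 → SmoothFun U) :
    ∃ (n : Fin 2 → Fin 2 → SmoothFun U) (a₁₆ a₁₇ g h a₂₅ a₂₆ : SmoothFun U),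
      (fun i => quad (c i)) - br flow₀ (fun i => lin (n i))
        = ![quad ![0, 0, 0, a₁₆, a₁₇], quad ![g, h, a₂₅, a₂₆, -(cu * a₂₆)]] := by
  have two : (2 : SmoothFun U) * const (1 / 2) = 1 := SmoothFun.eq_of_ev fun p => by
    simp [ev_const, map_ofNat (SmoothFun.ev p) 2]
  -- In the first flux `n₂₁`, `n₁₁`, `n₁₂` remove `uₓₓ`, `uₓ²`, `vₓₓ`. The function `n₂₂` imposes
  -- the relation between `uₓ vₓ` and `vₓ²` in the second flux, where its derivative cancels. No
  -- differential equation has to be solved.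
  obtain ⟨n₂₁, h21⟩ : ∃ n, n = c 0 0 * w := ⟨_, rfl⟩
  obtain ⟨n₁₁, h11⟩ : ∃ n, n = const (1 / 2) * (c 0 2 * w - pu n₂₁) := ⟨_, rfl⟩
  obtain ⟨n₂₂, h22⟩ : ∃ n, n = -(c 1 4 + 2 * n₂₁ + cu * pu n₂₁ + cu * c 1 3) * w := ⟨_, rfl⟩
  obtain ⟨n₁₂, h12⟩ : ∃ n, n = (n₂₂ * cu - n₁₁ * cu - c 0 1) * w ^ 2 := ⟨_, rfl⟩
  have lin0 : (![lin ![0, 0], lin ![0, 0]] : Fin 2 → DiffFun U) = 0 := by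
    funext i
    fin_cases i <;> exact lin_eq_zero_iff.2 ⟨rfl, rfl⟩
  have s₀ := br_first_order 0 0 0 0 n₁₁ n₁₂ n₂₁ n₂₂
  rw [lin0, br_comm 0, br_zero_right, neg_zero, add_zero] at s₀
  have hsub : ∀ (c : Fin 5 → SmoothFun U) (d₀ d₁ d₂ d₃ d₄ : SmoothFun U),
      quad c - quad ![d₀, d₁, d₂, d₃, d₄]
        = quad ![c 0 - d₀, c 1 - d₁, c 2 - d₂, c 3 - d₃, c 4 - d₄] := fun c d₀ d₁ d₂ d₃ d₄ => by
    simp only [quad, Matrix.cons_val, map_sub]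
    ring
  have hn : (fun i => lin (![![n₁₁, n₁₂], ![n₂₁, n₂₂]] i) : Fin 2 → DiffFun U)
      = ![lin ![n₁₁, n₁₂], lin ![n₂₁, n₂₂]] := by
    funext i
    fin_cases i <;> rfl
  have hq : ∀ P Q : Fin 2 → DiffFun U, P - Q = ![P 0 - Q 0, P 1 - Q 1] := fun P Q => by
    funext i
    fin_cases i <;> rfl
  refine ⟨![![n₁₁, n₁₂], ![n₂₁, n₂₂]], c 0 3 + n₁₂ + pv n₁₂ * cu ^ 2 + pu n₁₂ * cu - pv n₂₂ * cu,
    c 0 4 + 2 * n₁₁ + pv n₁₁ * cu ^ 2 + pu n₁₁ * cu - pv n₂₁ * cu - pu n₂₂ * cu,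
    c 1 0 - n₂₁ * cu ^ 2, c 1 1 + n₂₁ * cu, c 1 2 - 2 * n₂₁ * cu - pu n₂₁ * cu ^ 2,
    c 1 3 + n₂₂ + pu n₂₂ * cu, ?_⟩
  rw [hn, s₀, hq]
  simp only [Matrix.cons_val_zero, Matrix.cons_val_one, hsub, map_zero, zero_mul, mul_zero, add_zero,
    sub_zero]
  have e₀ : c 0 0 - n₂₁ * cu = 0 := by linear_combination -cu * h21 - c 0 0 * hw
  have e₁ : c 0 1 - (-(n₁₁ * cu) - n₁₂ * cu ^ 2 + n₂₂ * cu) = 0 := by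
    linear_combination cu ^ 2 * h12 + (n₂₂ * cu - n₁₁ * cu - c 0 1) * (cu * w + 1) * hw
  have e₂ : c 0 2 - (2 * n₁₁ * cu + pu n₂₁ * cu) = 0 := by
    linear_combination -2 * cu * h11 - (c 0 2 * w - pu n₂₁) * cu * two - c 0 2 * hw
  have e₄ : c 1 4 - (-(2 * n₂₁) - pu n₂₁ * cu + pu n₂₂ * cu ^ 2)
      = -(cu * (c 1 3 + n₂₂ + pu n₂₂ * cu)) := by
    linear_combination cu * h22 - (c 1 4 + 2 * n₂₁ + cu * pu n₂₁ + cu * c 1 3) * hw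
  rw [e₀, e₁, e₂, e₄]
  congr 3 <;> ring_nf

set_option maxHeartbeats 1000000 in
/-- The elements of the group of Miura transformations that bring the terms of first order and some
of the terms of second order to a normal shape. -/
theorem exists_normal {w : SmoothFun U} (hw : cu * w = 1) {x y : Fin 2 → Fin 8 → SmoothFun U}
    (hx₀ : part₀ x = flow₀) (hy₀ : part₀ y = ![coef riemFun, coef 0])
    (h₀ : br (part₀ x) (part₀ y) = 0)
    (h₁ : br (part₀ x) (part₁ y) + br (part₁ x) (part₀ y) = 0)
    (h₂ : br (part₀ x) (part₂ y) + br (part₁ x) (part₁ y) + br (part₂ x) (part₀ y) = 0)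
    {M : Fin 2 → SmoothFun U} (hM₁ : pu (M 1) = x 1 1 * w ^ 2)
    (hM₀ : pu (M 0) + cu * pv (M 0) = pv (M 1) - x 0 2 * w) :
    ∃ (φ γ η : SmoothFun U) (n : Fin 2 → Fin 2 → SmoothFun U), pu φ = -(cu * pv φ) ∧
      pu γ = -(cu * pv γ) ∧ pu η = 0 ∧
      exp₁ (fun k => coef (M k)) flow₀ (part₁ x) = part₁ (normalFormFun φ γ η w) ∧
      exp₂ (fun k => coef (M k)) (fun i => lin (n i)) flow₀ (part₁ x) (part₂ x)
        = part₂ (normalFormFun φ γ η w) := by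
  set K : Fin 2 → DiffFun U := fun k => coef (M k) with hK
  have hflow : (flow₀ : Fin 2 → DiffFun U) = fun k => coef (![cu * cv - (1 / 3 : ℝ) • cu ^ 3,
      (1 / 2 : ℝ) • cv ^ 2] k) := by
    funext k
    fin_cases k <;> rfl
  have hriem : (![coef riemFun, coef 0] : Fin 2 → DiffFun U) = fun k => coef (![riemFun, 0] k) := by
    funext k
    fin_cases k <;> rfl
  have lx : ∀ k, IsLin (part₁ x k) := fun k => isLin_lin _
  have ly : ∀ k, IsLin (part₁ y k) := fun k => isLin_lin _
  have qx : ∀ k, IsQuad (part₂ x k) := fun k => ⟨_, rfl⟩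
  have qy : ∀ k, IsQuad (part₂ y k) := fun k => ⟨_, rfl⟩
  rw [hx₀, hy₀] at h₀ h₁ h₂
  have E₁ := br_exp₁ K flow₀ (part₁ x) ![coef riemFun, coef 0] (part₁ y)
  rw [h₀, h₁, br_zero_right, add_zero] at E₁
  -- The equations `hM₁` and `hM₀` are exactly the vanishing of the `uₓ` term of the second flux and
  -- the `vₓ` term of the first.
  have a1 : exp₁ K flow₀ (part₁ x)
      = ![lin ![x 0 1 - x 1 1 * w, 0], lin ![0, x 1 2 + x 1 1 * w]] := by
    have hK2 : K = ![coef (M 0), coef (M 1)] := by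
      funext k
      fin_cases k <;> rfl
    rw [exp₁, br_comm K, hK2, br_hydro]
    funext i
    have hw' := congrArg (coef (U := U)) hw
    have hM₀' := congrArg (coef (U := U)) hM₀
    simp only [map_add, map_sub, map_mul, map_one] at hw' hM₀'
    fin_cases i
    · simp only [Pi.add_apply, Pi.neg_apply, part₁, lin, Matrix.cons_val, Fin.zero_eta, map_add,
        map_sub, map_neg, map_mul, map_pow, hM₁, map_zero]
      linear_combination (-(coef (x 1 1) * coef w * q 0 1) - coef (x 0 2) * q 1 1) * hw'
        + coef cu * q 1 1 * hM₀'
    · simp only [Pi.add_apply, Pi.neg_apply, part₁, lin, Matrix.cons_val, Fin.mk_one, map_add,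
        map_sub, map_neg, map_mul, map_pow, hM₁, map_zero]
      linear_combination (-(coef (x 1 1) * (coef cu * coef w + 1) * q 0 1)
        + coef (x 1 1) * coef w * q 1 1) * hw'
  obtain ⟨b₁₁, b₁₂, hb₁⟩ := isLin_exp₁ M ![riemFun, 0] ly 0
  obtain ⟨b₂₁, b₂₂, hb₂⟩ := isLin_exp₁ M ![riemFun, 0] ly 1
  rw [← hriem, ← hK] at hb₁ hb₂
  have hb : exp₁ K ![coef riemFun, coef 0] (part₁ y) = ![lin ![b₁₁, b₁₂], lin ![b₂₁, b₂₂]] := by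
    funext i
    fin_cases i
    exacts [hb₁, hb₂]
  rw [a1, hb] at E₁
  obtain ⟨hp, rfl, rfl, φ, hφ, hf, rfl, rfl⟩ := first_order_normal hw E₁
  have lin0 : (lin ![0, 0] : DiffFun U) = 0 := lin_eq_zero_iff.2 ⟨rfl, rfl⟩
  rw [hp, hf, lin0] at a1
  rw [lin0] at hb
  -- The second-order potential enters `exp₂` only through its bracket with the dispersionless flux,
  -- so it may first be set to zero and its effect added afterwards.
  obtain ⟨c, hc⟩ : ∃ c : Fin 2 → Fin 5 → SmoothFun U, ∀ i,
      exp₂ K 0 flow₀ (part₁ x) (part₂ x) i = quad (c i) := by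
    have : ∀ i, IsQuad (exp₂ K 0 flow₀ (part₁ x) (part₂ x) i) := fun i => by
      rw [hflow]
      exact isQuad_exp₂ M _ (fun k => ⟨0, 0, lin0.symm⟩) lx qx i
    choose c hc using this
    exact ⟨c, hc⟩
  obtain ⟨n, a₁₆, a₁₇, g, h, a₂₅, a₂₆, hn⟩ := exists_second_order_shape hw c
  have ha : exp₂ K (fun i => lin (n i)) flow₀ (part₁ x) (part₂ x)
      = ![quad ![0, 0, 0, a₁₆, a₁₇], quad ![g, h, a₂₅, a₂₆, -(cu * a₂₆)]] := by
    rw [← hn, ← funext hc]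
    simp only [exp₂, br_comm 0, br_zero_right, br_comm (fun i => lin (n i)) flow₀]
    abel
  obtain ⟨d, hd⟩ : ∃ d : Fin 2 → Fin 5 → SmoothFun U, ∀ i,
      exp₂ K (fun i => lin (n i)) ![coef riemFun, coef 0] (part₁ y) (part₂ y) i = quad (d i) := by
    have : ∀ i, IsQuad (exp₂ K (fun i => lin (n i)) ![coef riemFun, coef 0] (part₁ y) (part₂ y) i) :=
      fun i => by
        rw [hriem]
        exact isQuad_exp₂ M _ (fun k => isLin_lin _) ly qy i
    choose d hd using this
    exact ⟨d, hd⟩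
  -- The symmetry is transformed together with the deformation, so commutation persists in the
  -- normalised shape.
  have E₂ := br_exp₂ K (fun i => lin (n i)) flow₀ (part₁ x) (part₂ x) ![coef riemFun, coef 0]
    (part₁ y) (part₂ y)
  simp only [h₀, h₁, h₂, br_zero_right, add_zero, smul_zero] at E₂
  rw [a1, hb, ha, funext hd] at E₂
  obtain ⟨γ, η, hγ, hη, rfl, rfl, rfl, rfl, rfl, rfl⟩ := second_order_normal hw hφ E₂
  refine ⟨φ, γ, η, n, hφ, hγ, hη, ?_, ?_⟩
  · rw [a1, part₁_normalFormFun]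
  · rw [ha, part₂_normalFormFun]

end DiffFun

/-! ### Taylor estimates along quadratic curves. -/

theorem isBigO_one_of_continuous {f : ℝ → ℝ} (hf : Continuous f) : f =O[𝓝 0] fun _ => (1 : ℝ) :=
  (hf.tendsto 0).isBigO_one ℝ

theorem isBigO_mul_of_one {f g e : ℝ → ℝ} (hf : f =O[𝓝 0] fun _ => (1 : ℝ)) (hg : g =O[𝓝 0] e) :
    (fun ε => f ε * g ε) =O[𝓝 0] e := by
  simpa using hf.mul hg

/-- The mean value inequality on the interval of radius `|ε|` around zero gains one power of `ε`. -/
theorem isBigO_pow_succ_of_hasDerivAt {g h : ℝ → ℝ} {n : ℕ}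
    (hg : ∀ᶠ ε in 𝓝 0, HasDerivAt g (h ε) ε) (hh : h =O[𝓝 0] fun ε => ε ^ n) :
    (fun ε => g ε - g 0) =O[𝓝 0] fun ε => ε ^ (n + 1) := by
  obtain ⟨C, hC⟩ := hh.bound
  obtain ⟨δ, hδ, H⟩ := Metric.eventually_nhds_iff_ball.1 (hg.and hC)
  refine IsBigO.of_bound C ?_
  filter_upwards [Metric.ball_mem_nhds (0 : ℝ) hδ] with ε hε
  have sub : Metric.closedBall (0 : ℝ) |ε| ⊆ Metric.ball 0 δ := by
    intro t ht
    simp only [Metric.mem_closedBall, Metric.mem_ball, dist_zero_right, Real.norm_eq_abs] at *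
    linarith
  have hε' : 0 ≤ C * ‖ε ^ n‖ := (norm_nonneg _).trans (H ε hε).2
  have key := Convex.norm_image_sub_le_of_norm_hasDerivWithin_le (f := g) (f' := h)
    (C := C * ‖ε ^ n‖) (s := Metric.closedBall (0 : ℝ) |ε|) (x := 0) (y := ε)
    (fun t ht => (H t (sub ht)).1.hasDerivWithinAt) ?_ (convex_closedBall _ _) (by simp) (by simp)
  · refine key.trans (le_of_eq ?_)
    rw [sub_zero, pow_succ, norm_mul, mul_assoc]
  · intro t ht
    refine (H t (sub ht)).2.trans ?_
    rcases le_or_gt 0 C with h0 | h0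
    · rw [norm_pow, norm_pow]
      have : ‖t‖ ≤ ‖ε‖ := by simpa using ht
      gcongr
    -- The constant supplied by `IsBigO` need not be nonnegative; if it is negative, the bound
    -- forces `t ^ n = 0`.
    · have h1 : ‖t ^ n‖ = 0 := by
        have := (norm_nonneg _).trans (H t (sub ht)).2
        nlinarith [norm_nonneg (t ^ n)]
      rw [h1, mul_zero]
      exact hε'

namespace SmoothFun

variable {U : Opens (ℝ × ℝ)}

/-- A curve given by quadratic polynomials. -/
def quadCurve (p : U) (c d : ℝ × ℝ) (ε : ℝ) : ℝ × ℝ := p + ε • c + ε ^ 2 • d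

theorem tendsto_quadCurve (p : U) (c d : ℝ × ℝ) :
    Tendsto (quadCurve p c d) (𝓝 0) (𝓝 (p : ℝ × ℝ)) := by
  have : Continuous (quadCurve p c d) := by unfold quadCurve; fun_prop
  simpa [quadCurve] using this.tendsto 0

theorem eventually_quadCurve_mem (p : U) (c d : ℝ × ℝ) : ∀ᶠ ε in 𝓝 0, quadCurve p c d ε ∈ U :=
  (tendsto_quadCurve p c d).eventually (U.2.mem_nhds p.2)

theorem hasDerivAt_quadCurve (φ : SmoothFun U) (p : U) (c d : ℝ × ℝ) :
    ∀ᶠ ε in 𝓝 0, HasDerivAt (fun ε => ext φ (quadCurve p c d ε))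
      ((c.1 + 2 * ε * d.1) * ext (pu φ) (quadCurve p c d ε)
        + (c.2 + 2 * ε * d.2) * ext (pv φ) (quadCurve p c d ε)) ε := by
  filter_upwards [eventually_quadCurve_mem p c d] with ε hε
  have h1 : HasDerivAt (quadCurve p c d) (c + (2 * ε) • d) ε := by
    have h2 := ((hasDerivAt_id ε).smul_const c).const_add (p : ℝ × ℝ)
    have h3 := ((hasDerivAt_id ε).pow 2).smul_const d
    exact (h2.add h3).congr_deriv (by simp)
  have h2 := (differentiableAt_ext φ ⟨_, hε⟩).hasFDerivAt.comp_hasDerivAt ε h1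
  refine h2.congr_deriv ?_
  rw [ev_pd_eq_add, ext_apply _ ⟨_, hε⟩, ext_apply _ ⟨_, hε⟩]
  rfl

theorem taylor_one (φ : SmoothFun U) (p : U) (c d : ℝ × ℝ) :
    (fun ε => ext φ (quadCurve p c d ε) - ev p φ) =O[𝓝 0] fun ε => ε := by
  have hb : ∀ ψ : SmoothFun U, (fun ε => ext ψ (quadCurve p c d ε)) =O[𝓝 0] fun ε : ℝ => ε ^ 0 :=
    fun ψ => by
      simp only [pow_zero]
      exact Tendsto.isBigO_one ℝ ((contDiffAt_ext ψ p).continuousAt.tendsto.comp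
        (tendsto_quadCurve p c d))
  have hl : ∀ a b : ℝ, (fun ε : ℝ => a + 2 * ε * b) =O[𝓝 0] fun _ : ℝ => (1 : ℝ) := fun a b =>
    isBigO_one_of_continuous (by fun_prop)
  have := isBigO_pow_succ_of_hasDerivAt (hasDerivAt_quadCurve φ p c d) (n := 0)
    ((isBigO_mul_of_one (hl _ _) (hb _)).add (isBigO_mul_of_one (hl _ _) (hb _)))
  simpa [quadCurve, ext_apply, ev_apply] using this

/-- The derivative of the remainder is built from the lower-order remainders of `pu φ` and `pv φ`,
plus an explicit multiple of `ε`. The third-order estimate repeats this with `ε²`. -/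
theorem taylor_two (φ : SmoothFun U) (p : U) (c d : ℝ × ℝ) :
    (fun ε => ext φ (quadCurve p c d ε) - (ev p φ + ε * (c.1 * ev p (pu φ) + c.2 * ev p (pv φ))))
      =O[𝓝 0] fun ε => ε ^ 2 := by
  have hl : ∀ a b : ℝ, (fun ε : ℝ => a + 2 * ε * b) =O[𝓝 0] fun _ : ℝ => (1 : ℝ) := fun a b =>
    isBigO_one_of_continuous (by fun_prop)
  have hc : ∀ r : ℝ, (fun ε : ℝ => ε * r) =O[𝓝 0] fun ε : ℝ => ε := fun r => by
    simpa using (isBigO_refl (fun ε : ℝ => ε) (𝓝 0)).mul (isBigO_const_one ℝ r _)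
  have hd : ∀ᶠ ε in 𝓝 0, HasDerivAt (fun ε => ext φ (quadCurve p c d ε)
      - (ev p φ + ε * (c.1 * ev p (pu φ) + c.2 * ev p (pv φ))))
      ((c.1 + 2 * ε * d.1) * (ext (pu φ) (quadCurve p c d ε) - ev p (pu φ))
        + (c.2 + 2 * ε * d.2) * (ext (pv φ) (quadCurve p c d ε) - ev p (pv φ))
        + ε * (2 * d.1 * ev p (pu φ) + 2 * d.2 * ev p (pv φ))) ε := by
    filter_upwards [hasDerivAt_quadCurve φ p c d] with ε hε
    refine (hε.sub (((hasDerivAt_id ε).mul_const _).const_add _)).congr_deriv ?_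
    ring
  have := isBigO_pow_succ_of_hasDerivAt hd (n := 1)
    (by simpa using ((isBigO_mul_of_one (hl _ _) (taylor_one _ p c d)).add
      (isBigO_mul_of_one (hl _ _) (taylor_one _ p c d))).add (hc _))
  simpa [quadCurve, ext_apply, ev_apply] using this

theorem taylor_three (φ : SmoothFun U) (p : U) (c d : ℝ × ℝ) :
    (fun ε => ext φ (quadCurve p c d ε) - (ev p φ + ε * (c.1 * ev p (pu φ) + c.2 * ev p (pv φ))
      + ε ^ 2 * (d.1 * ev p (pu φ) + d.2 * ev p (pv φ) + 1 / 2 * (c.1 ^ 2 * ev p (pu (pu φ))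
        + 2 * c.1 * c.2 * ev p (pu (pv φ)) + c.2 ^ 2 * ev p (pv (pv φ))))))
      =O[𝓝 0] fun ε => ε ^ 3 := by
  have hl : ∀ a b : ℝ, (fun ε : ℝ => a + 2 * ε * b) =O[𝓝 0] fun _ : ℝ => (1 : ℝ) := fun a b =>
    isBigO_one_of_continuous (by fun_prop)
  have hc : ∀ r : ℝ, (fun ε : ℝ => ε ^ 2 * r) =O[𝓝 0] fun ε : ℝ => ε ^ 2 := fun r => by
    simpa using (isBigO_refl (fun ε : ℝ => ε ^ 2) (𝓝 0)).mul (isBigO_const_one ℝ r _)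
  have hd : ∀ᶠ ε in 𝓝 0, HasDerivAt (fun ε => ext φ (quadCurve p c d ε)
      - (ev p φ + ε * (c.1 * ev p (pu φ) + c.2 * ev p (pv φ))
      + ε ^ 2 * (d.1 * ev p (pu φ) + d.2 * ev p (pv φ) + 1 / 2 * (c.1 ^ 2 * ev p (pu (pu φ))
        + 2 * c.1 * c.2 * ev p (pu (pv φ)) + c.2 ^ 2 * ev p (pv (pv φ))))))
      ((c.1 + 2 * ε * d.1) * (ext (pu φ) (quadCurve p c d ε)
          - (ev p (pu φ) + ε * (c.1 * ev p (pu (pu φ)) + c.2 * ev p (pv (pu φ)))))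
        + (c.2 + 2 * ε * d.2) * (ext (pv φ) (quadCurve p c d ε)
          - (ev p (pv φ) + ε * (c.1 * ev p (pu (pv φ)) + c.2 * ev p (pv (pv φ)))))
        + ε ^ 2 * (2 * d.1 * (c.1 * ev p (pu (pu φ)) + c.2 * ev p (pv (pu φ)))
          + 2 * d.2 * (c.1 * ev p (pu (pv φ)) + c.2 * ev p (pv (pv φ))))) ε := by
    filter_upwards [hasDerivAt_quadCurve φ p c d] with ε hε
    refine (hε.sub ((((hasDerivAt_id ε).mul_const _).const_add _).add
      (((hasDerivAt_id ε).pow 2).mul_const _))).congr_deriv ?_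
    rw [pv_pu]
    simp
    ring
  have := isBigO_pow_succ_of_hasDerivAt hd (n := 2)
    (((isBigO_mul_of_one (hl _ _) (taylor_two _ p c d)).add
      (isBigO_mul_of_one (hl _ _) (taylor_two _ p c d))).add (hc _))
  simpa [quadCurve, ext_apply, ev_apply] using this

end SmoothFun

/-! ### Miura transformations as truncated exponentials. -/

namespace DiffFun

open SmoothFun

variable {U : Opens (ℝ × ℝ)}

/-- Second order Taylor polynomial of the exponential of `ε K + ε² L`. -/
noncomputable def expPoly (K L : Fin 2 → DiffFun U) (ε : ℝ) (P : DiffFun U) : DiffFun U :=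
  P + ε • cl K P + ε ^ 2 • ((1 / 2 : ℝ) • cl K (cl K P) + cl L P)

theorem isBigO_one_ev_expPoly (K L : Fin 2 → DiffFun U) (j : JetsOver U) (P : DiffFun U) :
    (fun ε => ev j (expPoly K L ε P)) =O[𝓝 0] fun _ => (1 : ℝ) := by
  refine isBigO_one_of_continuous ?_
  simp only [expPoly, map_add, map_smul, smul_eq_mul]
  fun_prop

/-- The exponential of a derivation is multiplicative, and its quadratic truncation is so up to
`ε³`. The estimate therefore passes to sums and products. It is exact on jet coordinates by `hJ`,
and on coefficients it is the third-order Taylor estimate. -/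
theorem ext_sub_expPoly (K L : Fin 2 → DiffFun U) (j : JetsOver U) {J : ℝ → Jet}
    (hJ : ∀ ε k s, J ε k s = ev j (expPoly K L ε (q k s))) (P : DiffFun U) :
    (fun ε => ext P (J ε) - ev j (expPoly K L ε P)) =O[𝓝 0] fun ε => ε ^ 3 := by
  have hJ' : ∀ ε, (J ε).base = quadCurve j.pt (ev j (D (K 0)), ev j (D (K 1)))
      (1 / 2 * ev j (cl K (D (K 0))) + ev j (D (L 0)), 1 / 2 * ev j (cl K (D (K 1))) + ev j (D (L 1))) ε := by
    intro ε
    have h0 := hJ ε 0 0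
    have h1 := hJ ε 1 0
    simp only [expPoly, map_add, map_smul, cl_q, zero_add, Function.iterate_one, smul_eq_mul, ev_q]
      at h0 h1
    exact Prod.ext h0 h1
  have hU : ∀ᶠ ε in 𝓝 0, (J ε).base ∈ U := by
    simp only [hJ']
    exact eventually_quadCurve_mem _ _ _
  induction P using DiffFun.induction with
  | hc φ =>
    refine (taylor_three φ j.pt (ev j (D (K 0)), ev j (D (K 1)))
      (1 / 2 * ev j (cl K (D (K 0))) + ev j (D (L 0)),
        1 / 2 * ev j (cl K (D (K 1))) + ev j (D (L 1)))).congr' ?_ EventuallyEq.rfl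
    filter_upwards [hU] with ε hε
    rw [ext_apply _ ⟨J ε, hε⟩, ev_coef, ← hJ' ε]
    have e : SmoothFun.ext φ (J ε).base = SmoothFun.ev (JetsOver.pt ⟨J ε, hε⟩) φ :=
      SmoothFun.ext_apply φ ⟨_, hε⟩
    rw [e]
    simp only [expPoly, map_add, map_smul, cl_coef, Derivation.leibniz, smul_eq_mul, map_mul, ev_coef,
      pv_pu]
    ring
  | hq k s =>
    refine EventuallyEq.trans_isBigO (f₂ := fun _ => 0) ?_ (isBigO_zero _ _)
    filter_upwards [hU] with ε hε
    rw [ext_apply _ ⟨J ε, hε⟩, ev_q, ← hJ, sub_self]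
  | hadd P Q hP hQ =>
    refine (hP.add hQ).congr' ?_ EventuallyEq.rfl
    filter_upwards [hU] with ε hε
    simp only [ext_apply _ ⟨J ε, hε⟩, expPoly, map_add, map_smul, smul_eq_mul]
    ring
  | hmul P Q hP hQ =>
    have bP : (fun ε => ext P (J ε)) =O[𝓝 0] fun _ => (1 : ℝ) := by
      have h3 : (fun ε : ℝ => ε ^ 3) =O[𝓝 0] fun _ => (1 : ℝ) :=
        isBigO_one_of_continuous (by fun_prop)
      exact ((hP.trans h3).add (isBigO_one_ev_expPoly K L j P)).congr_left fun ε => by ring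
    have h1 := bP.mul hQ
    have h2 := hP.mul (isBigO_one_ev_expPoly K L j Q)
    simp only [one_mul, mul_one] at h1 h2
    -- This is the product of the two truncated exponentials minus the truncated exponential of the
    -- product.
    have h3 : (fun ε : ℝ => ε ^ 3 * (ev j (cl K P) * ev j ((1 / 2 : ℝ) • cl K (cl K Q) + cl L Q)
        + ev j (cl K Q) * ev j ((1 / 2 : ℝ) • cl K (cl K P) + cl L P)
        + ε * (ev j ((1 / 2 : ℝ) • cl K (cl K P) + cl L P)
          * ev j ((1 / 2 : ℝ) • cl K (cl K Q) + cl L Q)))) =O[𝓝 0] fun ε => ε ^ 3 := by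
      simpa using (isBigO_refl (fun ε : ℝ => ε ^ 3) (𝓝 0)).mul (isBigO_one_of_continuous
        (f := fun ε : ℝ => ev j (cl K P) * ev j ((1 / 2 : ℝ) • cl K (cl K Q) + cl L Q)
        + ev j (cl K Q) * ev j ((1 / 2 : ℝ) • cl K (cl K P) + cl L P)
        + ε * (ev j ((1 / 2 : ℝ) • cl K (cl K P) + cl L P)
          * ev j ((1 / 2 : ℝ) • cl K (cl K Q) + cl L Q))) (by fun_prop))
    refine ((h1.add h2).add h3).congr' ?_ EventuallyEq.rfl
    filter_upwards [hU] with ε hε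
    simp only [ext_apply _ ⟨J ε, hε⟩, expPoly, map_add, map_smul, smul_eq_mul, map_mul,
      Derivation.leibniz]
    ring

end DiffFun

namespace DiffFun

open SmoothFun

variable {U : Opens (ℝ × ℝ)}

theorem D_iterate_q (k : Fin 2) (s : ℕ) : D^[s] (q k 0 : DiffFun U) = q k s := by
  induction s with
  | zero => rfl
  | succ s ih => rw [Function.iterate_succ_apply', ih, D_q]

theorem D_iterate_add (s : ℕ) (P Q : DiffFun U) : D^[s] (P + Q) = D^[s] P + D^[s] Q :=
  iterate_map_add D s P Q

theorem D_iterate_smul (s : ℕ) (r : ℝ) (P : DiffFun U) : D^[s] (r • P) = r • D^[s] P := by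
  induction s with
  | zero => rfl
  | succ s ih => rw [Function.iterate_succ_apply', ih, Derivation.map_smul, Function.iterate_succ_apply']

theorem rep_miuraPotential {M : Fin 2 → ℝ × ℝ → ℝ} {N : Fin 2 → Fin 2 → ℝ × ℝ → ℝ}
    {m : Fin 2 → SmoothFun U} {n : Fin 2 → Fin 2 → SmoothFun U}
    (hM : ∀ i p, SmoothFun.ev p (m i) = M i p) (hN : ∀ i k p, SmoothFun.ev p (n i k) = N i k p)
    (ε : ℝ) (i : Fin 2) :
    Rep (miuraPotential M N ε i) (ε • coef (m i) + ε ^ 2 • lin (n i)) := fun j => by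
  have hM' : SmoothFun.ev j.pt (m i) = M i j.1.base := hM i j.pt
  have hN' : ∀ k, SmoothFun.ev j.pt (n i k) = N i k j.1.base := fun k => hN i k j.pt
  simp [miuraPotential, lin, hM', hN']
  ring

theorem rep_miura {Y : Fin 2 → Jet → ℝ} {y : Fin 2 → DiffFun U} (h : ∀ i, Rep (Y i) (y i))
    (i : Fin 2) : Rep (miura Y i) (q i 0 + D (y i)) := fun j => by
  rw [miura, (h i).dx j, map_add, ev_q]

/-- Applying the exponential of `ε cl K + ε² cl K₂` to `u^i` gives `u^i + ∂ₓ(ε K_i + ε² (K₂_i + ½ cl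
K K_i))` up to `ε³`; hence the correction in `hn`. In these terms, carrying one system to the other
is conjugation by the exponential, which acts on fluxes by `exp₁` and `exp₂`. -/
theorem miuraCarries_of_exp {a a' : Coeffs} {x x' : Fin 2 → Fin 8 → SmoothFun U}
    (hx : ∀ i k p, SmoothFun.ev p (x i k) = a i k p)
    (hx' : ∀ i k p, SmoothFun.ev p (x' i k) = a' i k p)
    {M : Fin 2 → ℝ × ℝ → ℝ} {N : Fin 2 → Fin 2 → ℝ × ℝ → ℝ}
    {m : Fin 2 → SmoothFun U} {n : Fin 2 → Fin 2 → SmoothFun U}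
    (hM : ∀ i p, SmoothFun.ev p (m i) = M i p) (hN : ∀ i k p, SmoothFun.ev p (n i k) = N i k p)
    {K₂ : Fin 2 → DiffFun U} (h₀ : part₀ x' = part₀ x)
    (h₁ : part₁ x' = exp₁ (fun k => coef (m k)) (part₀ x) (part₁ x))
    (h₂ : part₂ x' = exp₂ (fun k => coef (m k)) K₂ (part₀ x) (part₁ x) (part₂ x))
    (hn : ∀ i, lin (n i) = K₂ i + (1 / 2 : ℝ) • cl (fun k => coef (m k)) (coef (m i))) :
    MiuraCarries U M N a a' := by
  intro j hj i
  set K : Fin 2 → DiffFun U := fun k => coef (m k) with hK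
  let j' : JetsOver U := ⟨j, hj⟩
  let y : ℝ → Fin 2 → DiffFun U := fun ε i => ε • K i + ε ^ 2 • lin (n i)
  have hy : ∀ ε i, Rep (miuraPotential M N ε i) (y ε i) := rep_miuraPotential hM hN
  let J : ℝ → Jet := fun ε => prolong (miura (miuraPotential M N ε)) j
  have hJ : ∀ ε k s, J ε k s = ev j' (expPoly K K₂ ε (q k s)) := by
    intro ε k s
    have h := (rep_miura (hy ε) k).dx_iterate s j'
    refine h.trans (congrArg _ ?_)
    have hc : cl K (D^[s + 1] (K k)) = D^[s + 1] (cl K (K k)) := (D_iterate_evo _ _ _).symm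
    rw [D_iterate_add, D_iterate_q, ← Function.iterate_succ_apply, expPoly, cl_q, cl_q, hc]
    simp only [y, hn, D_iterate_add, D_iterate_smul]
    simp only [hK]
    module
  have hU : ∀ᶠ ε in 𝓝 0, (J ε).base ∈ U := by
    have hc : Continuous fun ε => (J ε).base := by
      simp only [Jet.base, hJ, expPoly, map_add, map_smul, smul_eq_mul]
      fun_prop
    refine hc.continuousAt.eventually (U.2.mem_nhds ?_)
    have : (J 0).base = j.base := by
      simp only [Jet.base, hJ, expPoly, map_add, map_smul, smul_eq_mul]
      simp [j']
    change (J 0).base ∈ U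
    rw [this]
    exact hj
  have T := fun P => ext_sub_expPoly K K₂ j' hJ P
  have bε : (fun ε : ℝ => ε) =O[𝓝 0] fun _ => (1 : ℝ) := isBigO_one_of_continuous continuous_id
  have bε2 : (fun ε : ℝ => ε ^ 2) =O[𝓝 0] fun _ => (1 : ℝ) :=
    isBigO_one_of_continuous (by fun_prop)
  have S := ((T (part₀ x' i)).add (isBigO_mul_of_one bε (T (part₁ x' i)))).add
    (isBigO_mul_of_one bε2 (T (part₂ x' i)))
  -- After truncation both sides are polynomials in `ε`; the hypotheses on the parts cancel the
  -- terms below `ε³`.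
  obtain ⟨c₃, c₄, hc⟩ : ∃ c₃ c₄ : ℝ, ∀ ε : ℝ,
      ev j' ((part₀ x + ε • part₁ x + ε ^ 2 • part₂ x) i
          + cl (part₀ x + ε • part₁ x + ε ^ 2 • part₂ x) (y ε i))
        - (ev j' (expPoly K K₂ ε (part₀ x' i)) + ε * ev j' (expPoly K K₂ ε (part₁ x' i))
          + ε ^ 2 * ev j' (expPoly K K₂ ε (part₂ x' i))) = ε ^ 3 * (c₃ + ε * c₄) := by
    have e₁ : ev j' (part₁ x' i) = ev j' (part₁ x i) + ev j' (cl (part₀ x) (K i))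
        - ev j' (cl K (part₀ x i)) := by
      rw [h₁, exp₁, Pi.add_apply, br_apply, map_add, map_sub]
      ring
    have e₂ : ev j' (part₂ x' i) = ev j' (part₂ x i) + ev j' (cl (part₁ x) (K i))
        + ev j' (cl (part₀ x) (K₂ i)) - ev j' (cl K₂ (part₀ x i))
        + 1 / 2 * ev j' (cl (part₀ x) (cl K (K i))) - ev j' (cl K (part₁ x' i))
        - 1 / 2 * ev j' (cl K (cl K (part₀ x i))) := by
      rw [h₂, h₁, exp₂, exp₁]
      simp only [Pi.add_apply, Pi.smul_apply, br_apply, cl_br, Derivation.commutator_apply, map_add,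
        map_sub, map_smul, smul_eq_mul]
      ring
    refine ⟨ev j' (cl (part₁ x) (lin (n i))) + ev j' (cl (part₂ x) (K i))
      - ev j' (cl K (part₂ x' i)) - ev j' ((1 / 2 : ℝ) • cl K (cl K (part₁ x' i)) + cl K₂ (part₁ x' i)),
      ev j' (cl (part₂ x) (lin (n i)))
        - ev j' ((1 / 2 : ℝ) • cl K (cl K (part₂ x' i)) + cl K₂ (part₂ x' i)), fun ε => ?_⟩
    have e₃ : ev j' (cl (part₀ x) (lin (n i)))
        = ev j' (cl (part₀ x) (K₂ i)) + 1 / 2 * ev j' (cl (part₀ x) (cl K (K i))) := by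
      rw [hn, map_add, Derivation.map_smul, map_add, map_smul, smul_eq_mul]
    simp only [y, expPoly, cl_add, cl_smul, Derivation.add_apply, Derivation.smul_apply,
      Derivation.map_smul, map_add, map_smul, smul_eq_mul, Pi.add_apply, Pi.smul_apply, h₀]
    rw [e₃]
    linear_combination -ε * e₁ - ε ^ 2 * e₂
  have R : (fun ε : ℝ => ε ^ 3 * (c₃ + ε * c₄)) =O[𝓝 0] fun ε => ε ^ 3 := by
    simpa using (isBigO_refl (fun ε : ℝ => ε ^ 3) (𝓝 0)).mul
      (isBigO_one_of_continuous (f := fun ε => c₃ + ε * c₄) (by fun_prop))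
  refine (R.sub S).congr' ?_ EventuallyEq.rfl
  filter_upwards [hU] with ε hε
  have r₁ := rep_flux hx ε i j'
  have r₂ := Rep.evol_flow (rep_flux hx ε) (hy ε i) j'
  have r₃ := rep_flux hx' ε i ⟨J ε, hε⟩
  have r₁' : flux a ε i j = _ := r₁
  have r₂' : evol (flow (flux a ε)) (miuraPotential M N ε i) j = _ := r₂
  have r₃' : flux a' ε i (prolong (miura (miuraPotential M N ε)) j) = _ := r₃
  rw [r₁', r₂', r₃', ← hc]
  simp only [ext_apply _ ⟨J ε, hε⟩, map_add, map_smul, smul_eq_mul, Pi.add_apply, Pi.smul_apply]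
  ring

end DiffFun

/-! ### Local solution of the equations for the first-order potential. -/

open MeasureTheory in
-- Integration in `u` from `-∞` is convolution with the indicator of the half-line. For compactly
-- supported `ψ`, the regularity of convolutions with parameters gives smoothness jointly in `u` and
-- `v`.
theorem exists_contDiff_primitive {ψ : ℝ × ℝ → ℝ} (hψ : ContDiff ℝ ∞ ψ) (hc : HasCompactSupport ψ) :
    ∃ Ψ : ℝ × ℝ → ℝ, ContDiff ℝ ∞ Ψ ∧
      ∀ q : ℝ × ℝ, HasDerivAt (fun t => Ψ (t, q.2)) (ψ q) q.1 := by
  have hint : ∀ v, Integrable fun s => ψ (s, v) := fun v => by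
    refine (hψ.continuous.comp (Continuous.prodMk_left v)).integrable_of_hasCompactSupport ?_
    refine HasCompactSupport.intro (hc.isCompact.image continuous_fst) fun s hs => ?_
    by_contra h
    exact hs ⟨(s, v), subset_tsupport _ h, rfl⟩
  have hconv := contDiffOn_convolution_right_with_param (𝕜 := ℝ) (μ := volume) (n := ⊤)
    (f := (Ici (0 : ℝ)).indicator fun _ => (1 : ℝ)) (ContinuousLinearMap.mul ℝ ℝ)
    (g := fun (v : ℝ) (u : ℝ) => ψ (u, v)) (s := univ) (k := Prod.fst '' tsupport ψ) isOpen_univ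
    (hc.isCompact.image continuous_fst)
    (fun v u _ hu => by
      by_contra h
      exact hu ⟨(u, v), subset_tsupport _ h, rfl⟩)
    ((locallyIntegrable_const (1 : ℝ)).indicator measurableSet_Ici)
    (by
      refine ContDiff.contDiffOn ?_
      exact hψ.comp (contDiff_snd.prodMk contDiff_fst))
  rw [univ_prod_univ, contDiffOn_univ] at hconv
  have heq : ∀ u v : ℝ, convolution ((Ici (0 : ℝ)).indicator fun _ => (1 : ℝ))
      (fun u => ψ (u, v)) (ContinuousLinearMap.mul ℝ ℝ) volume u = ∫ s in Iic u, ψ (s, v) := by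
    intro u v
    rw [convolution_def, ← integral_indicator measurableSet_Iic,
      ← integral_sub_left_eq_self (fun s => (Iic u).indicator (fun s => ψ (s, v)) s) volume u]
    congr 1
    funext t
    by_cases ht : 0 ≤ t <;> simp [indicator, ht]
  refine ⟨fun q => ∫ s in Iic q.1, ψ (s, q.2), ?_, fun q => ?_⟩
  · have := hconv.comp (contDiff_snd.prodMk contDiff_fst : ContDiff ℝ ∞ fun q : ℝ × ℝ => (q.2, q.1))
    convert this using 1
    exact funext fun q => (heq q.1 q.2).symm
  · have h1 : (fun t => ∫ s in Iic t, ψ (s, q.2))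
        = fun t => (∫ s in Iic q.1, ψ (s, q.2)) + ∫ s in q.1..t, ψ (s, q.2) := by
      funext t
      rw [← intervalIntegral.integral_Iic_sub_Iic (hint _).integrableOn (hint _).integrableOn]
      ring
    change HasDerivAt (fun t => ∫ s in Iic t, ψ (s, q.2)) _ _
    rw [h1]
    refine HasDerivAt.const_add _ ?_
    have hcont : Continuous fun s => ψ (s, q.2) := hψ.continuous.comp (Continuous.prodMk_left q.2)
    exact intervalIntegral.integral_hasDerivAt_right (hcont.intervalIntegrable _ _)
      (hcont.stronglyMeasurableAtFilter _ _) hcont.continuousAt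

/-- A smooth bump supported in `U` and equal to one near `p` reduces this to compact support. -/
theorem exists_local_primitive {φ : ℝ × ℝ → ℝ} {U : Set (ℝ × ℝ)} (hU : IsOpen U)
    (hφ : ContDiffOn ℝ ∞ φ U) {p : ℝ × ℝ} (hp : p ∈ U) :
    ∃ Ψ : ℝ × ℝ → ℝ, ContDiff ℝ ∞ Ψ ∧
      ∀ᶠ q in 𝓝 p, HasDerivAt (fun t => Ψ (t, q.2)) (φ q) q.1 := by
  obtain ⟨r, hr, hrU⟩ := Metric.nhds_basis_closedBall.mem_iff.1 (hU.mem_nhds hp)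
  let χ : ContDiffBump p := ⟨r / 2, r, by linarith, by linarith⟩
  have h1 : ContDiff ℝ ∞ fun q => χ q * φ q := by
    rw [contDiff_iff_contDiffAt]
    intro q
    by_cases hq : q ∈ U
    · exact χ.contDiff.contDiffAt.mul (hφ.contDiffAt (hU.mem_nhds hq))
    · have hq' : q ∉ tsupport χ := fun h => hq (hrU (by rwa [χ.tsupport_eq] at h))
      refine contDiffAt_const (c := (0 : ℝ)) |>.congr_of_eventuallyEq ?_
      filter_upwards [(isClosed_tsupport χ).isOpen_compl.mem_nhds hq'] with x hx
      rw [image_eq_zero_of_notMem_tsupport hx, zero_mul]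
  obtain ⟨Ψ, hΨ, H⟩ := exists_contDiff_primitive h1 χ.hasCompactSupport.mul_right
  refine ⟨Ψ, hΨ, ?_⟩
  filter_upwards [Metric.closedBall_mem_nhds p χ.rIn_pos] with q hq
  have := H q
  rwa [χ.one_of_mem_closedBall hq, one_mul] at this

theorem contDiff_riem : ContDiff ℝ ∞ riem := by
  unfold riem
  fun_prop

/-- Solvability near a point of the equations for the terms of first order of a Miura
transformation. -/
theorem exists_local_solution {α β : ℝ × ℝ → ℝ} {U : Set (ℝ × ℝ)} (hU : IsOpen U)
    (hα : ContDiffOn ℝ ∞ α U) (hβ : ContDiffOn ℝ ∞ β U) {p : ℝ × ℝ} (hp : p ∈ U) :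
    ∃ Ψ₀ Ψ₁ : ℝ × ℝ → ℝ, ContDiff ℝ ∞ Ψ₀ ∧ ContDiff ℝ ∞ Ψ₁ ∧ ∀ᶠ q in 𝓝 p,
      fderiv ℝ Ψ₁ q (1, 0) = α q ∧ fderiv ℝ Ψ₀ q (1, q.1) = fderiv ℝ Ψ₁ q (0, 1) - β q := by
  obtain ⟨Ψ₁, h₁, e₁⟩ := exists_local_primitive hU hα hp
  -- In the coordinates `ζ = (u, v - u²/2)`, with inverse `θ`, the field `∂_u + u ∂_v` becomes
  -- `∂_u`, so the second equation is also solved by a primitive.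
  let θ : ℝ × ℝ → ℝ × ℝ := fun q => (q.1, q.2 + q.1 ^ 2 / 2)
  have hθ : ContDiff ℝ ∞ θ := by unfold θ; fun_prop
  let ζ : ℝ × ℝ → ℝ × ℝ := fun q => (q.1, riem q)
  have hζ : ContDiff ℝ ∞ ζ := contDiff_fst.prodMk contDiff_riem
  have hθζ : ∀ q, θ (ζ q) = q := fun q => Prod.ext rfl (by simp only [θ, ζ, riem]; ring)
  have hρ : ContDiffOn ℝ ∞ (fun q => fderiv ℝ Ψ₁ q (0, 1) - β q) U :=
    ((h₁.fderiv_right (m := ∞) (by simp)).clm_apply contDiff_const).contDiffOn.sub hβ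
  obtain ⟨Ψ, h₀, e₀⟩ := exists_local_primitive (hU.preimage hθ.continuous)
    (hρ.comp hθ.contDiffOn (fun _ h => h)) (p := ζ p) (by simpa [hθζ] using hp)
  refine ⟨Ψ ∘ ζ, Ψ₁, h₀.comp hζ, h₁, ?_⟩
  filter_upwards [e₁, hζ.continuous.continuousAt.eventually e₀] with q k₁ k₀
  constructor
  · have hd : HasDerivAt (fun t : ℝ => (t, q.2)) (1, 0) q.1 :=
      (hasDerivAt_id _).prodMk (hasDerivAt_const _ _)
    have := HasFDerivAt.comp_hasDerivAt (x := q.1) (f := fun t : ℝ => (t, q.2)) (l := Ψ₁)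
      (h₁.differentiable (by simp) q).hasFDerivAt hd
    exact this.unique k₁
  · have hd : HasDerivAt (fun t : ℝ => (t, q.2 - q.1 ^ 2 / 2 + t ^ 2 / 2)) (1, q.1) q.1 := by
      refine (hasDerivAt_id _).prodMk ?_
      exact ((((hasDerivAt_id q.1).pow 2).div_const 2).const_add _).congr_deriv (by simp)
    have hq : (q.1, q.2 - q.1 ^ 2 / 2 + q.1 ^ 2 / 2) = q := Prod.ext rfl (by ring)
    have := HasFDerivAt.comp_hasDerivAt (x := q.1)
      (f := fun t : ℝ => (t, q.2 - q.1 ^ 2 / 2 + t ^ 2 / 2)) (l := Ψ ∘ ζ)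
      (by rw [hq]; exact ((h₀.comp hζ).differentiable (by simp) q).hasFDerivAt) hd
    have h2 : (Ψ ∘ ζ) ∘ (fun t : ℝ => (t, q.2 - q.1 ^ 2 / 2 + t ^ 2 / 2))
        = fun t => Ψ (t, (ζ q).2) := by
      funext t
      simp only [Function.comp, ζ, riem]
      congr 2
      ring
    rw [h2] at this
    have h3 := this.unique k₀
    simpa [hθζ] using h3

namespace SmoothFun

theorem ext_curve_const {U : Opens (ℝ × ℝ)} {φ : SmoothFun U} {γ γ' : ℝ → ℝ × ℝ} {s : Set ℝ}
    (hs : IsOpen s) (hs' : IsPreconnected s) (hU : ∀ t ∈ s, γ t ∈ U)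
    (hγ : ∀ t ∈ s, HasDerivAt γ (γ' t) t)
    (h : ∀ t (ht : t ∈ s), (γ' t).1 * ev ⟨γ t, hU t ht⟩ (pu φ)
      + (γ' t).2 * ev ⟨γ t, hU t ht⟩ (pv φ) = 0) {x y : ℝ} (hx : x ∈ s) (hy : y ∈ s) :
    ext φ (γ x) = ext φ (γ y) := by
  have hd : ∀ t ∈ s, HasDerivAt (ext φ ∘ γ) 0 t := fun t ht => by
    have h1 := HasFDerivAt.comp_hasDerivAt t (differentiableAt_ext φ ⟨γ t, hU t ht⟩).hasFDerivAt
      (hγ t ht)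
    rw [ev_pd_eq_add ⟨γ t, hU t ht⟩, h t ht] at h1
    exact h1
  exact hs.is_const_of_deriv_eq_zero hs' (fun t ht => (hd t ht).differentiableAt.differentiableWithinAt)
    (fun t ht => (hd t ht).deriv) hx hy

end SmoothFun

/-! ### Neighbourhoods that are boxes in the coordinates `(v - u²/2, v)`. -/

/-- A point with `u ≠ 0` has arbitrarily small neighbourhoods on which the solutions of `φ_u + u φ_v = 0`
are functions of the Riemann invariant, and those of `η_u = 0` are functions of `v`. -/
theorem exists_adapted_nhd {p : ℝ × ℝ} (hp : p.1 ≠ 0) {W : Set (ℝ × ℝ)} (hW : W ∈ 𝓝 p) :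
    ∃ V : Opens (ℝ × ℝ), p ∈ V ∧ (V : Set (ℝ × ℝ)) ⊆ W ∧ (∀ q ∈ V, q.1 ≠ 0) ∧
      (∀ φ : SmoothFun V, SmoothFun.pu φ = -(SmoothFun.cu * SmoothFun.pv φ) →
        ∃ F : ℝ → ℝ, ContDiffOn ℝ ∞ F (riem '' V) ∧ ∀ q : V, SmoothFun.ev q φ = F (riem q)) ∧
      (∀ η : SmoothFun V, SmoothFun.pu η = 0 → ∃ H : ℝ → ℝ,
        ContDiffOn ℝ ∞ H (Prod.snd '' (V : Set (ℝ × ℝ))) ∧ ∀ q : V, SmoothFun.ev q η = H q.1.2) := by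
  obtain ⟨ρ, hρ, hρW⟩ := Metric.nhds_basis_ball.mem_iff.1 hW
  have hp2 : 0 < p.1 ^ 2 := by positivity
  have hpa : 0 < |p.1| := abs_pos.2 hp
  -- The two bounds with `ρ` put the box inside the ball of radius `ρ`. The last keeps `v` minus the
  -- invariant, which equals `p.1 ^ 2 / 2` at `p`, positive on the whole box.
  obtain ⟨δ, hδ, hδρ, hδp, hδ4⟩ : ∃ δ : ℝ, 0 < δ ∧ δ ≤ ρ ∧ 4 * δ ≤ ρ * |p.1| ∧ 4 * δ < p.1 ^ 2 := by
    refine ⟨min (min ρ (ρ * |p.1| / 4)) (p.1 ^ 2 / 8), by positivity, ?_, ?_, ?_⟩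
    · exact (min_le_left _ _).trans (min_le_left _ _)
    · have : min (min ρ (ρ * |p.1| / 4)) (p.1 ^ 2 / 8) ≤ ρ * |p.1| / 4 :=
        (min_le_left _ _).trans (min_le_right _ _)
      linarith
    · have : min (min ρ (ρ * |p.1| / 4)) (p.1 ^ 2 / 8) ≤ p.1 ^ 2 / 8 := min_le_right _ _
      linarith
  -- The root of `u² = 2x` with the sign of `p.1`; it recovers `u` from `x = v - (v - u²/2)`.
  let κ : ℝ → ℝ := fun x => p.1 * √(2 * x / p.1 ^ 2)
  have κpos : ∀ x, 0 < x → 0 < κ x * p.1 := fun x hx => by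
    have : 0 < √(2 * x / p.1 ^ 2) := Real.sqrt_pos.2 (by positivity)
    have e : κ x * p.1 = p.1 ^ 2 * √(2 * x / p.1 ^ 2) := by simp only [κ]; ring
    rw [e]
    positivity
  have κsq : ∀ x, 0 < x → κ x ^ 2 = 2 * x := fun x hx => by
    simp only [κ, mul_pow]
    rw [Real.sq_sqrt (by positivity)]
    field_simp
  have κuniq : ∀ x u, 0 < u * p.1 → u ^ 2 = 2 * x → κ x = u := fun x u hu hx => by
    have hu0 : u ≠ 0 := fun h => by simp [h] at hu
    have hx0 : 0 < x := by nlinarith [sq_pos_of_ne_zero hu0]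
    have h1 : (κ x - u) * (κ x + u) = 0 := by nlinarith [κsq x hx0]
    rcases mul_eq_zero.1 h1 with h | h
    · linarith
    · nlinarith [κpos x hx0]
  have κsmooth : ContDiffOn ℝ ∞ κ (Ioi 0) := fun x hx => by
    have hx : 0 < x := hx
    have h1 : ContDiffAt ℝ ∞ (fun x : ℝ => 2 * x / p.1 ^ 2) x := by fun_prop
    exact (contDiffAt_const.mul (h1.sqrt (by positivity))).contDiffWithinAt
  have κderiv : ∀ x, 0 < x → HasDerivAt κ (κ x)⁻¹ x := fun x hx => by
    have h1 : HasDerivAt κ (deriv κ x) x :=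
      ((κsmooth.contDiffAt (Ioi_mem_nhds hx)).differentiableAt (by simp)).hasDerivAt
    have h2 : HasDerivAt (fun x => κ x ^ 2) 2 x := by
      refine HasDerivAt.congr_of_eventuallyEq (f := fun x => 2 * x) ?_ ?_
      · simpa using (hasDerivAt_id x).const_mul 2
      · filter_upwards [Ioi_mem_nhds hx] with y hy using κsq y hy
    have h3 := (h1.pow 2).unique h2
    have hne : κ x ≠ 0 := fun h => by simpa [h] using κpos x hx
    have h4 : deriv κ x = (κ x)⁻¹ := by
      refine eq_inv_of_mul_eq_one_left ?_
      simp at h3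
      linarith
    rwa [h4] at h1
  let I : Set ℝ := Metric.ball (riem p) δ
  let J : Set ℝ := Metric.ball p.2 δ
  have hIJ : ∀ s ∈ I, ∀ t ∈ J, 0 < t - s := fun s hs t ht => by
    have hs : |s - riem p| < δ := hs
    have ht : |t - p.2| < δ := ht
    rw [abs_lt] at hs ht
    simp only [riem] at hs
    linarith
  let V : Opens (ℝ × ℝ) := ⟨{q | riem q ∈ I ∧ q.2 ∈ J ∧ 0 < q.1 * p.1},
    (Metric.isOpen_ball.preimage contDiff_riem.continuous).inter
      ((Metric.isOpen_ball.preimage continuous_snd).inter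
        (isOpen_lt continuous_const (continuous_fst.mul continuous_const)))⟩
  have memV : ∀ s ∈ I, ∀ t ∈ J, (κ (t - s), t) ∈ V := fun s hs t ht => by
    refine ⟨?_, ht, κpos _ (hIJ s hs t ht)⟩
    have : riem (κ (t - s), t) = s := by
      simp only [riem, κsq _ (hIJ s hs t ht)]
      ring
    rw [this]
    exact hs
  have eqV : ∀ q ∈ V, (κ (q.2 - riem q), q.2) = q := fun q hq =>
    Prod.ext (κuniq _ _ hq.2.2 (by simp only [riem]; ring)) rfl
  have hrp : riem p ∈ I := Metric.mem_ball_self hδ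
  have hvp : p.2 ∈ J := Metric.mem_ball_self hδ
  have conn : ∀ c : ℝ, IsPreconnected (Metric.ball c δ) := fun c => (convex_ball c δ).isPreconnected
  refine ⟨V, ⟨hrp, hvp, by nlinarith⟩, fun q hq => hρW ?_, fun q hq h => ?_, fun φ hφ => ?_, fun η hη => ?_⟩
  · obtain ⟨h1, h2, h3⟩ := hq
    have h1 : |riem q - riem p| < δ := h1
    have h2 : |q.2 - p.2| < δ := h2
    rw [Metric.mem_ball, Prod.dist_eq, max_lt_iff, Real.dist_eq, Real.dist_eq]
    refine ⟨?_, h2.trans_le hδρ⟩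
    -- Since `u²` is twice the difference of the two coordinates, it varies by less than `4δ`. As
    -- `q.1` and `p.1` have the same sign, the factor `|q.1 + p.1|` is at least `|p.1|`.
    have h4 : |q.1 - p.1| * |q.1 + p.1| < 4 * δ := by
      rw [← abs_mul]
      rw [abs_lt] at h1 h2 ⊢
      simp only [riem] at h1
      constructor <;> nlinarith
    have h5 : |p.1| ≤ |q.1 + p.1| := by
      refine sq_le_sq.1 ?_
      nlinarith [sq_nonneg q.1]
    have h6 : |q.1 - p.1| * |p.1| < ρ * |p.1| :=
      (mul_le_mul_of_nonneg_left h5 (abs_nonneg _)).trans_lt (h4.trans_le hδp)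
    exact lt_of_mul_lt_mul_right h6 hpa.le
  · have := hq.2.2
    simp [h] at this
  -- `F` is the restriction of `φ` to the side `v = p.2` of the coordinate grid. The curves of
  -- constant invariant, with velocity `(1/u, 1)`, join each point to this line inside the box.
  · refine ⟨fun s => SmoothFun.ext φ (κ (p.2 - s), p.2), ?_, fun q => ?_⟩
    · refine (SmoothFun.contDiffOn_ext φ).comp (ContDiffOn.prodMk (κsmooth.comp
        (contDiffOn_const.sub contDiffOn_id) ?_) contDiffOn_const) ?_
      · rintro _ ⟨q, hq, rfl⟩
        exact hIJ _ hq.1 _ hvp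
      · rintro _ ⟨q, hq, rfl⟩
        exact memV _ hq.1 _ hvp
    · have key := SmoothFun.ext_curve_const (φ := φ) (γ := fun t => (κ (t - riem q), t))
        (γ' := fun t => ((κ (t - riem q))⁻¹, 1)) (s := J) Metric.isOpen_ball (conn _)
        (fun t ht => memV _ q.2.1 t ht)
        (fun t ht => by
          have h := (κderiv _ (hIJ _ q.2.1 t ht)).comp t ((hasDerivAt_id t).sub_const (riem q))
          exact (h.congr_deriv (by simp)).prodMk (hasDerivAt_id t))
        (fun t ht => by
          have hne : κ (t - riem q) ≠ 0 := fun h => by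
            simpa [h] using κpos _ (hIJ _ q.2.1 t ht)
          rw [hφ, map_neg, map_mul, SmoothFun.ev_cu]
          field_simp
          ring) q.2.2.1 hvp
      simp only [eqV q q.2] at key
      rw [SmoothFun.ev_apply, ← SmoothFun.ext_apply]
      exact key
  -- Likewise `H` is the restriction to the curve through `p` of constant invariant, reached along
  -- horizontal segments.
  · refine ⟨fun t => SmoothFun.ext η (κ (t - riem p), t), ?_, fun q => ?_⟩
    · refine (SmoothFun.contDiffOn_ext η).comp (ContDiffOn.prodMk (κsmooth.comp
        (contDiffOn_id.sub contDiffOn_const) ?_) contDiffOn_id) ?_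
      · rintro _ ⟨q, hq, rfl⟩
        exact hIJ _ hrp _ hq.2.1
      · rintro _ ⟨q, hq, rfl⟩
        exact memV _ hrp _ hq.2.1
    · have key := SmoothFun.ext_curve_const (φ := η) (γ := fun s => (κ (q.1.2 - s), q.1.2))
        (γ' := fun s => (-(κ (q.1.2 - s))⁻¹, 0)) (s := I) Metric.isOpen_ball (conn _)
        (fun s hs => memV s hs _ q.2.2.1)
        (fun s hs => by
          have h := (κderiv _ (hIJ s hs _ q.2.2.1)).comp s ((hasDerivAt_id s).const_sub q.1.2)
          exact (h.congr_deriv (by simp)).prodMk (hasDerivAt_const _ _))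
        (fun s hs => by simp [hη]) q.2.1 hrp
      simp only [eqV q q.2] at key
      rw [SmoothFun.ev_apply, ← SmoothFun.ext_apply]
      exact key

/-! ### Reduction of an integrable deformation to the normal form. -/

namespace DiffFun

open SmoothFun

theorem IsLin.smul {U : Opens (ℝ × ℝ)} {P : DiffFun U} (hP : IsLin P) (r : ℝ) : IsLin (r • P) := by
  rw [Algebra.smul_def, ← AlgHom.commutes coef]
  exact hP.coef_mul _

/-- Near a point with `u ≠ 0`, a Miura transformation carries an integrable deformation to the normal
form. -/
theorem exists_miuraCarries {U : Set (ℝ × ℝ)} {a : Coeffs} (hU : IsOpen U) (hd : IsDeformation U a)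
    (hi : IntegrableUpToTwo U a) {p : ℝ × ℝ} (hp : p ∈ U) (hp0 : p.1 ≠ 0) :
    ∃ V : Set (ℝ × ℝ), IsOpen V ∧ p ∈ V ∧ V ⊆ U ∧ (∀ q ∈ V, q.1 ≠ 0) ∧
      ∃ F G H : ℝ → ℝ,
        ContDiffOn ℝ ∞ F (riem '' V) ∧ ContDiffOn ℝ ∞ G (riem '' V) ∧
        ContDiffOn ℝ ∞ H (Prod.snd '' V) ∧
        ∃ (M : Fin 2 → ℝ × ℝ → ℝ) (N : Fin 2 → Fin 2 → ℝ × ℝ → ℝ),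
          (∀ i, ContDiffOn ℝ ∞ (M i) V) ∧ (∀ i k, ContDiffOn ℝ ∞ (N i k) V) ∧
          MiuraCarries V M N a (normalForm F G H) := by
  have hsym : IsDispersionlessSymmetry U a ![riem, 0] := by
    refine ⟨fun i => ?_, ?_⟩
    · fin_cases i
      exacts [contDiff_riem.contDiffOn, contDiffOn_const]
    · refine (isDispersionlessSymmetry_iff (U := ⟨U, hU⟩) hd.2 (h₁ := riemFun) (h₂ := 0)
        ev_riemFun fun _ => rfl).2 ⟨by simp, ?_⟩
      rw [pv_riemFun, pu_riemFun, map_zero]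
      ring
  obtain ⟨b, hb, hb0, hab⟩ := hi _ hsym
  have hU₀ : IsOpen (U ∩ {q | q.1 ≠ 0}) := hU.inter (isOpen_ne_fun continuous_fst continuous_const)
  have hinv : ContDiffOn ℝ ∞ (fun q : ℝ × ℝ => q.1⁻¹) (U ∩ {q | q.1 ≠ 0}) :=
    contDiffOn_fst.inv fun q hq => hq.2
  -- The right-hand sides `a₂₁ / u²` and `a₁₂ / u` are those that make the first-order part
  -- diagonal.
  obtain ⟨Ψ₀, Ψ₁, hΨ₀, hΨ₁, hΨ⟩ := exists_local_solution hU₀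
    (((hd.1 1 1).mono inter_subset_left).mul (hinv.pow 2))
    (((hd.1 0 2).mono inter_subset_left).mul hinv) (p := p) ⟨hp, hp0⟩
  obtain ⟨V, hpV, hVW, hV0, hVF, hVH⟩ := exists_adapted_nhd hp0
    (Filter.inter_mem (hU.mem_nhds hp) hΨ)
  have hVU : (V : Set (ℝ × ℝ)) ⊆ U := fun q hq => (hVW hq).1
  let w : SmoothFun V := SmoothFun.mk (fun q => q.1⁻¹) (contDiffOn_fst.inv hV0)
  have hw : cu * w = 1 := SmoothFun.eq_of_ev fun q => by
    simp only [map_mul, ev_cu, w, ev_mk, map_one]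
    exact mul_inv_cancel₀ (hV0 q q.2)
  let x : Fin 2 → Fin 8 → SmoothFun V := fun i k => SmoothFun.mk (a i k) ((hd.1 i k).mono hVU)
  let y : Fin 2 → Fin 8 → SmoothFun V := fun i k => SmoothFun.mk (b i k) ((hb i k).mono hVU)
  have hx₀ : part₀ x = flow₀ := by
    funext i
    have h := fun q : V => hd.2 i q (hVU q.2)
    fin_cases i
    · refine congrArg coef (SmoothFun.eq_of_ev fun q => (h q).trans ?_)
      simp [flow21]
    · refine congrArg coef (SmoothFun.eq_of_ev fun q => (h q).trans ?_)
      simp [flow21]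
  have hy₀ : part₀ y = ![coef riemFun, coef 0] := by
    funext i
    have h := fun q : V => hb0 i q (hVU q.2)
    fin_cases i
    · exact congrArg coef (SmoothFun.eq_of_ev fun q => (h q).trans (ev_riemFun q).symm)
    · exact congrArg coef (SmoothFun.eq_of_ev fun q => h q)
  obtain ⟨h₀, h₁, h₂⟩ := (commuteUpToTwo_iff (U := V) (x := x) (y := y) (a := a) (b := b)
    (fun _ _ _ => rfl) fun _ _ _ => rfl).1 fun j hj => hab j (hVU hj)
  let m : Fin 2 → SmoothFun V := ![SmoothFun.mk Ψ₀ hΨ₀.contDiffOn, SmoothFun.mk Ψ₁ hΨ₁.contDiffOn]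
  have hm₀ : ∀ q : V, SmoothFun.ev q (m 0) = Ψ₀ q := fun _ => rfl
  have hm₁ : ∀ q : V, SmoothFun.ev q (m 1) = Ψ₁ q := fun _ => rfl
  have hM₁ : pu (m 1) = x 1 1 * w ^ 2 := SmoothFun.eq_of_ev fun q => by
    rw [ev_pd_of_eq _ hm₁]
    exact (hVW q.2).2.1
  have hM₀ : pu (m 0) + cu * pv (m 0) = pv (m 1) - x 0 2 * w := SmoothFun.eq_of_ev fun q => by
    have h := (hVW q.2).2.2
    have e : ((1, q.1.1) : ℝ × ℝ) = (1, 0) + q.1.1 • (0, 1) := by simp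
    rw [e, map_add, map_smul, smul_eq_mul] at h
    rw [map_add, map_mul, map_sub, ev_pd_of_eq _ hm₀, ev_pd_of_eq _ hm₀, ev_pd_of_eq _ hm₁]
    exact h
  obtain ⟨φ, γ, η, n, hφ, hγ, hη, e₁, e₂⟩ := exists_normal hw hx₀ hy₀ h₀ h₁ h₂ hM₁ hM₀
  obtain ⟨F, hF, hF'⟩ := hVF φ hφ
  obtain ⟨G, hG, hG'⟩ := hVF γ hγ
  obtain ⟨H, hH, hH'⟩ := hVH η hη
  -- The functions `N` combine the normalising potential `n` with the quadratic correction from the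
  -- exponential of `M`; that correction is linear in `uₓ, vₓ`, so it fits the prescribed form.
  have hN : ∀ i, ∃ c : Fin 2 → SmoothFun V,
      lin c = lin (n i) + (1 / 2 : ℝ) • cl (fun k => coef (m k)) (coef (m i)) := fun i => by
    obtain ⟨c, d, h⟩ := (isLin_lin (n i)).add ((isLin_cl_coef m (m i)).smul (1 / 2))
    exact ⟨_, h.symm⟩
  choose c hc using hN
  refine ⟨V, V.2, hpV, hVU, hV0, F, G, H, hF, hG, hH, fun i => SmoothFun.ext (m i),
    fun i k => SmoothFun.ext (c i k), fun i => SmoothFun.contDiffOn_ext _,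
    fun i k => SmoothFun.contDiffOn_ext _, ?_⟩
  refine miuraCarries_of_exp (x := x) (x' := normalFormFun φ γ η w) (fun _ _ _ => rfl)
    (ev_normalFormFun hw hF' hG' hH') (fun i q => (SmoothFun.ext_apply (m i) q).symm)
    (fun i k q => (SmoothFun.ext_apply (c i k) q).symm) (K₂ := fun i => lin (n i)) ?_ ?_ ?_ hc
  · rw [hx₀, part₀_normalFormFun]
  · rw [hx₀, e₁]
  · rw [hx₀, e₂]

end DiffFun
end ConsLaw

theorem mainTheorem5 :
    (∀ (U : Set (ℝ × ℝ)) (a : Coeffs), IsOpen U → IsDeformation U a → IntegrableUpToTwo U a →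
      ∀ p ∈ U, p.1 ≠ 0 →
        ∃ V : Set (ℝ × ℝ), IsOpen V ∧ p ∈ V ∧ V ⊆ U ∧ (∀ q ∈ V, q.1 ≠ 0) ∧
          ∃ F G H : ℝ → ℝ,
            ContDiffOn ℝ ∞ F (riem '' V) ∧ ContDiffOn ℝ ∞ G (riem '' V) ∧
            ContDiffOn ℝ ∞ H (Prod.snd '' V) ∧
            ∃ (M : Fin 2 → ℝ × ℝ → ℝ) (N : Fin 2 → Fin 2 → ℝ × ℝ → ℝ),
              (∀ i, ContDiffOn ℝ ∞ (M i) V) ∧ (∀ i k, ContDiffOn ℝ ∞ (N i k) V) ∧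
              MiuraCarries V M N a (normalForm F G H)) ∧
    (∀ (U : Set (ℝ × ℝ)) (F G H : ℝ → ℝ), IsOpen U → (∀ q ∈ U, q.1 ≠ 0) →
      ContDiffOn ℝ ∞ F (riem '' U) → ContDiffOn ℝ ∞ G (riem '' U) →
      ContDiffOn ℝ ∞ H (Prod.snd '' U) →
        IsDeformation U (normalForm F G H) ∧ IntegrableUpToTwo U (normalForm F G H)) :=
  ⟨fun _ _ hU hd hi _ hp hp0 => DiffFun.exists_miuraCarries hU hd hi hp hp0,
    fun U _ _ _ hU h0 hF hG hH => DiffFun.isDeformation_normalForm (U := ⟨U, hU⟩) h0 hF hG hH⟩
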